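/- Let $p$ be a prime and let $R$ be a semiperfect ring of characteristic $p$, i.e. an $\mathbb{F}_p$-algebra $R\neq 0$ whose Frobenius $\phi$ is surjective. Call a semiperfect ring $R'$ *balanced* if $\operatorname{Ker}(\phi:R'\to R')^p=0$, and assume that $R$ is *iso-balanced*, i.e. that there is a surjective ring homomorphism $R\to R'$ onto a balanced semiperfect ring $R'$ whose kernel is annihilated by a power of $\phi$. A *frame* consists of a ring $S$, an ideal $\operatorname{Fil}^1S$ with $pS+\operatorname{Fil}^1S\subseteq\operatorname{Rad}(S)$, a ring endomorphism $\sigma$ of $S$ with $\sigma(a)\equiv a^p \bmod pS$, and a $\sigma$-linear map $\sigma_1:\operatorname{Fil}^1S\to S$ whose image generates the unit ideal. A *window* over it is a quadruple $(P,Q,\Phi,\Phi_1)$ where $P$ is a finite projective $S$-module, $Q\subseteq P$ is a submodule such that $P=L\oplus T$ and $Q=L\oplus(\operatorname{Fil}^1S)T$ for suitable submodules $L,T$, and $\Phi:P\to P$, $\Phi_1:Q\to P$ are $\sigma$-linear maps with $\Phi_1(ax)=\sigma_1(a)\Phi(x)$ for $a\in\operatorname{Fil}^1S$, $x\in P$,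 such that $\Phi_1(Q)$ generates $P$. A *frame homomorphism* $\alpha:S\to S'$ is a ring homomorphism with $\alpha(\operatorname{Fil}^1S)\subseteq\operatorname{Fil}^1S'$, $\sigma'\alpha=\alpha\sigma$ and $\sigma_1'\alpha=u\cdot\alpha\sigma_1$ for a unit $u\in S'$; it is *crystalline* if the base change functor $P\mapsto S'\otimes_SP$ from windows over $S$ to windows over $S'$ is an equivalence of categories. Let $R^\flat=\varprojlim_\phi R$ and $J=\operatorname{Ker}(R^\flat\to R)$. Let $A_{\mathrm{cris}}(R)$ be the $p$-adic completion of the divided power envelope, compatible with the divided powers of $p\mathbb{Z}_p$, of the homomorphism $W(R^\flat)\to R$. It is a frame with $\operatorname{Fil}^1=\operatorname{Ker}(A_{\mathrm{cris}}(R)\to R)$, with $\sigma$ induced by the Frobenius of $W(R^\flat)$, and with the $\sigma$-linear map $\sigma_1$ given by $\sigma_1(p)=1$ and $\sigma_1([x]^{[n]})=\frac{(pn)!}{p\cdot n!}[x]^{[pn]}$ for $x\in J$ and $n\ge 1$. Let $J_i=J^{p^i}$ for $i\ge 0$, let $W(J_*)\subseteq W(R^\flat)$ be the ideal of all Witt vectors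 $(a_0,a_1,\ldots)$ with $a_i\in J_i$, and let $A(J_*)=W(R^\flat)/W(J_*)$; this is a frame with $\operatorname{Fil}^1=pA(J_*)$, with $\sigma$ induced by the Frobenius of $W(R^\flat)$, and with $\sigma_1(pa)=\sigma(a)$. Let $$\varkappa:A_{\mathrm{cris}}(R)\to A(J_*)$$ be the unique homomorphism that is compatible with the projections from $W(R^\flat)$ and with divided powers, where $pA(J_*)$ carries the divided powers $(pa)^{[n]}=\frac{p^n}{n!}a^n$; it is a frame homomorphism (with $u=1$). Then $\varkappa$ is crystalline. -/

import Mathlib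

namespace SemiperfectFrames

universe u

noncomputable section

section FramesAndWindows

open CategoryTheory
open scoped TensorProduct

/-! ## Frames and windows -/

/-- A frame `(S, Fil¹ S, R, σ, σ₁)` (for the prime `p`), where `R = S / Fil¹ S`. -/
structure Frame (p : ℕ) where
  /-- the ring `S` -/
  S : Type u
  [commRing : CommRing S]
  /-- the ideal `Fil¹ S` -/
  Fil : Ideal S
  /-- the Frobenius lift -/
  σ : S →+* S
  /-- the `σ`-linear map `σ₁ : Fil¹ S → S` -/
  σ₁ : Fil →ₛₗ[σ] S
  le_jacobson : Ideal.span {(p : S)} ⊔ Fil ≤ (⊥ : Ideal S).jacobson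
  frobenius_lift : ∀ a : S, σ a - a ^ p ∈ Ideal.span {(p : S)}
  span_σ₁ : Ideal.span (Set.range σ₁) = ⊤

attribute [instance] Frame.commRing

/-- A frame homomorphism; `u` is the unit with `σ₁' ∘ α = u • α ∘ σ₁`. -/
structure Frame.Hom {p : ℕ} (F G : Frame.{u} p) where
  toRingHom : F.S →+* G.S
  map_fil : ∀ a ∈ F.Fil, toRingHom a ∈ G.Fil
  map_σ : ∀ a, G.σ (toRingHom a) = toRingHom (F.σ a)
  u : G.Sˣ
  map_σ₁ : ∀ a : F.Fil, G.σ₁ ⟨toRingHom a, map_fil a a.2⟩ = u * toRingHom (F.σ₁ a)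

/-- A window `(P, Q, Φ, Φ₁)` over a frame: `P` is a finite projective `S`-module, `Q = Fil¹ P` is a
submodule that admits a normal decomposition, and `Φ : P → P` and `Φ₁ : Q → P` are `σ`-linear. -/
structure Window {p : ℕ} (F : Frame.{u} p) where
  P : Type u
  [addCommGroup : AddCommGroup P]
  [module : Module F.S P]
  [finite : Module.Finite F.S P]
  [projective : Module.Projective F.S P]
  Q : Submodule F.S P
  Φ : P →ₛₗ[F.σ] P
  Φ₁ : Q →ₛₗ[F.σ] P
  exists_normal : ∃ L T : Submodule F.S P, IsCompl L T ∧ Q = L ⊔ F.Fil • T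
  Φ₁_smul : ∀ (a : F.Fil) (x : P) (h : (a : F.S) • x ∈ Q), Φ₁ ⟨(a : F.S) • x, h⟩ = F.σ₁ a • Φ x
  span_Φ₁ : Submodule.span F.S (Set.range Φ₁) = ⊤

attribute [instance] Window.addCommGroup Window.module Window.finite Window.projective

namespace Window

variable {p : ℕ} {F : Frame.{u} p}

/-- Homomorphisms of windows. -/
@[ext]
structure Hom (M N : Window F) where
  toLin : M.P →ₗ[F.S] N.P
  map_Q : ∀ x ∈ M.Q, toLin x ∈ N.Q
  map_Φ : ∀ x, toLin (M.Φ x) = N.Φ (toLin x)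
  map_Φ₁ : ∀ x : M.Q, toLin (M.Φ₁ x) = N.Φ₁ ⟨toLin x, map_Q x x.2⟩

/-- The category `Win(F)` of windows over the frame `F`. -/
instance : Category (Window F) where
  Hom M N := Hom M N
  id M := ⟨LinearMap.id, fun _ h => h, fun _ => rfl, fun _ => rfl⟩
  comp f g := ⟨g.toLin.comp f.toLin, fun x h => g.map_Q _ (f.map_Q x h),
    fun x => by simp [f.map_Φ, g.map_Φ], fun x => by
      simp only [LinearMap.comp_apply, f.map_Φ₁, g.map_Φ₁]⟩

theorem smul_mem_Q (M : Window F) (a : F.Fil) (x : M.P) : (a : F.S) • x ∈ M.Q := by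
  obtain ⟨L, T, h, hQ⟩ := M.exists_normal
  have hx : x ∈ L ⊔ T := by rw [h.sup_eq_top]; trivial
  obtain ⟨l, hl, t, ht, rfl⟩ := Submodule.mem_sup.1 hx
  rw [hQ, smul_add]
  exact Submodule.add_mem_sup (L.smul_mem _ hl) (Submodule.smul_mem_smul a.2 ht)

end Window

/-! ## Base change of windows -/

section Aux

variable {S S' : Type u} [CommRing S] [CommRing S'] [Algebra S S'] {σ : S →+* S} {σ' : S' →+* S'}
  {P : Type u} [AddCommGroup P] [Module S P]

/-- The `σ'`-linear extension `a ⊗ x ↦ σ' a • g x` of a map `g` on `P`. -/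
def semilinearExtend (hσ : ∀ s, σ' (algebraMap S S' s) = algebraMap S S' (σ s))
    {P' : Type u} [AddCommGroup P'] [Module S' P'] (g : P →+ P')
    (hg : ∀ s x, g (s • x) = algebraMap S S' (σ s) • g x) : (S' ⊗[S] P) →ₛₗ[σ'] P' where
  toFun := TensorProduct.liftAddHom
    { toFun := fun a => (DistribSMul.toAddMonoidHom P' (σ' a)).comp g
      map_zero' := by ext; simp
      map_add' := fun a b => by ext; simp [add_smul] }
    (fun r m n => by
      change σ' (r • m) • g n = σ' m • g (r • n)
      rw [hg, Algebra.smul_def, map_mul, hσ, mul_comm, mul_smul])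
  map_add' := map_add _
  map_smul' := fun r x => by
    induction x using TensorProduct.induction_on with
    | zero => simp
    | tmul a x => simp [TensorProduct.smul_tmul', mul_smul]
    | add x y hx hy => simp only [smul_add, map_add, hx, hy]

@[simp]
theorem semilinearExtend_tmul (hσ : ∀ s, σ' (algebraMap S S' s) = algebraMap S S' (σ s))
    {P' : Type u} [AddCommGroup P'] [Module S' P'] (g : P →+ P')
    (hg : ∀ s x, g (s • x) = algebraMap S S' (σ s) • g x) (a : S') (x : P) :
    semilinearExtend (σ' := σ') hσ g hg (a ⊗ₜ[S] x) = σ' a • g x := rfl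

/-- For a flat module `P` the map `a • x ↦ σ₁ a • Φ x` on `I • P` is well-defined. -/
theorem exists_idealSMul [Module.Flat S P] {I : Ideal S} (σ₁ : I →ₛₗ[σ] S) (Φ : P →ₛₗ[σ] P) :
    ∃ m : ↥(I • (⊤ : Submodule S P)) →ₛₗ[σ] P, ∀ (a : I) (x : P) (h : (a : S) • x ∈ I • ⊤),
      m ⟨(a : S) • x, h⟩ = σ₁ a • Φ x := by
  let μ : (I ⊗[S] P) →+ P := TensorProduct.liftAddHom
    { toFun := fun a => (DistribSMul.toAddMonoidHom P (σ₁ a)).comp Φ.toAddMonoidHom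
      map_zero' := by ext; simp
      map_add' := fun a b => by ext; simp [add_smul] }
    (fun r m n => by
      change σ₁ (r • m) • Φ n = σ₁ m • Φ (r • n)
      rw [map_smulₛₗ, map_smulₛₗ, smul_eq_mul, mul_comm, mul_smul])
  have hμ : ∀ (a : I) (x : P), μ (a ⊗ₜ x) = σ₁ a • Φ x := fun a x => rfl
  have hμs : ∀ (s : S) t, μ (s • t) = σ s • μ t := by
    intro s t
    induction t using TensorProduct.induction_on with
    | zero => simp
    | tmul a x => simp [TensorProduct.smul_tmul', hμ, mul_smul]
    | add x y hx hy => simp only [smul_add, map_add, hx, hy]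
  let ν : (I ⊗[S] P) →ₗ[S] P := (TensorProduct.lid S P).toLinearMap ∘ₗ (LinearMap.rTensor P I.subtype)
  have hν : ∀ (a : I) (x : P), ν (a ⊗ₜ x) = (a : S) • x := fun a x => by simp [ν]
  have hinj : Function.Injective ν := by
    simp only [ν, LinearMap.coe_comp, LinearEquiv.coe_coe]
    exact (TensorProduct.lid S P).injective.comp
      (Module.Flat.rTensor_preserves_injective_linearMap _ I.subtype_injective)
  have hsurj : ∀ y ∈ I • (⊤ : Submodule S P), ∃ t, ν t = y := by
    intro y hy
    induction hy using Submodule.smul_induction_on' with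
    | smul r hr n hn => exact ⟨(⟨r, hr⟩ : I) ⊗ₜ n, by simp [hν]⟩
    | add x hx y hy h1 h2 =>
      obtain ⟨t, rfl⟩ := h1
      obtain ⟨t', rfl⟩ := h2
      exact ⟨t + t', map_add _ _ _⟩
  choose c hc using hsurj
  refine ⟨{ toFun := fun y => μ (c y.1 y.2), map_add' := ?_, map_smul' := ?_ }, ?_⟩
  · intro x y
    rw [← map_add]
    congr 1
    apply hinj
    simp [hc]
  · intro s x
    rw [← hμs]
    congr 1
    apply hinj
    simp [hc]
  · intro a x h
    rw [← hμ]
    change μ _ = μ _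
    congr 1
    apply hinj
    simp [hc, hν]

end Aux

namespace Frame.Hom

variable {p : ℕ} {F G : Frame.{u} p} (α : Frame.Hom F G)

/-- The ring homomorphism underlying a frame homomorphism, as an algebra structure. -/
abbrev algebra : Algebra F.S G.S := α.toRingHom.toAlgebra

variable (M : Window F)

/-- The underlying module `S' ⊗_S P` of the base change. -/
abbrev BaseModule : Type u :=
  letI := α.algebra
  G.S ⊗[F.S] M.P

/-- The map `x ↦ 1 ⊗ x`. -/
def toBase : M.P →+ α.BaseModule M :=
  letI := α.algebra
  { toFun := fun x => (1 : G.S) ⊗ₜ[F.S] x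
    map_zero' := by simp
    map_add' := fun x y => TensorProduct.tmul_add _ _ _ }

theorem toBase_smul (s : F.S) (x : M.P) :
    α.toBase M (s • x) = α.toRingHom s • α.toBase M x := by
  let _ := α.algebra
  simp only [toBase, AddMonoidHom.coe_mk, ZeroHom.coe_mk, TensorProduct.tmul_smul,
    TensorProduct.smul_tmul', smul_eq_mul, mul_one, Algebra.smul_def]
  rfl

theorem span_toBase : Submodule.span G.S (Set.range (α.toBase M)) = ⊤ := by
  let _ := α.algebra
  rw [eq_top_iff]
  intro y _
  induction y using TensorProduct.induction_on with
  | zero => exact Submodule.zero_mem _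
  | tmul a x =>
    have : a ⊗ₜ[F.S] x = a • α.toBase M x := by
      change _ = a • ((1 : G.S) ⊗ₜ[F.S] x)
      simp [TensorProduct.smul_tmul']
    rw [this]
    exact Submodule.smul_mem _ _ (Submodule.subset_span ⟨x, rfl⟩)
  | add x y hx hy => exact Submodule.add_mem _ (hx trivial) (hy trivial)

/-- `Q'`, the submodule generated by the image of `Q` and by `Fil¹ S' • P'`. -/
def baseQ : Submodule G.S (α.BaseModule M) :=
  Submodule.span G.S (α.toBase M '' (M.Q : Set M.P)) ⊔ G.Fil • ⊤

theorem toBase_mem_baseQ {x : M.P} (hx : x ∈ M.Q) : α.toBase M x ∈ α.baseQ M :=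
  Submodule.mem_sup_left (Submodule.subset_span ⟨x, hx, rfl⟩)

theorem smul_mem_baseQ (a : G.Fil) (y : α.BaseModule M) : (a : G.S) • y ∈ α.baseQ M :=
  Submodule.mem_sup_right (Submodule.smul_mem_smul a.2 trivial)

/-- The `σ'`-linear extension `Φ'` of `Φ`. -/
def baseΦ : α.BaseModule M →ₛₗ[G.σ] α.BaseModule M :=
  letI := α.algebra
  semilinearExtend (σ := F.σ) α.map_σ ((α.toBase M).comp M.Φ.toAddMonoidHom)
    (fun s x => by
      change α.toBase M (M.Φ (s • x)) = _
      rw [map_smulₛₗ]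
      exact α.toBase_smul M (F.σ s) (M.Φ x))

theorem baseΦ_toBase (x : M.P) : α.baseΦ M (α.toBase M x) = α.toBase M (M.Φ x) := by
  let _ := α.algebra
  change semilinearExtend _ _ _ _ = _
  exact (semilinearExtend_tmul _ _ _ _ _).trans (by simp)

theorem semilinear_ext {N : Type u} [AddCommGroup N] [Module G.S N] {τ : G.S →+* G.S}
    {f g : α.BaseModule M →ₛₗ[τ] N} (h : ∀ x, f (α.toBase M x) = g (α.toBase M x)) : f = g :=
  LinearMap.ext_on (α.span_toBase M) (by rintro _ ⟨x, rfl⟩; exact h x)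

/-- The base change of a linear map. -/
def baseMap {M N : Window F} (f : M.P →ₗ[F.S] N.P) : α.BaseModule M →ₗ[G.S] α.BaseModule N :=
  letI := α.algebra
  f.baseChange G.S

theorem baseMap_toBase {M N : Window F} (f : M.P →ₗ[F.S] N.P) (x : M.P) :
    α.baseMap f (α.toBase M x) = α.toBase N (f x) := by
  let _ := α.algebra
  exact LinearMap.baseChange_tmul _ _ _

theorem toBase_mem_smul {x : M.P} {T : Submodule F.S M.P} (hx : x ∈ F.Fil • T) :
    α.toBase M x ∈ G.Fil • Submodule.span G.S (α.toBase M '' (T : Set M.P)) := by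
  induction hx using Submodule.smul_induction_on' with
  | smul a ha n hn =>
    rw [toBase_smul]
    exact Submodule.smul_mem_smul (α.map_fil a ha) (Submodule.subset_span ⟨n, hn, rfl⟩)
  | add x hx y hy h1 h2 => rw [map_add]; exact Submodule.add_mem _ h1 h2

theorem exists_baseΦ₁ : ∃ m : α.baseQ M →ₛₗ[G.σ] α.BaseModule M,
    (∀ x : M.Q, m ⟨α.toBase M x, α.toBase_mem_baseQ M x.2⟩ = (α.u : G.S) • α.toBase M (M.Φ₁ x)) ∧
    ∀ (a : G.Fil) (y : α.BaseModule M),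
      m ⟨(a : G.S) • y, α.smul_mem_baseQ M a y⟩ = G.σ₁ a • α.baseΦ M y := by
  obtain ⟨L, T, hLT, hQ⟩ := M.exists_normal
  have hLQ : L ≤ M.Q := hQ ▸ le_sup_left
  let pL : M.P →ₗ[F.S] L := L.projectionOnto T hLT
  let pT : M.P →ₗ[F.S] M.P := LinearMap.id - L.subtype ∘ₗ pL
  have hpL : ∀ x ∈ L, (pL x : M.P) = x := fun x hx => by
    simp [pL, Submodule.projectionOnto_apply_left hLT ⟨x, hx⟩]
  have hpT0 : ∀ x ∈ T, pL x = 0 := fun x hx => by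
    simpa [pL] using hx
  have hsplit : ∀ x, (pL x : M.P) + pT x = x := fun x => by simp [pT]
  let g : M.P →+ α.BaseModule M :=
    { toFun := fun x => (α.u : G.S) • α.toBase M (M.Φ₁ ⟨pL x, hLQ (pL x).2⟩)
      map_zero' := by
        have : (⟨pL 0, hLQ (pL 0).2⟩ : M.Q) = 0 := by ext; simp
        rw [this]; simp
      map_add' := fun x y => by
        have : (⟨pL (x + y), hLQ (pL (x + y)).2⟩ : M.Q) =
          ⟨pL x, hLQ (pL x).2⟩ + ⟨pL y, hLQ (pL y).2⟩ := by ext; simp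
        rw [this, map_add, map_add, smul_add] }
  have hg : ∀ s x, g (s • x) = α.toRingHom (F.σ s) • g x := fun s x => by
    have : (⟨pL (s • x), hLQ (pL (s • x)).2⟩ : M.Q) = s • ⟨pL x, hLQ (pL x).2⟩ := by ext; simp
    change (α.u : G.S) • α.toBase M (M.Φ₁ _) = _ • ((α.u : G.S) • α.toBase M (M.Φ₁ _))
    rw [this, map_smulₛₗ, toBase_smul, smul_comm]
  let E : α.BaseModule M →ₛₗ[G.σ] α.BaseModule M :=
    letI := α.algebra
    semilinearExtend (σ := F.σ) α.map_σ g hg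
  have hE : ∀ x, E (α.toBase M x) = g x := fun x => by
    let _ := α.algebra
    exact (semilinearExtend_tmul (σ' := G.σ) α.map_σ g hg 1 x).trans (by simp)
  have : Module.Flat G.S (α.BaseModule M) := by
    let _ := α.algebra
    infer_instance
  obtain ⟨m₀, hm₀⟩ := exists_idealSMul G.σ₁ (α.baseΦ M)
  have hTmem : ∀ y ∈ α.baseQ M, α.baseMap pT y ∈ G.Fil • (⊤ : Submodule G.S (α.BaseModule M)) := by
    intro y hy
    have : α.baseQ M ≤ (G.Fil • (⊤ : Submodule G.S (α.BaseModule M))).comap (α.baseMap pT) := by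
      rw [baseQ, sup_le_iff, Submodule.span_le]
      constructor
      · rintro _ ⟨x, hx, rfl⟩
        rw [SetLike.mem_coe, Submodule.mem_comap, baseMap_toBase]
        have hx' : x ∈ L ⊔ F.Fil • T := hQ ▸ hx
        obtain ⟨l, hl, z, hz, rfl⟩ := Submodule.mem_sup.1 hx'
        have hzT : z ∈ T := (Submodule.smul_le_right (I := F.Fil)) hz
        have : pT (l + z) = z := by simp [pT, hpL l hl, hpT0 z hzT]
        rw [this]
        exact Submodule.smul_mono le_rfl le_top (α.toBase_mem_smul M hz)
      · rw [← Submodule.map_le_iff_le_comap, Submodule.map_smul'']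
        exact Submodule.smul_mono le_rfl le_top
    exact this hy
  let pT' : α.baseQ M →ₗ[G.S] ↥(G.Fil • (⊤ : Submodule G.S (α.BaseModule M))) :=
    (α.baseMap pT).restrict hTmem
  have key : ∀ (a : G.Fil) (y : α.BaseModule M),
      G.σ a • E y = G.σ₁ a • α.baseΦ M (y - α.baseMap pT y) := by
    intro a y
    have : (G.σ a • E) = (G.σ₁ a • α.baseΦ M ∘ₛₗ (LinearMap.id - α.baseMap pT)) := by
      apply α.semilinear_ext M
      intro x
      simp only [LinearMap.smul_apply, LinearMap.comp_apply, LinearMap.sub_apply,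
        LinearMap.id_apply, baseMap_toBase, hE, ← map_sub, baseΦ_toBase]
      have hx : x - pT x = pL x := by rw [sub_eq_iff_eq_add, hsplit]
      rw [hx]
      change G.σ a • (α.u : G.S) • α.toBase M (M.Φ₁ _) = _
      set l : M.Q := ⟨pL x, hLQ (pL x).2⟩ with hl
      have hall : ∀ c ∈ Ideal.span (Set.range F.σ₁), α.toRingHom c •
          (G.σ a • (α.u : G.S) • α.toBase M (M.Φ₁ l) - G.σ₁ a • α.toBase M (M.Φ l)) = 0 := by
        intro c hc
        induction hc using Submodule.span_induction with
        | mem c hc =>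
          obtain ⟨b, rfl⟩ := hc
          have h1 : F.σ₁ b • M.Φ l = F.σ b • M.Φ₁ l := by
            rw [← M.Φ₁_smul b l (M.smul_mem_Q b l), ← map_smulₛₗ]
            rfl
          have h2 : α.toRingHom (F.σ₁ b) • α.toBase M (M.Φ l) =
              G.σ (α.toRingHom b) • α.toBase M (M.Φ₁ l) := by
            rw [← toBase_smul, h1, toBase_smul, α.map_σ]
          have h3 : G.σ a * G.σ₁ ⟨α.toRingHom b, α.map_fil b b.2⟩ =
              G.σ (α.toRingHom b) * G.σ₁ a := by
            rw [← smul_eq_mul, ← map_smulₛₗ, ← smul_eq_mul (a := G.σ (α.toRingHom b)),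
              ← map_smulₛₗ]
            congr 1
            ext
            simp [mul_comm]
          rw [α.map_σ₁] at h3
          rw [smul_sub, smul_comm _ (G.σ₁ a), h2, smul_smul, smul_smul, smul_smul, sub_eq_zero]
          congr 1
          linear_combination h3
        | zero => simp
        | add c d _ _ h1 h2 => rw [map_add, add_smul, h1, h2, add_zero]
        | smul r c _ h1 => rw [smul_eq_mul, map_mul, mul_smul, h1, smul_zero]
      have h1 := hall 1 (by rw [F.span_σ₁]; trivial)
      rw [map_one, one_smul, sub_eq_zero] at h1
      exact h1
    have := congrArg (fun f => f y) this
    simpa using this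
  refine ⟨E ∘ₛₗ (α.baseQ M).subtype + m₀ ∘ₛₗ pT', ?_, ?_⟩
  · intro x
    have hz : ∀ z (hz : z ∈ F.Fil • (⊤ : Submodule F.S M.P)), ∃ hzQ : z ∈ M.Q,
        ∃ hz' : α.toBase M z ∈ G.Fil • (⊤ : Submodule G.S (α.BaseModule M)),
        m₀ ⟨α.toBase M z, hz'⟩ = (α.u : G.S) • α.toBase M (M.Φ₁ ⟨z, hzQ⟩) := by
      intro z hz
      induction hz using Submodule.smul_induction_on' with
      | smul a ha n hn =>
        refine ⟨M.smul_mem_Q ⟨a, ha⟩ n, ?_, ?_⟩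
        · rw [toBase_smul]
          exact Submodule.smul_mem_smul (α.map_fil a ha) trivial
        · have h1 := hm₀ ⟨α.toRingHom a, α.map_fil a ha⟩ (α.toBase M n)
            (Submodule.smul_mem_smul (α.map_fil a ha) trivial)
          rw [α.map_σ₁ ⟨a, ha⟩, baseΦ_toBase] at h1
          have h2 := M.Φ₁_smul ⟨a, ha⟩ n (M.smul_mem_Q ⟨a, ha⟩ n)
          simp only [toBase_smul]
          rw [h1, h2, toBase_smul, smul_smul]
      | add x hx y hy h1 h2 =>
        obtain ⟨a1, b1, c1⟩ := h1
        obtain ⟨a2, b2, c2⟩ := h2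
        refine ⟨M.Q.add_mem a1 a2, by rw [map_add]; exact Submodule.add_mem _ b1 b2, ?_⟩
        have e1 : (⟨x + y, M.Q.add_mem a1 a2⟩ : M.Q) = ⟨x, a1⟩ + ⟨y, a2⟩ := rfl
        have e2 : m₀ ⟨α.toBase M (x + y), by rw [map_add]; exact Submodule.add_mem _ b1 b2⟩ =
            m₀ ⟨α.toBase M x, b1⟩ + m₀ ⟨α.toBase M y, b2⟩ := by
          rw [← map_add m₀]
          congr 1
          ext1
          exact map_add _ _ _
        rw [e1, e2, c1, c2, map_add, map_add, smul_add]
    have hx' : (x : M.P) ∈ L ⊔ F.Fil • T := hQ ▸ x.2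
    obtain ⟨l, hl, z, hz0, hlz⟩ := Submodule.mem_sup.1 hx'
    have hzT : z ∈ T := (Submodule.smul_le_right (I := F.Fil)) hz0
    have hpx : pL (x : M.P) = ⟨l, hl⟩ := by
      ext; rw [← hlz]; simp [hpL l hl, hpT0 z hzT]
    have hpTx : pT (x : M.P) = z := by
      rw [← hlz]; simp [pT, hpL l hl, hpT0 z hzT]
    obtain ⟨hzQ, hz', hzm⟩ := hz z (Submodule.smul_mono le_rfl le_top hz0)
    have e1 : E (α.toBase M x) = (α.u : G.S) • α.toBase M (M.Φ₁ ⟨l, hLQ hl⟩) := by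
      rw [hE]
      change (α.u : G.S) • α.toBase M (M.Φ₁ _) = _
      congr 4
      simp [hpx]
    have e2 : pT' ⟨α.toBase M x, α.toBase_mem_baseQ M x.2⟩ = ⟨α.toBase M z, hz'⟩ := by
      ext1
      refine (α.baseMap_toBase pT (x : M.P)).trans ?_
      rw [hpTx]
    change E (α.toBase M x) + m₀ (pT' _) = _
    rw [e1, e2, hzm, ← smul_add, ← map_add, ← map_add]
    congr 4
    exact Subtype.ext hlz
  · intro a y
    have e2 : pT' ⟨(a : G.S) • y, α.smul_mem_baseQ M a y⟩ =
        ⟨(a : G.S) • α.baseMap pT y, Submodule.smul_mem_smul a.2 trivial⟩ := by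
      ext1
      exact map_smul (α.baseMap pT) _ _
    change E ((a : G.S) • y) + m₀ (pT' _) = _
    rw [e2, hm₀, map_smulₛₗ, key, ← smul_add, ← map_add, sub_add_cancel]

/-- The map `Φ₁' : Q' → P'`, characterised by `Φ₁' (1 ⊗ x) = u ⊗ Φ₁ x` for `x ∈ Q` and
`Φ₁' (a y) = σ₁' a • Φ' y` for `a ∈ Fil¹ S'`; such a map exists, and it is unique since these
elements generate `Q'`. -/
def baseΦ₁ : α.baseQ M →ₛₗ[G.σ] α.BaseModule M := (α.exists_baseΦ₁ M).choose

theorem baseΦ₁_toBase (x : M.Q) :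
    α.baseΦ₁ M ⟨α.toBase M x, α.toBase_mem_baseQ M x.2⟩ = (α.u : G.S) • α.toBase M (M.Φ₁ x) :=
  (α.exists_baseΦ₁ M).choose_spec.1 x

theorem baseΦ₁_smul (a : G.Fil) (y : α.BaseModule M) :
    α.baseΦ₁ M ⟨(a : G.S) • y, α.smul_mem_baseQ M a y⟩ = G.σ₁ a • α.baseΦ M y :=
  (α.exists_baseΦ₁ M).choose_spec.2 a y

theorem baseQ_induction {C : α.BaseModule M → Prop}
    (h1 : ∀ x ∈ M.Q, C (α.toBase M x)) (h2 : ∀ (a : G.Fil) y, C ((a : G.S) • y))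
    (h0 : C 0) (hadd : ∀ x y, x ∈ α.baseQ M → y ∈ α.baseQ M → C x → C y → C (x + y))
    (hsmul : ∀ (s : G.S) x, x ∈ α.baseQ M → C x → C (s • x)) :
    ∀ y ∈ α.baseQ M, C y := by
  have hQ : α.baseQ M = Submodule.span G.S (α.toBase M '' (M.Q : Set M.P) ∪
      {y | ∃ (a : G.Fil) (z : α.BaseModule M), (a : G.S) • z = y}) := by
    rw [Submodule.span_union, baseQ]
    congr 1
    apply le_antisymm
    · rw [Submodule.smul_le]
      exact fun a ha n _ => Submodule.subset_span ⟨⟨a, ha⟩, n, rfl⟩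
    · rw [Submodule.span_le]
      rintro _ ⟨a, z, rfl⟩
      exact Submodule.smul_mem_smul a.2 trivial
  intro y hy
  rw [hQ] at hy
  induction hy using Submodule.span_induction with
  | mem y hy =>
    rcases hy with ⟨x, hx, rfl⟩ | ⟨a, z, rfl⟩
    · exact h1 x hx
    · exact h2 a z
  | zero => exact h0
  | add x y hx hy h1 h2 => exact hadd x y (hQ ▸ hx) (hQ ▸ hy) h1 h2
  | smul s x hx h1 => exact hsmul s x (hQ ▸ hx) h1

theorem exists_normal_base : ∃ L T : Submodule G.S (α.BaseModule M),
    IsCompl L T ∧ α.baseQ M = L ⊔ G.Fil • T := by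
  obtain ⟨L, T, hLT, hQ⟩ := M.exists_normal
  let pL : M.P →ₗ[F.S] M.P := L.subtype ∘ₗ L.projectionOnto T hLT
  have hpL : ∀ x ∈ L, pL x = x := fun x hx => by
    simp [pL, Submodule.projectionOnto_apply_left hLT ⟨x, hx⟩]
  have hpT0 : ∀ x ∈ T, pL x = 0 := fun x hx => by
    simpa [pL] using hx
  let L' := Submodule.span G.S (α.toBase M '' (L : Set M.P))
  let T' := Submodule.span G.S (α.toBase M '' (T : Set M.P))
  have hL' : ∀ y ∈ L', α.baseMap pL y = y := by
    intro y hy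
    induction hy using Submodule.span_induction with
    | mem y hy =>
      obtain ⟨x, hx, rfl⟩ := hy
      rw [baseMap_toBase, hpL x hx]
    | zero => simp
    | add x y _ _ h1 h2 => rw [map_add, h1, h2]
    | smul s x _ h1 => rw [map_smul, h1]
  have hT' : ∀ y ∈ T', α.baseMap pL y = 0 := by
    intro y hy
    induction hy using Submodule.span_induction with
    | mem y hy =>
      obtain ⟨x, hx, rfl⟩ := hy
      rw [baseMap_toBase, hpT0 x hx, map_zero]
    | zero => simp
    | add x y _ _ h1 h2 => rw [map_add, h1, h2, add_zero]
    | smul s x _ h1 => rw [map_smul, h1, smul_zero]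
  have hsup : L' ⊔ T' = ⊤ := by
    rw [eq_top_iff, ← α.span_toBase M, Submodule.span_le]
    rintro _ ⟨x, rfl⟩
    have hx : x ∈ L ⊔ T := by rw [hLT.sup_eq_top]; trivial
    obtain ⟨l, hl, t, ht, rfl⟩ := Submodule.mem_sup.1 hx
    rw [map_add]
    exact Submodule.add_mem_sup (Submodule.subset_span ⟨l, hl, rfl⟩)
      (Submodule.subset_span ⟨t, ht, rfl⟩)
  refine ⟨L', T', ⟨?_, codisjoint_iff.2 hsup⟩, le_antisymm ?_ ?_⟩
  · rw [Submodule.disjoint_def]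
    intro y h1 h2
    rw [← hL' y h1, hT' y h2]
  · rw [baseQ, sup_le_iff, Submodule.span_le]
    constructor
    · rintro _ ⟨x, hx, rfl⟩
      have hx' : x ∈ L ⊔ F.Fil • T := hQ ▸ hx
      obtain ⟨l, hl, z, hz, rfl⟩ := Submodule.mem_sup.1 hx'
      rw [map_add]
      exact Submodule.add_mem_sup (Submodule.subset_span ⟨l, hl, rfl⟩) (α.toBase_mem_smul M hz)
    · rw [← hsup, Submodule.smul_sup]
      exact sup_le_sup_right Submodule.smul_le_right _
  · rw [sup_le_iff]
    constructor
    · exact le_sup_of_le_left (Submodule.span_mono (Set.image_mono (by rw [hQ]; exact SetLike.coe_subset_coe.2 le_sup_left)))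
    · exact le_sup_of_le_right (Submodule.smul_mono le_rfl le_top)

/-- The base change `α^* M` of a window along a frame homomorphism. -/
def baseChangeObj : Window G :=
  letI := α.algebra
  { P := α.BaseModule M
    finite := inferInstanceAs (Module.Finite G.S (G.S ⊗[F.S] M.P))
    projective := inferInstanceAs (Module.Projective G.S (G.S ⊗[F.S] M.P))
    Q := α.baseQ M
    Φ := α.baseΦ M
    Φ₁ := α.baseΦ₁ M
    exists_normal := α.exists_normal_base M
    Φ₁_smul := fun a y _ => α.baseΦ₁_smul M a y
    span_Φ₁ := by
      rw [eq_top_iff, ← α.span_toBase M, Submodule.span_le]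
      rintro _ ⟨x, rfl⟩
      have hx : x ∈ Submodule.span F.S (Set.range M.Φ₁) := by rw [M.span_Φ₁]; trivial
      induction hx using Submodule.span_induction with
      | mem x hx =>
        obtain ⟨x, rfl⟩ := hx
        have h : α.toBase M (M.Φ₁ x) = (↑(α.u⁻¹) : G.S) • α.baseΦ₁ M
            ⟨α.toBase M x, α.toBase_mem_baseQ M x.2⟩ := by
          rw [baseΦ₁_toBase, smul_smul, Units.inv_mul, one_smul]
        rw [h]
        exact Submodule.smul_mem _ _ (Submodule.subset_span ⟨_, rfl⟩)
      | zero => rw [map_zero]; exact Submodule.zero_mem _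
      | add x y _ _ h1 h2 => rw [map_add]; exact Submodule.add_mem _ h1 h2
      | smul s x _ h1 => rw [toBase_smul]; exact Submodule.smul_mem _ _ h1 }

theorem baseMap_mem {M N : Window F} (f : Window.Hom M N) {y : α.BaseModule M}
    (hy : y ∈ α.baseQ M) : α.baseMap f.toLin y ∈ α.baseQ N := by
  refine α.baseQ_induction M (C := fun y => α.baseMap f.toLin y ∈ α.baseQ N)
    ?_ ?_ ?_ ?_ ?_ y hy
  · intro x hx
    rw [baseMap_toBase]
    exact α.toBase_mem_baseQ N (f.map_Q x hx)
  · intro a y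
    rw [map_smul]
    exact α.smul_mem_baseQ N a _
  · simp
  · intro x y _ _ h1 h2
    rw [map_add]
    exact Submodule.add_mem _ h1 h2
  · intro s x _ h1
    rw [map_smul]
    exact Submodule.smul_mem _ _ h1

theorem baseMap_baseΦ {M N : Window F} (f : Window.Hom M N) (y : α.BaseModule M) :
    α.baseMap f.toLin (α.baseΦ M y) = α.baseΦ N (α.baseMap f.toLin y) := by
  have : (α.baseMap f.toLin) ∘ₛₗ (α.baseΦ M) = (α.baseΦ N) ∘ₛₗ (α.baseMap f.toLin) := by
    apply α.semilinear_ext M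
    intro x
    simp only [LinearMap.comp_apply, baseΦ_toBase, baseMap_toBase, f.map_Φ]
  exact congrArg (fun g => g y) this

/-- The base change of a homomorphism of windows. -/
def baseChangeMap {M N : Window F} (f : M ⟶ N) : α.baseChangeObj M ⟶ α.baseChangeObj N where
  toLin := α.baseMap f.toLin
  map_Q _ hy := α.baseMap_mem f hy
  map_Φ y := α.baseMap_baseΦ f y
  map_Φ₁ := by
    rintro ⟨y, hy⟩
    refine (α.baseQ_induction M (C := fun y => ∀ hy : y ∈ α.baseQ M,
      α.baseMap f.toLin (α.baseΦ₁ M ⟨y, hy⟩) =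
        α.baseΦ₁ N ⟨α.baseMap f.toLin y, α.baseMap_mem f hy⟩) ?_ ?_ ?_ ?_ ?_ y hy) hy
    · intro x hx _
      have h1 := α.baseΦ₁_toBase M ⟨x, hx⟩
      have h2 := α.baseΦ₁_toBase N ⟨f.toLin x, f.map_Q x hx⟩
      simp only at h1 h2
      simp only [h1, map_smul, baseMap_toBase, h2, f.map_Φ₁ ⟨x, hx⟩]
    · intro a y _
      simp only [baseΦ₁_smul, map_smul, baseMap_baseΦ]
    · intro _
      have e1 : ∀ (K : Window F) h, α.baseΦ₁ K ⟨0, h⟩ = 0 := fun K h => map_zero (α.baseΦ₁ K)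
      simp only [e1, map_zero]
    · intro x y hx hy h1 h2 hxy
      have e1 : ∀ (K : Window F) a b (ha : a ∈ α.baseQ K) (hb : b ∈ α.baseQ K) hab,
          α.baseΦ₁ K ⟨a + b, hab⟩ = α.baseΦ₁ K ⟨a, ha⟩ + α.baseΦ₁ K ⟨b, hb⟩ :=
        fun K a b ha hb _ => map_add (α.baseΦ₁ K) ⟨a, ha⟩ ⟨b, hb⟩
      rw [e1 M x y hx hy, map_add, h1 hx, h2 hy, ← map_add]
      congr 1
      exact Subtype.ext (map_add _ _ _).symm
    · intro s x hx h1 hsx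
      have e1 : ∀ (K : Window F) a (ha : a ∈ α.baseQ K) hsa,
          α.baseΦ₁ K ⟨s • a, hsa⟩ = G.σ s • α.baseΦ₁ K ⟨a, ha⟩ :=
        fun K a ha _ => map_smulₛₗ (α.baseΦ₁ K) s ⟨a, ha⟩
      rw [e1 M x hx, map_smul, h1 hx, ← map_smulₛₗ]
      congr 1
      exact Subtype.ext (map_smul _ _ _).symm

/-- The base change functor `α^* : Win(F) ⥤ Win(G)`. -/
def baseChange : Window F ⥤ Window G where
  obj := α.baseChangeObj
  map f := α.baseChangeMap f
  map_id M := by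
    refine Window.Hom.ext (α.semilinear_ext M fun x => ?_)
    exact α.baseMap_toBase _ x
  map_comp {M N K} f g := by
    refine Window.Hom.ext (α.semilinear_ext M fun x => ?_)
    refine (α.baseMap_toBase _ x).trans ?_
    symm
    refine (congrArg (α.baseMap g.toLin) (α.baseMap_toBase f.toLin x)).trans ?_
    exact α.baseMap_toBase g.toLin _

/-- A frame homomorphism is crystalline if base change is an equivalence of the categories of
windows. -/
def IsCrystalline : Prop := α.baseChange.IsEquivalence

end Frame.Hom

end FramesAndWindows

section SemiperfectRings

open scoped Nat

/-! ## Semiperfect rings -/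

section Semiperfect

variable (p : ℕ) [Fact p.Prime] (R : Type u) [CommRing R] [CharP R p]

/-- A ring of characteristic `p` is semiperfect if its Frobenius is surjective. -/
def IsSemiperfect : Prop := Function.Surjective (frobenius R p)

/-- A (semiperfect) ring is balanced if the ideal `J̄ = Ker(φ)` satisfies `J̄ ^ p = 0`. -/
def IsBalanced : Prop := RingHom.ker (frobenius R p) ^ p = ⊥

variable {R} in
/-- An isogeny is a surjective homomorphism whose kernel is annihilated by a power of `φ`. -/
def IsIsogeny {R' : Type u} [CommRing R'] (f : R →+* R') : Prop :=
  Function.Surjective f ∧ ∃ n : ℕ, ∀ x ∈ RingHom.ker f, (frobenius R p)^[n] x = 0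

/-- A semiperfect ring is iso-balanced if it is isogenous to a balanced semiperfect ring. -/
def IsIsoBalanced : Prop :=
  ∃ (R' : Type u) (_ : CommRing R') (_ : CharP R' p),
    IsSemiperfect p R' ∧ IsBalanced p R' ∧ ∃ f : R →+* R', IsIsogeny p f

/-- The ring `W(R^♭)`, where `R^♭` is the limit of `R` along Frobenius. -/
abbrev Ainf : Type u := WittVector p (Perfection R p)

/-- The ideal `J = Ker(R^♭ → R)`. -/
abbrev idealJ : Ideal (Perfection R p) := RingHom.ker (Perfection.coeff R p 0)

/-- The natural map `W(R^♭) → R^♭ → R`. -/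
def theta : Ainf p R →+* R := (Perfection.coeff R p 0).comp WittVector.constantCoeff

/-- The kernel of `W(R^♭) → R`. -/
abbrev kerTheta : Ideal (Ainf p R) := RingHom.ker (theta p R)

theorem theta_apply (x : Ainf p R) : theta p R x = Perfection.coeff R p 0 (x.coeff 0) := rfl

theorem p_mem_kerTheta : (p : Ainf p R) ∈ kerTheta p R := by
  rw [RingHom.mem_ker, map_natCast, CharP.cast_eq_zero]

end Semiperfect

/-! ## Witt vectors of perfect rings -/

section Witt

variable {p : ℕ} [hp : Fact p.Prime] {k : Type u} [CommRing k] [CharP k p] [PerfectRing k p]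

theorem W_p_mul_cancel {x y : WittVector p k} (h : (p : WittVector p k) * x = p * y) : x = y := by
  rw [← sub_eq_zero]
  apply WittVector.eq_zero_of_p_mul_eq_zero
  rw [mul_comm, mul_sub, h, sub_self]

theorem W_p_mem_jacobson : Ideal.span {(p : WittVector p k)} ≤ (⊥ : Ideal (WittVector p k)).jacobson :=
  IsAdicComplete.le_jacobson_bot _

theorem W_isUnit_natCast {n : ℕ} (h : n.Coprime p) : IsUnit (n : WittVector p k) := by
  have h1 : Int.gcd n p = 1 := by exact_mod_cast h
  have h2 := Int.gcd_eq_gcd_ab n p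
  rw [h1] at h2
  have h3 : (1 : WittVector p k) = n * ((Int.gcdA n p : ℤ) : WittVector p k) + p * ((Int.gcdB n p : ℤ) : WittVector p k) := by
    have := congrArg (fun z : ℤ => (z : WittVector p k)) h2
    push_cast at this
    exact_mod_cast this
  have h4 : (p : WittVector p k) ∈ (⊥ : Ideal (WittVector p k)).jacobson :=
    W_p_mem_jacobson (Ideal.subset_span rfl)
  rw [Ideal.mem_jacobson_bot] at h4
  have h5 := h4 (-((Int.gcdB n p : ℤ) : WittVector p k))
  have h6 : (p : WittVector p k) * -((Int.gcdB n p : ℤ) : WittVector p k) + 1 = n * ((Int.gcdA n p : ℤ) : WittVector p k) := by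
    rw [h3]; ring
  rw [h6] at h5
  exact isUnit_of_mul_isUnit_left h5

theorem W_natCast_mul_cancel {n : ℕ} (hn : n ≠ 0) {x y : WittVector p k} (h : (n : WittVector p k) * x = n * y) : x = y := by
  obtain ⟨v, m, hm, rfl⟩ := Nat.exists_eq_pow_mul_and_not_dvd hn p hp.out.ne_one
  have hu : IsUnit (m : WittVector p k) := W_isUnit_natCast ((Nat.Prime.coprime_iff_not_dvd hp.out).2 hm).symm
  clear hn
  induction v with
  | zero =>
    simp only [pow_zero, one_mul] at h
    exact hu.mul_left_cancel h
  | succ v ih =>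
    apply ih
    apply W_p_mul_cancel
    push_cast at h ⊢
    linear_combination h

/-- The numbers `p ^ (n - 1) / n!` are `p`-integral for `n ≥ 1`. -/
theorem W_exists_coef (n : ℕ) : ∃ e : WittVector p k, ((n + 1)! : WittVector p k) * e = p ^ n := by
  obtain ⟨v, m, hm, hv⟩ := Nat.exists_eq_pow_mul_and_not_dvd (Nat.factorial_ne_zero (n + 1)) p
    hp.out.ne_one
  have hu : IsUnit (m : WittVector p k) := W_isUnit_natCast ((Nat.Prime.coprime_iff_not_dvd hp.out).2 hm).symm
  obtain ⟨m', hm'⟩ := hu.exists_right_inv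
  have hvn : v ≤ n := by
    have h1 : padicValNat p (n + 1)! = v := by
      rw [hv, padicValNat.mul (pow_ne_zero _ hp.out.ne_zero) (by rintro rfl; simp at hm),
        padicValNat.prime_pow, padicValNat.eq_zero_of_not_dvd hm, add_zero]
    have h2 := sub_one_mul_padicValNat_factorial (p := p) (n + 1)
    rw [h1] at h2
    have h3 : 0 < (p.digits (n + 1)).sum := by
      by_contra h
      have h4 : (p.digits (n+1)).sum = 0 := by omega
      rw [h4] at h2
      have h5 := Nat.digits_ne_nil_iff_ne_zero (b := p).2 (Nat.succ_ne_zero n)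
      have h6 := Nat.getLast_digit_ne_zero p (Nat.succ_ne_zero n)
      exact h6 (List.sum_eq_zero_iff.1 h4 _ (List.getLast_mem h5))
    have h7 : 1 ≤ p - 1 := Nat.le_sub_one_of_lt hp.out.one_lt
    have : v ≤ (p - 1) * v := Nat.le_mul_of_pos_left _ h7
    omega
  refine ⟨p ^ (n - v) * m', ?_⟩
  rw [hv]
  push_cast
  have : (p : WittVector p k) ^ n = p ^ v * p ^ (n - v) := by rw [← pow_add]; congr 1; omega
  rw [this]
  linear_combination (p : WittVector p k) ^ v * p ^ (n - v) * hm'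

/-- `coef n = p ^ n / (n + 1)!` in `W(k)`. -/
def coef (n : ℕ) : WittVector p k := (W_exists_coef n).choose

theorem coef_spec (n : ℕ) : ((n + 1)! : WittVector p k) * (coef n : WittVector p k) = p ^ n := (W_exists_coef n).choose_spec

theorem coef_unique {n : ℕ} {e : WittVector p k} (h : ((n + 1)! : WittVector p k) * e = p ^ n) : e = coef n :=
  W_natCast_mul_cancel (Nat.factorial_ne_zero (n + 1)) (h.trans (coef_spec n).symm)

theorem coef_zero : (coef 0 : WittVector p k) = 1 := (coef_unique (by simp)).symm

theorem frobenius_coef (n : ℕ) : WittVector.frobenius (coef n : WittVector p k) = coef n := by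
  apply coef_unique
  have := congrArg WittVector.frobenius (coef_spec (p := p) (k := k) n)
  simpa using this

theorem coef_mul (m n : ℕ) :
    (p : WittVector p k) * (coef m * coef n) =
      (((m + 1 + (n + 1)).choose (m + 1) : ℕ) : WittVector p k) * coef (m + n + 1) := by
  apply W_natCast_mul_cancel (Nat.factorial_ne_zero (m + 1))
  apply W_natCast_mul_cancel (Nat.factorial_ne_zero (n + 1))
  have h1 := coef_spec (p := p) (k := k) m
  have h2 := coef_spec (p := p) (k := k) n
  have h3 := coef_spec (p := p) (k := k) (m + n + 1)
  have h4 : (((m + 1 + (n + 1)).choose (m + 1) : ℕ) : WittVector p k) * ((m + 1)! : WittVector p k) * ((n + 1)! : WittVector p k) =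
      ((m + n + 1 + 1)! : WittVector p k) := by
    have := Nat.add_choose_mul_factorial_mul_factorial (m + 1) (n + 1)
    rw [show m + n + 1 + 1 = m + 1 + (n + 1) by ring, ← this, Nat.choose_symm_add]
    push_cast
    ring
  have h5 : (p : WittVector p k) ^ (m + n + 1) = p * (p ^ m * p ^ n) := by ring
  calc ((n + 1)! : WittVector p k) * (((m + 1)! : WittVector p k) * ((p : WittVector p k) * (coef m * coef n)))
      = (p : WittVector p k) * ((((m + 1)! : WittVector p k) * coef m) * (((n + 1)! : WittVector p k) * coef n)) := by ring
    _ = (p : WittVector p k) ^ (m + n + 1) := by rw [h1, h2, h5]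
    _ = _ := by rw [← h3, ← h4]; ring

theorem W_exists_delta (x : WittVector p k) : ∃ y : WittVector p k, WittVector.frobenius x = x ^ p + p * y := by
  have h : WittVector.frobenius x - x ^ p ∈ Ideal.span {(p : WittVector p k)} := by
    rw [WittVector.mem_span_p_iff_coeff_zero_eq_zero]
    have : ∀ y : WittVector p k, y.coeff 0 = WittVector.constantCoeff y := fun _ => rfl
    rw [this, map_sub, map_pow, ← this, ← this, WittVector.coeff_frobenius_charP, sub_self]
  obtain ⟨y, hy⟩ := Ideal.mem_span_singleton.1 h
  exact ⟨y, by rw [← hy]; ring⟩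

/-- The `p`-derivation `δ(x) = (σ(x) - x ^ p) / p` on `W(k)`. -/
def delta (x : WittVector p k) : WittVector p k := (W_exists_delta x).choose

theorem delta_spec (x : WittVector p k) : WittVector.frobenius x = x ^ p + p * delta x :=
  (W_exists_delta x).choose_spec

theorem delta_mul (a x : WittVector p k) :
    delta (a * x) = WittVector.frobenius a * delta x + x ^ p * delta a := by
  apply W_p_mul_cancel
  have h1 := delta_spec (a * x)
  rw [map_mul] at h1
  have h2 := delta_spec a
  have h3 := delta_spec x
  rw [mul_pow] at h1
  linear_combination (-1 : WittVector p k) * h1 + WittVector.frobenius a * h3 + x ^ p * h2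

theorem delta_p : delta (p : WittVector p k) = 1 - p ^ (p - 1) := by
  apply W_p_mul_cancel
  have h1 := delta_spec (p : WittVector p k)
  rw [map_natCast] at h1
  have h2 : (p : WittVector p k) ^ p = p * p ^ (p - 1) := by
    rw [← pow_succ', Nat.sub_add_cancel hp.out.one_le]
  rw [h2] at h1
  linear_combination -h1

/-- `C(p, i) / p`. -/
def bcoef (p i : ℕ) : ℕ := p.choose i / p

theorem p_mul_bcoef {i : ℕ} (h0 : i ≠ 0) (hi : i < p) : p * bcoef p i = p.choose i :=
  Nat.mul_div_cancel' (hp.out.dvd_choose_self h0 hi)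

theorem bcoef_mul {i : ℕ} (h0 : i ≠ 0) (hi : i < p) : bcoef p i * (i ! * (p - i)!) = (p - 1)! := by
  apply Nat.eq_of_mul_eq_mul_left hp.out.pos
  rw [← mul_assoc, p_mul_bcoef h0 hi, Nat.mul_factorial_pred hp.out.ne_zero, ← mul_assoc]
  exact Nat.choose_mul_factorial_mul_factorial hi.le

theorem delta_add (x y : WittVector p k) : delta (x + y) = delta x + delta y -
    ∑ i ∈ Finset.Ioo 0 p, (bcoef p i : WittVector p k) * (x ^ i * y ^ (p - i)) := by
  apply W_p_mul_cancel
  have h1 := delta_spec (x + y)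
  rw [map_add, delta_spec x, delta_spec y, add_pow] at h1
  have h2 : Finset.range (p + 1) = insert 0 (insert p (Finset.Ioo 0 p)) := by
    ext i
    have := hp.out.pos
    simp only [Finset.mem_range, Finset.mem_insert, Finset.mem_Ioo]
    omega
  rw [h2, Finset.sum_insert (by simp [hp.out.ne_zero.symm]), Finset.sum_insert (by simp)] at h1
  simp only [pow_zero, one_mul, Nat.choose_zero_right, Nat.sub_zero, Nat.cast_one, mul_one,
    Nat.choose_self, Nat.sub_self] at h1
  have h3 : ∑ i ∈ Finset.Ioo 0 p, x ^ i * y ^ (p - i) * (p.choose i : WittVector p k) =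
      p * ∑ i ∈ Finset.Ioo 0 p, (bcoef p i : WittVector p k) * (x ^ i * y ^ (p - i)) := by
    rw [Finset.mul_sum]
    refine Finset.sum_congr rfl fun i hi => ?_
    rw [Finset.mem_Ioo] at hi
    rw [← p_mul_bcoef hi.1.ne' hi.2]
    push_cast
    ring
  rw [h3] at h1
  linear_combination -h1

end Witt

end SemiperfectRings

section Envelope

open scoped Nat

/-! ## The divided power envelope -/

/-- Ring homomorphisms out of a divided power algebra, semilinear over `g`. -/
def dpLift {A M T : Type*} [CommRing A] [AddCommGroup M] [Module A M] [CommRing T]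
    (g : A →+* T) (f : ℕ → M → T) (h0 : ∀ m, f 0 m = 1)
    (hs : ∀ n r m, f n (r • m) = g r ^ n * f n m)
    (hm : ∀ n q m, f n m * f q m = ((n + q).choose n : ℕ) * f (n + q) m)
    (ha : ∀ n u v, f n (u + v) = ∑ i ∈ Finset.HasAntidiagonal.antidiagonal n, f i.1 u * f i.2 v) :
    DividedPowerAlgebra A M →+* T :=
  letI := g.toAlgebra
  (DividedPowerAlgebra.lift' (R := A) (M := M) (A := T) (f := fun nm => f nm.1 nm.2) h0
    (fun n r m => by rw [Algebra.smul_def, map_pow]; exact hs n r m)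
    (fun n q m => by rw [nsmul_eq_mul]; exact hm n q m) (fun n u v => ha n u v)).toRingHom

section dpLift

variable {A M T : Type*} [CommRing A] [AddCommGroup M] [Module A M] [CommRing T]
    (g : A →+* T) (f : ℕ → M → T) (h0 : ∀ m, f 0 m = 1)
    (hs : ∀ n r m, f n (r • m) = g r ^ n * f n m)
    (hm : ∀ n q m, f n m * f q m = ((n + q).choose n : ℕ) * f (n + q) m)
    (ha : ∀ n u v, f n (u + v) = ∑ i ∈ Finset.HasAntidiagonal.antidiagonal n, f i.1 u * f i.2 v)

@[simp]
theorem dpLift_algebraMap (a : A) : dpLift g f h0 hs hm ha (algebraMap A _ a) = g a := by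
  let _ := g.toAlgebra
  exact AlgHom.commutes (DividedPowerAlgebra.lift' (R := A) (M := M) (A := T) _ _ _ _) a

@[simp]
theorem dpLift_dp (n : ℕ) (m : M) :
    dpLift g f h0 hs hm ha (DividedPowerAlgebra.dp A n m) = f n m := by
  let _ := g.toAlgebra
  exact DividedPowerAlgebra.lift'_apply_dp (R := A) (M := M) (A := T) (f := fun nm => f nm.1 nm.2)
    _ _ _ _ n m

theorem dp_ringHom_ext {f g : DividedPowerAlgebra A M →+* T}
    (h1 : ∀ a, f (algebraMap A _ a) = g (algebraMap A _ a))
    (h2 : ∀ n m, f (DividedPowerAlgebra.dp A n m) = g (DividedPowerAlgebra.dp A n m)) : f = g := by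
  refine RingHom.ext fun x => ?_
  induction x using DividedPowerAlgebra.induction_on with
  | C a => exact h1 a
  | add x y hx hy => rw [map_add, map_add, hx, hy]
  | dp x n m hx => rw [map_mul, map_mul, hx, h2]

end dpLift

section coefLift

variable {p : ℕ} [Fact p.Prime] {k : Type u} [CommRing k] [CharP k p] [PerfectRing k p]
  {M T : Type*} [CommRing T] (g : WittVector p k →+* T) (ω : T) (t : M → T)

/-- The family `1, ω t, (p / 2!) ω t ^ 2, (p ^ 2 / 3!) ω t ^ 3, …`. -/
def coefFun (n : ℕ) (m : M) : T := if n = 0 then 1 else g (coef (n - 1)) * (ω * t m ^ n)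

theorem coefFun_succ (n : ℕ) (m : M) :
    coefFun g ω t (n + 1) m = g (coef n) * (ω * t m ^ (n + 1)) := rfl

theorem coefFun_zero (m : M) : coefFun g ω t 0 m = 1 := rfl

theorem mul_pow_eq {ω a b : T} (h : ω * a = ω * b) (n : ℕ) : ω * a ^ n = ω * b ^ n := by
  induction n with
  | zero => simp
  | succ n ih => rw [pow_succ, pow_succ, ← mul_assoc, ih, mul_right_comm, h]; ring

variable {g ω t}

theorem coefFun_smul [AddCommGroup M] [Module (WittVector p k) M]
    (ht : ∀ r m, ω * t (r • m) = ω * (g r * t m)) (n : ℕ) (r : WittVector p k) (m : M) :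
    coefFun g ω t n (r • m) = g r ^ n * coefFun g ω t n m := by
  cases n with
  | zero => simp [coefFun_zero]
  | succ n =>
    rw [coefFun_succ, coefFun_succ, mul_pow_eq (ht r m)]
    ring

theorem coefFun_mul' (hω : ω * ω = p * ω) (m n : ℕ) (u v : M) :
    coefFun g ω t (m + 1) u * coefFun g ω t (n + 1) v =
      ((m + 1 + (n + 1)).choose (m + 1) : ℕ) *
        (g (coef (m + n + 1)) * (ω * (t u ^ (m + 1) * t v ^ (n + 1)))) := by
  rw [coefFun_succ, coefFun_succ]
  have h := congrArg g (coef_mul (p := p) (k := k) m n)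
  simp only [map_mul, map_natCast] at h
  linear_combination (g (coef m) * g (coef n) * t u ^ (m + 1) * t v ^ (n + 1)) * hω +
    (ω * t u ^ (m + 1) * t v ^ (n + 1)) * h

theorem coefFun_mul (hω : ω * ω = p * ω) (n q : ℕ) (m : M) :
    coefFun g ω t n m * coefFun g ω t q m =
      ((n + q).choose n : ℕ) * coefFun g ω t (n + q) m := by
  cases n with
  | zero => simp [coefFun_zero]
  | succ n =>
    cases q with
    | zero => simp [coefFun_zero]
    | succ q =>
      rw [coefFun_mul' hω, show n + 1 + (q + 1) = n + q + 1 + 1 by ring, coefFun_succ]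
      ring

theorem coefFun_add [AddCommGroup M] (hω : ω * ω = p * ω)
    (ht : ∀ u v, ω * t (u + v) = ω * (t u + t v)) (n : ℕ) (u v : M) : coefFun g ω t n (u + v) =
      ∑ i ∈ Finset.HasAntidiagonal.antidiagonal n, coefFun g ω t i.1 u * coefFun g ω t i.2 v := by
  cases n with
  | zero => simp [coefFun_zero]
  | succ n =>
    rw [coefFun_succ, mul_pow_eq (ht u v), (Commute.all (t u) (t v)).add_pow', Finset.mul_sum,
      Finset.mul_sum]
    refine Finset.sum_congr rfl ?_
    rintro ⟨i, j⟩ hij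
    rw [Finset.HasAntidiagonal.mem_antidiagonal] at hij
    simp only at hij ⊢
    cases i with
    | zero =>
      rw [zero_add] at hij
      subst hij
      rw [coefFun_zero, coefFun_succ]
      simp
    | succ i =>
      cases j with
      | zero =>
        rw [add_zero] at hij
        cases hij
        rw [coefFun_zero, coefFun_succ]
        simp
      | succ j =>
        have : n = i + j + 1 := by omega
        subst this
        rw [coefFun_mul' hω, show i + 1 + (j + 1) = i + j + 1 + 1 by ring, nsmul_eq_mul]
        ring

end coefLift

variable (p : ℕ) [hp : Fact p.Prime] (R : Type u) [CommRing R] [CharP R p]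

/-- The element `p` of `Ker(W(R^♭) → R)`. -/
def pElt : kerTheta p R := ⟨p, p_mem_kerTheta p R⟩

/-- The relations that define the divided power envelope of `I = Ker(W(R^♭) → R)` as a quotient of
the divided power algebra of the module `I`: the element `x^{[1]}` is identified with `x` for `x` in
`I`, and `p^{[n]}` is identified with `p ^ n / n!`, which is the unique element `c` of the torsion
free ring `W(R^♭)` with `n! c = p ^ n`. -/
def pdRel : Ideal (DividedPowerAlgebra (Ainf p R) (kerTheta p R)) :=
  Ideal.span
    ({z | ∃ x : kerTheta p R,
        z = DividedPowerAlgebra.dp (Ainf p R) 1 x - algebraMap (Ainf p R) _ (x : Ainf p R)} ∪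
     {z | ∃ (n : ℕ) (c : Ainf p R), (n ! : Ainf p R) * c = p ^ n ∧
        z = DividedPowerAlgebra.dp (Ainf p R) n (pElt p R) - algebraMap (Ainf p R) _ c})

/-- The divided power envelope of `W(R^♭) → R`, compatible with the divided powers on `p ℤ_p`. -/
def PDEnvelope : Type u := DividedPowerAlgebra (Ainf p R) (kerTheta p R) ⧸ pdRel p R

instance : CommRing (PDEnvelope p R) :=
  inferInstanceAs (CommRing (DividedPowerAlgebra (Ainf p R) (kerTheta p R) ⧸ pdRel p R))

namespace PDEnvelope

/-- The projection from the divided power algebra to the divided power envelope. -/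
def proj : DividedPowerAlgebra (Ainf p R) (kerTheta p R) →+* PDEnvelope p R :=
  Ideal.Quotient.mk (pdRel p R)

theorem proj_surjective : Function.Surjective (proj p R) := Ideal.Quotient.mk_surjective

theorem proj_eq_zero_iff {z : DividedPowerAlgebra (Ainf p R) (kerTheta p R)} :
    proj p R z = 0 ↔ z ∈ pdRel p R := Ideal.Quotient.eq_zero_iff_mem

/-- The structure map `W(R^♭) → D`. -/
def iota : Ainf p R →+* PDEnvelope p R :=
  (proj p R).comp (algebraMap (Ainf p R) _)

variable {R}

/-- The divided power `x^{[n]}` in `D` of an element `x` of `Ker(W(R^♭) → R)`. -/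
def gamma (n : ℕ) (x : kerTheta p R) : PDEnvelope p R :=
  proj p R (DividedPowerAlgebra.dp (Ainf p R) n x)

theorem gamma_zero (x : kerTheta p R) : gamma p 0 x = 1 := by
  rw [gamma, DividedPowerAlgebra.dp_zero, map_one]

theorem gamma_one (x : kerTheta p R) : gamma p 1 x = iota p R x := by
  rw [← sub_eq_zero, gamma, iota, RingHom.comp_apply, ← map_sub, proj_eq_zero_iff]
  exact Ideal.subset_span (Or.inl ⟨x, rfl⟩)

theorem gamma_p {n : ℕ} {c : Ainf p R} (h : (n ! : Ainf p R) * c = p ^ n) :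
    gamma p n (pElt p R) = iota p R c := by
  rw [← sub_eq_zero, gamma, iota, RingHom.comp_apply, ← map_sub, proj_eq_zero_iff]
  exact Ideal.subset_span (Or.inr ⟨n, c, h, rfl⟩)

theorem gamma_smul (n : ℕ) (r : Ainf p R) (x : kerTheta p R) :
    gamma p n (r • x) = iota p R r ^ n * gamma p n x := by
  rw [gamma, DividedPowerAlgebra.dp_smul, Algebra.smul_def, map_mul, map_pow, map_pow]
  rfl

theorem gamma_mul (n q : ℕ) (x : kerTheta p R) :
    gamma p n x * gamma p q x = ((n + q).choose n : ℕ) * gamma p (n + q) x := by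
  rw [gamma, gamma, ← map_mul, DividedPowerAlgebra.dp_mul, nsmul_eq_mul, map_mul, map_natCast]
  rfl

theorem gamma_add (n : ℕ) (x y : kerTheta p R) : gamma p n (x + y) =
    ∑ i ∈ Finset.HasAntidiagonal.antidiagonal n, gamma p i.1 x * gamma p i.2 y := by
  rw [gamma, DividedPowerAlgebra.dp_add, map_sum]
  simp only [map_mul]
  rfl

theorem factorial_mul_gamma (n : ℕ) (x : kerTheta p R) :
    (n ! : PDEnvelope p R) * gamma p n x = iota p R x ^ n := by
  rw [← gamma_one, gamma, gamma, ← map_pow, ← DividedPowerAlgebra.natFactorial_mul_dp_eq,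
    map_mul, map_natCast]

theorem induction {C : PDEnvelope p R → Prop} (d : PDEnvelope p R)
    (h1 : ∀ a, C (iota p R a)) (h2 : ∀ x y, C x → C y → C (x + y))
    (h3 : ∀ d n x, C d → C (d * gamma p n x)) : C d := by
  obtain ⟨d, rfl⟩ := proj_surjective p R d
  induction d using DividedPowerAlgebra.induction_on with
  | C a => exact h1 a
  | add x y hx hy => rw [map_add]; exact h2 _ _ hx hy
  | dp x n m hx => rw [map_mul]; exact h3 _ _ _ hx

theorem ringHom_ext {T : Type*} [CommRing T] {f g : PDEnvelope p R →+* T}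
    (h1 : ∀ a, f (iota p R a) = g (iota p R a))
    (h2 : ∀ n x, f (gamma p n x) = g (gamma p n x)) : f = g :=
  Ideal.Quotient.ringHom_ext (dp_ringHom_ext h1 h2)

variable (R) in
/-- Ring homomorphisms out of the divided power envelope. -/
def lift {T : Type*} [CommRing T] (g : Ainf p R →+* T) (f : ℕ → kerTheta p R → T)
    (h0 : ∀ m, f 0 m = 1) (hs : ∀ n r m, f n (r • m) = g r ^ n * f n m)
    (hm : ∀ n q m, f n m * f q m = ((n + q).choose n : ℕ) * f (n + q) m)
    (ha : ∀ n u v, f n (u + v) = ∑ i ∈ Finset.HasAntidiagonal.antidiagonal n, f i.1 u * f i.2 v)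
    (h1 : ∀ x, f 1 x = g x)
    (hp : ∀ n c, (n ! : Ainf p R) * c = p ^ n → f n (pElt p R) = g c) : PDEnvelope p R →+* T :=
  Ideal.Quotient.lift (pdRel p R) (dpLift g f h0 hs hm ha) (by
    intro z hz
    have : pdRel p R ≤ RingHom.ker (dpLift g f h0 hs hm ha) := by
      rw [pdRel, Ideal.span_le]
      rintro z (⟨x, rfl⟩ | ⟨n, c, hc, rfl⟩)
      · simp [h1]
      · simp [hp n c hc]
    exact this hz)

section lift

variable {T : Type*} [CommRing T] (g : Ainf p R →+* T) (f : ℕ → kerTheta p R → T)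
    (h0 : ∀ m, f 0 m = 1) (hs : ∀ n r m, f n (r • m) = g r ^ n * f n m)
    (hm : ∀ n q m, f n m * f q m = ((n + q).choose n : ℕ) * f (n + q) m)
    (ha : ∀ n u v, f n (u + v) = ∑ i ∈ Finset.HasAntidiagonal.antidiagonal n, f i.1 u * f i.2 v)
    (h1 : ∀ x, f 1 x = g x)
    (hp : ∀ n c, (n ! : Ainf p R) * c = p ^ n → f n (pElt p R) = g c)

@[simp]
theorem lift_iota (a : Ainf p R) : lift p R g f h0 hs hm ha h1 hp (iota p R a) = g a :=
  dpLift_algebraMap g f h0 hs hm ha a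

@[simp]
theorem lift_gamma (n : ℕ) (x : kerTheta p R) :
    lift p R g f h0 hs hm ha h1 hp (gamma p n x) = f n x :=
  dpLift_dp g f h0 hs hm ha n x

end lift

theorem eq_p_mul_coef {n : ℕ} {c : Ainf p R} (h : ((n + 1)! : Ainf p R) * c = p ^ (n + 1)) :
    c = (p : Ainf p R) * coef n := by
  apply W_natCast_mul_cancel (Nat.factorial_ne_zero (n + 1))
  rw [h, mul_left_comm, coef_spec, pow_succ']

theorem eq_one_of_zero {c : Ainf p R} (h : (0 ! : Ainf p R) * c = p ^ 0) : c = 1 := by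
  simpa using h

variable (R)

/-- The natural map `D → R`; it sends `x^{[n]}` to `0` for `n ≥ 1`. -/
def toR : PDEnvelope p R →+* R :=
  lift p R (theta p R) (fun n _ => if n = 0 then 1 else 0) (fun _ => rfl)
    (fun n r m => by cases n <;> simp)
    (fun n q m => by cases n <;> cases q <;> simp)
    (fun n u v => by
      cases n with
      | zero => simp
      | succ n =>
        symm
        rw [if_neg (Nat.succ_ne_zero n)]
        refine Finset.sum_eq_zero ?_
        rintro ⟨i, j⟩ hij
        rw [Finset.HasAntidiagonal.mem_antidiagonal] at hij
        cases i <;> cases j <;> simp at hij ⊢)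
    (fun x => by simpa using x.2.symm)
    (fun n c h => by
      cases n with
      | zero => rw [eq_one_of_zero p h]; simp
      | succ n =>
        rw [eq_p_mul_coef p h, map_mul, map_natCast, CharP.cast_eq_zero]
        simp)

variable {R}

/-- The Frobenius of `W(R^♭)` on the ideal `Ker(W(R^♭) → R)`. -/
def frobI (x : kerTheta p R) : kerTheta p R :=
  ⟨WittVector.frobenius (x : Ainf p R), by
    have h : theta p R (x : Ainf p R) = 0 := x.2
    rw [theta_apply] at h
    rw [RingHom.mem_ker, theta_apply, WittVector.coeff_frobenius_charP, map_pow, h,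
      zero_pow hp.out.ne_zero]⟩

theorem frobI_smul (r : Ainf p R) (x : kerTheta p R) :
    frobI p (r • x) = WittVector.frobenius r • frobI p x := by
  ext1; simp [frobI]

theorem frobI_add (x y : kerTheta p R) : frobI p (x + y) = frobI p x + frobI p y := by
  ext1; simp [frobI]

theorem frobI_p : frobI p (pElt p R) = pElt p R := by
  ext1; simp [frobI, pElt]

variable (R)

/-- The Frobenius lift `σ` of `D`, induced by the Frobenius of `W(R^♭)` and compatible with divided
powers: `σ (x^{[n]}) = (σ x)^{[n]}`. -/
def sigma : PDEnvelope p R →+* PDEnvelope p R :=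
  lift p R ((iota p R).comp WittVector.frobenius) (fun n x => gamma p n (frobI p x))
    (fun _ => gamma_zero p _)
    (fun n r m => by rw [frobI_smul, gamma_smul]; rfl)
    (fun n q m => gamma_mul p n q _)
    (fun n u v => by rw [frobI_add, gamma_add])
    (fun x => gamma_one p _)
    (fun n c h => by
      rw [frobI_p]
      exact gamma_p p (by simpa using congrArg WittVector.frobenius h))

variable {R}

@[simp]
theorem sigma_iota (a : Ainf p R) : sigma p R (iota p R a) = iota p R (WittVector.frobenius a) :=
  lift_iota p _ _ _ _ _ _ _ _ a

@[simp]
theorem sigma_gamma (n : ℕ) (x : kerTheta p R) :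
    sigma p R (gamma p n x) = gamma p n (frobI p x) :=
  lift_gamma p _ _ _ _ _ _ _ _ n x

@[simp]
theorem toR_iota (a : Ainf p R) : toR p R (iota p R a) = theta p R a :=
  lift_iota p _ _ _ _ _ _ _ _ a

@[simp]
theorem toR_gamma (n : ℕ) (x : kerTheta p R) :
    toR p R (gamma p n x) = if n = 0 then 1 else 0 :=
  lift_gamma p _ _ _ _ _ _ _ _ n x

/-- For `x` in `I = Ker(W(R^♭) → R)`, the element `τ(x) = (p - 1)! x^{[p]} + δ(x)` of `D`, which
is a canonical version of `σ(x) / p`. -/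
def tau (x : kerTheta p R) : PDEnvelope p R :=
  ((p - 1)! : PDEnvelope p R) * gamma p p x + iota p R (delta (x : Ainf p R))

theorem p_mul_tau (x : kerTheta p R) :
    (p : PDEnvelope p R) * tau p x = iota p R (WittVector.frobenius (x : Ainf p R)) := by
  rw [delta_spec, map_add, map_pow, map_mul, map_natCast, ← factorial_mul_gamma, tau,
    ← Nat.mul_factorial_pred hp.out.ne_zero]
  push_cast
  ring

theorem tau_smul (a : Ainf p R) (x : kerTheta p R) :
    tau p (a • x) = iota p R (WittVector.frobenius a) * tau p x := by
  have h1 : delta ((a • x : kerTheta p R) : Ainf p R) = _ := delta_mul a (x : Ainf p R)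
  rw [tau, tau, gamma_smul, h1]
  have h2 := factorial_mul_gamma p p x
  rw [← Nat.mul_factorial_pred hp.out.ne_zero] at h2
  have h3 := congrArg (iota p R) (delta_spec a)
  simp only [map_add, map_mul, map_pow, map_natCast] at h3 ⊢
  push_cast at h2
  linear_combination -iota p R (delta a) * h2 - ((p - 1)! : PDEnvelope p R) * gamma p p x * h3

theorem tau_add (x y : kerTheta p R) : tau p (x + y) = tau p x + tau p y := by
  have h1 : delta ((x + y : kerTheta p R) : Ainf p R) = _ :=
    delta_add (x : Ainf p R) (y : Ainf p R)
  rw [tau, tau, tau, h1, gamma_add, Finset.Nat.sum_antidiagonal_eq_sum_range_succ_mk]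
  have h2 : Finset.range p.succ = insert 0 (insert p (Finset.Ioo 0 p)) := by
    ext i
    have := hp.out.pos
    simp only [Finset.mem_range, Finset.mem_insert, Finset.mem_Ioo]
    omega
  rw [h2, Finset.sum_insert (by simp [hp.out.ne_zero.symm]), Finset.sum_insert (by simp)]
  simp only [gamma_zero, Nat.sub_zero, Nat.sub_self, one_mul, mul_one]
  have h3 : ((p - 1)! : PDEnvelope p R) * ∑ i ∈ Finset.Ioo 0 p, gamma p i x * gamma p (p - i) y =
      iota p R (∑ i ∈ Finset.Ioo 0 p,
        (bcoef p i : Ainf p R) * ((x : Ainf p R) ^ i * (y : Ainf p R) ^ (p - i))) := by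
    rw [Finset.mul_sum, map_sum]
    refine Finset.sum_congr rfl fun i hi => ?_
    rw [Finset.mem_Ioo] at hi
    rw [← bcoef_mul hi.1.ne' hi.2, map_mul, map_mul, map_pow, map_pow, map_natCast,
      ← factorial_mul_gamma, ← factorial_mul_gamma]
    push_cast
    ring
  simp only [map_add, map_sub]
  linear_combination h3

theorem tau_p : tau p (pElt p R) = 1 := by
  obtain ⟨c, hc⟩ : ∃ c : Ainf p R, ((p - 1)! : Ainf p R) * c = p ^ (p - 1) ∧
      (p ! : Ainf p R) * c = p ^ p := by
    have h := coef_spec (p := p) (k := Perfection R p) (p - 1)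
    rw [Nat.sub_add_cancel hp.out.one_le] at h
    have h1 : (p ! : Ainf p R) * ((p : Ainf p R) * coef (p - 1)) = (p : Ainf p R) ^ p := by
      rw [mul_left_comm, h, ← pow_succ', Nat.sub_add_cancel hp.out.one_le]
    refine ⟨(p : Ainf p R) * coef (p - 1), ?_, h1⟩
    apply W_p_mul_cancel
    rw [← pow_succ', Nat.sub_add_cancel hp.out.one_le, ← h1,
      ← Nat.mul_factorial_pred hp.out.ne_zero]
    push_cast
    ring
  have h2 : delta ((pElt p R : kerTheta p R) : Ainf p R) = 1 - p ^ (p - 1) := delta_p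
  have h3 := congrArg (iota p R) hc.1
  rw [map_mul, map_natCast] at h3
  rw [tau, gamma_p p hc.2, h2, h3, ← map_add]
  simp

theorem gamma_pow (n i : ℕ) (x : kerTheta p R) : ∃ N : ℕ,
    gamma p n x ^ i = N * gamma p (n * i) x ∧ n ! ^ i * N = (n * i)! := by
  induction i with
  | zero => exact ⟨1, by simp [gamma_zero]⟩
  | succ i ih =>
    obtain ⟨N, h1, h2⟩ := ih
    refine ⟨N * (n * i + n).choose (n * i), ?_, ?_⟩
    · rw [pow_succ, h1, mul_assoc, gamma_mul, mul_add_one]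
      push_cast
      ring
    · rw [mul_add_one, ← Nat.add_choose_mul_factorial_mul_factorial, Nat.choose_symm_add, ← h2]
      ring

/-- `c_i = p ^ i / i!` -/
theorem exists_c (i : ℕ) : ∃ c : Ainf p R, (i ! : Ainf p R) * c = p ^ i := by
  cases i with
  | zero => exact ⟨1, by simp⟩
  | succ n => exact ⟨(p : Ainf p R) * coef n, by rw [mul_left_comm, coef_spec, pow_succ']⟩

theorem sigma_gamma_aux {i : ℕ} {c : Ainf p R} (hc : (i ! : Ainf p R) * c = p ^ i)
    (x : kerTheta p R) :
    gamma p i ((x : Ainf p R) ^ (p - 1) • x) =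
      iota p R c * (((p - 1)! : PDEnvelope p R) * gamma p p x) ^ i := by
  obtain ⟨N, h1, h2⟩ := gamma_pow p p i x
  rw [gamma_smul, mul_pow _ _ i, h1, map_pow, ← pow_mul, ← factorial_mul_gamma, mul_assoc, gamma_mul]
  have h3 : (p - 1) * i + i = p * i := by
    rw [← Nat.succ_mul, Nat.succ_eq_add_one, Nat.sub_add_cancel hp.out.one_le]
  have h4 : ((((p - 1) * i)! : ℕ) : Ainf p R) * ((((p - 1) * i + i).choose ((p - 1) * i) : ℕ) :
      Ainf p R) = c * ((p - 1)! : Ainf p R) ^ i * N := by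
    apply W_natCast_mul_cancel (Nat.factorial_ne_zero i)
    have h5 := Nat.add_choose_mul_factorial_mul_factorial ((p - 1) * i) i
    rw [h3, ← h2] at h5
    have h6 := congrArg (fun z : ℕ => (z : Ainf p R)) h5
    rw [← Nat.mul_factorial_pred hp.out.ne_zero, ← h3, ← Nat.choose_symm_add] at h6
    push_cast at h6
    rw [mul_pow] at h6
    linear_combination h6 - ((p - 1)! : Ainf p R) ^ i * N * hc
  have h7 := congrArg (iota p R) h4
  simp only [map_mul, map_pow, map_natCast] at h7
  rw [h3] at h7 ⊢
  linear_combination gamma p (p * i) x * h7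

/-- `(σ x)^{[n]} = p · (p ^ (n - 1) / n!) τ(x) ^ n` for `n ≥ 1`. -/
theorem gamma_frobI (n : ℕ) (x : kerTheta p R) :
    gamma p (n + 1) (frobI p x) =
      p * (iota p R (coef n) * tau p x ^ (n + 1)) := by
  have h1 : frobI p x = (x : Ainf p R) ^ (p - 1) • x + delta (x : Ainf p R) • pElt p R := by
    ext1
    change WittVector.frobenius (x : Ainf p R) =
      (x : Ainf p R) ^ (p - 1) * x + delta (x : Ainf p R) * p
    rw [delta_spec, ← pow_succ, Nat.sub_add_cancel hp.out.one_le]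
    ring
  rw [h1, gamma_add, tau, (Commute.all _ _).add_pow', Finset.mul_sum, Finset.mul_sum]
  refine Finset.sum_congr rfl ?_
  rintro ⟨i, j⟩ hij
  rw [Finset.HasAntidiagonal.mem_antidiagonal] at hij
  simp only at hij ⊢
  obtain ⟨c, hc⟩ := exists_c (R := R) p i
  obtain ⟨d, hd⟩ := exists_c (R := R) p j
  rw [sigma_gamma_aux p hc, gamma_smul, gamma_p p hd, nsmul_eq_mul]
  have h2 : c * d = (p : Ainf p R) * coef n * (((n + 1).choose i : ℕ) : Ainf p R) := by
    apply W_natCast_mul_cancel (Nat.factorial_ne_zero i)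
    apply W_natCast_mul_cancel (Nat.factorial_ne_zero j)
    have h3 := Nat.add_choose_mul_factorial_mul_factorial i j
    rw [← Nat.choose_symm_add, hij] at h3
    have h4 := congrArg (fun z : ℕ => (z : Ainf p R)) h3
    push_cast at h4
    have h5 := coef_spec (p := p) (k := Perfection R p) n
    have h6 : (p : Ainf p R) ^ i * p ^ j = p * p ^ n := by
      rw [← pow_add, hij, pow_succ']
    calc (j ! : Ainf p R) * ((i ! : Ainf p R) * (c * d))
        = ((i ! : Ainf p R) * c) * ((j ! : Ainf p R) * d) := by ring
      _ = (p : Ainf p R) * (((n + 1)! : Ainf p R) * coef n) := by rw [hc, hd, h6, h5]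
      _ = _ := by rw [← h4]; ring
  have h7 := congrArg (iota p R) h2
  simp only [map_mul, map_natCast] at h7
  linear_combination ((((p - 1)! : PDEnvelope p R) * gamma p p x) ^ i *
    iota p R (delta (x : Ainf p R)) ^ j) * h7

theorem sigma_sub_pow_mem (d : PDEnvelope p R) :
    sigma p R d - d ^ p ∈ Ideal.span {(p : PDEnvelope p R)} := by
  induction d using PDEnvelope.induction p with
  | h1 a =>
    rw [sigma_iota, delta_spec, map_add, map_pow, map_mul, map_natCast, add_sub_cancel_left]
    exact Ideal.mul_mem_right _ _ (Ideal.subset_span rfl)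
  | h2 x y hx hy =>
    obtain ⟨r, hr⟩ := exists_add_pow_prime_eq hp.out x y
    have : sigma p R (x + y) - (x + y) ^ p =
        (sigma p R x - x ^ p) + (sigma p R y - y ^ p) - p * (x * y * r) := by
      rw [map_add, hr]; ring
    rw [this]
    exact sub_mem (add_mem hx hy) (Ideal.mul_mem_right _ _ (Ideal.subset_span rfl))
  | h3 d n x hd =>
    have h : sigma p R (gamma p n x) - gamma p n x ^ p ∈ Ideal.span {(p : PDEnvelope p R)} := by
      cases n with
      | zero => simp [gamma_zero]
      | succ n =>
        apply sub_mem
        · rw [sigma_gamma, gamma_frobI]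
          exact Ideal.mul_mem_right _ _ (Ideal.subset_span rfl)
        · obtain ⟨N, h1, -⟩ := gamma_pow p (n + 1) (p - 1) x
          have h2 : gamma p (n + 1) x ^ p = gamma p (n + 1) x ^ (p - 1) * gamma p (n + 1) x := by
            rw [← pow_succ, Nat.sub_add_cancel hp.out.one_le]
          have h3 : (n + 1) * (p - 1) + (n + 1) = p * (n + 1) := by
            rw [← mul_add_one, Nat.sub_add_cancel hp.out.one_le, mul_comm]
          have h4 : (p * (n + 1)).choose (n + 1) = p * (p * (n + 1) - 1).choose n := by
            simpa using Nat.choose_mul_right (m := p) (n := n + 1) (Nat.succ_ne_zero n)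
          rw [h2, h1, mul_assoc, gamma_mul, Nat.choose_symm_add, h3, h4]
          refine Ideal.mul_mem_left _ _ ?_
          push_cast
          rw [mul_assoc]
          exact Ideal.mul_mem_right _ _ (Ideal.subset_span rfl)
    have : sigma p R (d * gamma p n x) - (d * gamma p n x) ^ p =
        (sigma p R d - d ^ p) * sigma p R (gamma p n x) +
          d ^ p * (sigma p R (gamma p n x) - gamma p n x ^ p) := by
      rw [map_mul]; ring
    rw [this]
    exact add_mem (Ideal.mul_mem_right _ _ hd) (Ideal.mul_mem_left _ _ h)

end PDEnvelope

end Envelope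

section EnvelopeSigmaOne

open scoped Nat

namespace PDEnvelope

section sigmaOne

variable (p : ℕ) [hp : Fact p.Prime] (R : Type u) [CommRing R] [CharP R p]

/-- The augmentation of the divided power algebra. -/
def aug : DividedPowerAlgebra (Ainf p R) (kerTheta p R) →+* Ainf p R :=
  dpLift (RingHom.id _) (fun n _ => if n = 0 then 1 else 0) (fun _ => rfl)
    (fun n r m => by cases n <;> simp)
    (fun n q m => by cases n <;> cases q <;> simp)
    (fun n u v => by
      cases n with
      | zero => simp
      | succ n =>
        symm
        rw [if_neg (Nat.succ_ne_zero n)]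
        refine Finset.sum_eq_zero ?_
        rintro ⟨i, j⟩ hij
        rw [Finset.HasAntidiagonal.mem_antidiagonal] at hij
        cases i <;> cases j <;> simp at hij ⊢)

/-- The ring `D[ω] / (ω ^ 2 - p ω)`. -/
abbrev DOmega : Type u := QuadraticAlgebra (PDEnvelope p R) 0 (p : PDEnvelope p R)

theorem omega_sq : (QuadraticAlgebra.omega : DOmega p R) * QuadraticAlgebra.omega =
    (p : DOmega p R) * QuadraticAlgebra.omega := by
  ext <;> simp

/-- The ring homomorphism `x^{[n]} ↦ (p ^ (n - 1) / n!) τ(x) ^ n ω` for `n ≥ 1`. -/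
def sigmaOmega : DividedPowerAlgebra (Ainf p R) (kerTheta p R) →+* DOmega p R :=
  dpLift ((algebraMap (PDEnvelope p R) (DOmega p R)).comp ((iota p R).comp WittVector.frobenius))
    (coefFun ((algebraMap (PDEnvelope p R) (DOmega p R)).comp (iota p R)) QuadraticAlgebra.omega
      (fun x => algebraMap (PDEnvelope p R) (DOmega p R) (tau p x)))
    (coefFun_zero _ _ _)
    (fun n r m => by
      cases n with
      | zero => simp [coefFun_zero]
      | succ n =>
        rw [coefFun_succ, coefFun_succ, tau_smul]
        simp only [RingHom.comp_apply, map_mul]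
        ring)
    (fun n q m => coefFun_mul (omega_sq p R) n q m)
    (fun n u v => coefFun_add (omega_sq p R)
      (fun u v => by simp only [tau_add, map_add]) n u v)

variable {R}

@[simp]
theorem aug_algebraMap (a : Ainf p R) : aug p R (algebraMap _ _ a) = a :=
  dpLift_algebraMap _ _ _ _ _ _ a

@[simp]
theorem aug_dp (n : ℕ) (x : kerTheta p R) :
    aug p R (DividedPowerAlgebra.dp _ n x) = if n = 0 then 1 else 0 :=
  dpLift_dp _ _ _ _ _ _ n x

@[simp]
theorem sigmaOmega_algebraMap (a : Ainf p R) : sigmaOmega p R (algebraMap _ _ a) =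
    algebraMap _ _ (iota p R (WittVector.frobenius a)) :=
  dpLift_algebraMap _ _ _ _ _ _ a

theorem sigmaOmega_dp_zero (x : kerTheta p R) :
    sigmaOmega p R (DividedPowerAlgebra.dp _ 0 x) = 1 :=
  dpLift_dp _ _ _ _ _ _ 0 x

theorem sigmaOmega_dp_succ (n : ℕ) (x : kerTheta p R) :
    sigmaOmega p R (DividedPowerAlgebra.dp _ (n + 1) x) =
      ⟨0, iota p R (coef n) * tau p x ^ (n + 1)⟩ := by
  refine (dpLift_dp _ _ _ _ _ _ (n + 1) x).trans ?_
  have h : algebraMap (PDEnvelope p R) (DOmega p R) (tau p x) ^ (n + 1) =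
      algebraMap (PDEnvelope p R) (DOmega p R) (tau p x ^ (n + 1)) := (map_pow _ _ _).symm
  rw [coefFun_succ, h]
  ext <;> simp [-map_pow]

theorem re_sigmaOmega (z : DividedPowerAlgebra (Ainf p R) (kerTheta p R)) :
    (sigmaOmega p R z).re = iota p R (WittVector.frobenius (aug p R z)) := by
  induction z using DividedPowerAlgebra.induction_on with
  | C a => simp
  | add x y hx hy => simp [hx, hy]
  | dp z n x hz =>
    cases n with
    | zero => rw [map_mul, sigmaOmega_dp_zero, mul_one, map_mul, hz]; simp
    | succ n => rw [map_mul, sigmaOmega_dp_succ, map_mul]; simp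

theorem re_add_im_sigmaOmega (z : DividedPowerAlgebra (Ainf p R) (kerTheta p R)) :
    (sigmaOmega p R z).re + p * (sigmaOmega p R z).im = sigma p R (proj p R z) := by
  induction z using DividedPowerAlgebra.induction_on with
  | C a =>
    have h : proj p R (algebraMap _ _ a) = iota p R a := rfl
    simp [h]
  | add x y hx hy =>
    rw [map_add, map_add, map_add, ← hx, ← hy, QuadraticAlgebra.re_add, QuadraticAlgebra.im_add]
    ring
  | dp z n x hz =>
    have h : proj p R (DividedPowerAlgebra.dp _ n x) = gamma p n x := rfl
    cases n with
    | zero => rw [map_mul, sigmaOmega_dp_zero, mul_one, hz, map_mul, h, gamma_zero, mul_one]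
    | succ n =>
      rw [map_mul, sigmaOmega_dp_succ, map_mul, h, map_mul, sigma_gamma, gamma_frobI, ← hz]
      simp
      ring

theorem theta_aug (z : DividedPowerAlgebra (Ainf p R) (kerTheta p R)) :
    theta p R (aug p R z) = toR p R (proj p R z) := by
  induction z using DividedPowerAlgebra.induction_on with
  | C a => rw [aug_algebraMap]; exact (toR_iota p a).symm
  | add x y hx hy => simp only [map_add, hx, hy]
  | dp z n x hz =>
    have h : toR p R (proj p R (DividedPowerAlgebra.dp _ n x)) = _ := toR_gamma p n x
    rw [map_mul, map_mul, map_mul, map_mul, h, hz, aug_dp]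
    cases n <;> simp

theorem tau_neg (x : kerTheta p R) : tau p (-x) = - tau p x := by
  have := tau_smul p (-1) x
  simpa using this

theorem im_mul (z w : DividedPowerAlgebra (Ainf p R) (kerTheta p R))
    (hw : aug p R w ∈ kerTheta p R) (hzw : aug p R (z * w) ∈ kerTheta p R) :
    (sigmaOmega p R (z * w)).im + tau p ⟨aug p R (z * w), hzw⟩ =
      sigma p R (proj p R z) * ((sigmaOmega p R w).im + tau p ⟨aug p R w, hw⟩) := by
  have h1 : (⟨aug p R (z * w), hzw⟩ : kerTheta p R) = aug p R z • ⟨aug p R w, hw⟩ := by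
    ext1; simp
  have h2 := p_mul_tau p ⟨aug p R w, hw⟩
  rw [h1, tau_smul, map_mul, QuadraticAlgebra.im_mul, ← re_add_im_sigmaOmega, re_sigmaOmega,
    re_sigmaOmega]
  linear_combination -(sigmaOmega p R z).im * h2

theorem im_add (z w : DividedPowerAlgebra (Ainf p R) (kerTheta p R))
    (hz : aug p R z ∈ kerTheta p R) (hw : aug p R w ∈ kerTheta p R)
    (hzw : aug p R (z + w) ∈ kerTheta p R) :
    (sigmaOmega p R (z + w)).im + tau p ⟨aug p R (z + w), hzw⟩ =
      ((sigmaOmega p R z).im + tau p ⟨aug p R z, hz⟩) +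
      ((sigmaOmega p R w).im + tau p ⟨aug p R w, hw⟩) := by
  have h1 : (⟨aug p R (z + w), hzw⟩ : kerTheta p R) = ⟨aug p R z, hz⟩ + ⟨aug p R w, hw⟩ := by
    ext1; simp
  rw [h1, tau_add, map_add, QuadraticAlgebra.im_add]
  ring

theorem aug_mem {z : DividedPowerAlgebra (Ainf p R) (kerTheta p R)}
    (h : toR p R (proj p R z) = 0) : aug p R z ∈ kerTheta p R := by
  rw [RingHom.mem_ker, theta_aug, h]

theorem aug_mem' {z : DividedPowerAlgebra (Ainf p R) (kerTheta p R)} (h : z ∈ pdRel p R) :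
    aug p R z ∈ kerTheta p R :=
  aug_mem p (by rw [(proj_eq_zero_iff p R).2 h, map_zero])

theorem im_rel {z : DividedPowerAlgebra (Ainf p R) (kerTheta p R)} (h : z ∈ pdRel p R) :
    (sigmaOmega p R z).im + tau p ⟨aug p R z, aug_mem' p h⟩ = 0 := by
  have h0 : tau p (0 : kerTheta p R) = 0 := by simpa using tau_smul p 0 (0 : kerTheta p R)
  induction h using Submodule.span_induction with
  | zero =>
    have : (⟨aug p R 0, aug_mem' p (zero_mem _)⟩ : kerTheta p R) = 0 := by ext1; simp
    rw [this, h0]; simp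
  | add x y hx hy h1 h2 =>
    rw [im_add p x y (aug_mem' p hx) (aug_mem' p hy), h1, h2, add_zero]
  | smul a x hx h1 =>
    have := im_mul p a x (aug_mem' p hx) (aug_mem' p (Submodule.smul_mem _ a hx))
    refine this.trans ?_
    rw [h1, mul_zero]
  | mem z hz =>
    have hz' : aug p R z ∈ kerTheta p R := aug_mem' p (Ideal.subset_span hz)
    rcases hz with ⟨x, rfl⟩ | ⟨n, c, hc, rfl⟩
    · have : (⟨_, hz'⟩ : kerTheta p R) = -x := by ext1; simp
      rw [this, map_sub, sigmaOmega_dp_succ, tau_neg, coef_zero]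
      simp
    · cases n with
      | zero =>
        obtain rfl := eq_one_of_zero p hc
        have : (⟨_, hz'⟩ : kerTheta p R) = 0 := by ext1; simp
        rw [this, map_sub, sigmaOmega_dp_zero, h0]
        simp
      | succ n =>
        obtain rfl := eq_p_mul_coef p hc
        have : (⟨_, hz'⟩ : kerTheta p R) = (-coef n : Ainf p R) • pElt p R := by
          ext1; simp [pElt]; ring
        rw [this, map_sub, sigmaOmega_dp_succ, tau_smul, tau_p, map_neg, frobenius_coef]
        simp

theorem im_eq {z w : DividedPowerAlgebra (Ainf p R) (kerTheta p R)}
    (hz : aug p R z ∈ kerTheta p R) (hw : aug p R w ∈ kerTheta p R)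
    (h : proj p R z = proj p R w) :
    (sigmaOmega p R z).im + tau p ⟨aug p R z, hz⟩ =
      (sigmaOmega p R w).im + tau p ⟨aug p R w, hw⟩ := by
  have h1 : z - w ∈ pdRel p R := by
    rw [← proj_eq_zero_iff, map_sub, h, sub_self]
  have h2 := im_add p (z - w) w (aug_mem' p h1) hw (by rwa [sub_add_cancel])
  rw [im_rel p h1, zero_add] at h2
  rw [← h2]
  simp only [sub_add_cancel]

variable (R)

theorem exists_proj (x : RingHom.ker (toR p R)) : ∃ z, proj p R z = x :=
  proj_surjective p R x

/-- The functorial `σ`-linear map `σ₁ : Ker(D → R) → D` with `p σ₁ = σ`; it is characterized by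
`σ₁(x^{[n]}) = (p ^ (n - 1) / n!) τ(x) ^ n` for `n ≥ 1` and `x` in `Ker(W(R^♭) → R)`, where
`τ(x) = (p - 1)! x^{[p]} + δ(x)`. In particular `σ₁(p) = 1`, and since `δ([a]) = 0` for `a` in
`Ker(R^♭ → R)` we get `σ₁([a]^{[n]}) = ((p n)! / (p n!)) [a]^{[p n]}`. -/
def sigmaOne : RingHom.ker (toR p R) →ₛₗ[sigma p R] PDEnvelope p R where
  toFun x := (sigmaOmega p R (exists_proj p R x).choose).im +
    tau p ⟨aug p R (exists_proj p R x).choose,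
      aug_mem p (by rw [(exists_proj p R x).choose_spec]; exact x.2)⟩
  map_add' x y := by
    have hx := (exists_proj p R x).choose_spec
    have hy := (exists_proj p R y).choose_spec
    rw [← im_add]
    · refine im_eq p _ _ ?_
      rw [(exists_proj p R (x + y)).choose_spec, map_add, hx, hy]; rfl
    · refine aug_mem p ?_
      rw [map_add, hx, hy]
      exact (x + y).2
  map_smul' a x := by
    obtain ⟨a, rfl⟩ := proj_surjective p R a
    have hx := (exists_proj p R x).choose_spec
    rw [smul_eq_mul, ← im_mul]
    · refine im_eq p _ _ ?_
      rw [(exists_proj p R _).choose_spec, map_mul, hx]; rfl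
    · refine aug_mem p ?_
      rw [map_mul, hx]
      exact (proj p R a • x).2

variable {R}

theorem sigmaOne_proj (z : DividedPowerAlgebra (Ainf p R) (kerTheta p R))
    (h : proj p R z ∈ RingHom.ker (toR p R)) : sigmaOne p R ⟨proj p R z, h⟩ =
      (sigmaOmega p R z).im + tau p ⟨aug p R z, aug_mem p h⟩ :=
  im_eq p _ _ (exists_proj p R ⟨proj p R z, h⟩).choose_spec

theorem gamma_mem (n : ℕ) (x : kerTheta p R) : gamma p (n + 1) x ∈ RingHom.ker (toR p R) := by
  rw [RingHom.mem_ker, toR_gamma, if_neg (Nat.succ_ne_zero n)]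

theorem sigmaOne_gamma (n : ℕ) (x : kerTheta p R) :
    sigmaOne p R ⟨gamma p (n + 1) x, gamma_mem p n x⟩ =
      iota p R (coef n) * tau p x ^ (n + 1) := by
  refine (sigmaOne_proj p _ (gamma_mem p n x)).trans ?_
  have h0 : tau p (0 : kerTheta p R) = 0 := by simpa using tau_smul p 0 (0 : kerTheta p R)
  have : (⟨_, aug_mem p (gamma_mem p n x)⟩ : kerTheta p R) = 0 := by ext1; simp
  rw [this, h0, add_zero, sigmaOmega_dp_succ]

theorem p_mul_sigmaOne (x : RingHom.ker (toR p R)) :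
    (p : PDEnvelope p R) * sigmaOne p R x = sigma p R x := by
  obtain ⟨x, hx⟩ := x
  obtain ⟨z, rfl⟩ := proj_surjective p R x
  rw [sigmaOne_proj, mul_add, p_mul_tau, ← re_add_im_sigmaOmega, re_sigmaOmega]
  ring

theorem p_mem : (p : PDEnvelope p R) ∈ RingHom.ker (toR p R) := by
  rw [RingHom.mem_ker, map_natCast, CharP.cast_eq_zero]

theorem sigmaOne_p : sigmaOne p R ⟨p, p_mem p⟩ = 1 := by
  have h : gamma p 1 (pElt p R) = (p : PDEnvelope p R) := by
    rw [gamma_one]; simp [pElt]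
  have := sigmaOne_gamma p 0 (pElt p R)
  simpa [tau_p, coef_zero, h] using this

theorem ker_toR_eq : RingHom.ker (toR p R) =
    Ideal.span {d | ∃ (n : ℕ) (x : kerTheta p R), d = gamma p (n + 1) x} := by
  apply le_antisymm
  · have key : ∀ d : PDEnvelope p R, ∃ a : Ainf p R, toR p R d = theta p R a ∧ d - iota p R a ∈
        Ideal.span {d | ∃ (n : ℕ) (x : kerTheta p R), d = gamma p (n + 1) x} := by
      intro d
      induction d using PDEnvelope.induction p with
      | h1 a => exact ⟨a, by simp, by simp⟩
      | h2 x y hx hy =>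
        obtain ⟨a, ha, ha'⟩ := hx
        obtain ⟨b, hb, hb'⟩ := hy
        refine ⟨a + b, by simp [ha, hb], ?_⟩
        rw [map_add, add_sub_add_comm]
        exact add_mem ha' hb'
      | h3 d n x hd =>
        cases n with
        | zero => simpa [gamma_zero] using hd
        | succ n =>
          refine ⟨0, by simp, ?_⟩
          rw [map_zero, sub_zero]
          exact Ideal.mul_mem_left _ _ (Ideal.subset_span ⟨n, x, rfl⟩)
    intro d hd
    obtain ⟨a, ha, ha'⟩ := key d
    have h1 : a ∈ kerTheta p R := by
      rw [RingHom.mem_ker, ← ha]; exact hd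
    have h2 : iota p R a ∈
        Ideal.span {d | ∃ (n : ℕ) (x : kerTheta p R), d = gamma p (n + 1) x} :=
      Ideal.subset_span ⟨0, ⟨a, h1⟩, (gamma_one p ⟨a, h1⟩).symm⟩
    simpa using add_mem ha' h2
  · rw [Ideal.span_le]
    rintro _ ⟨n, x, rfl⟩
    exact gamma_mem p n x

theorem toR_sigma (d : PDEnvelope p R) : toR p R (sigma p R d) = toR p R d ^ p := by
  have h := sigma_sub_pow_mem p d
  obtain ⟨c, hc⟩ := Ideal.mem_span_singleton.1 h
  have := congrArg (toR p R) hc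
  rw [map_sub, map_mul, map_natCast, CharP.cast_eq_zero, zero_mul, map_pow, sub_eq_zero] at this
  exact this

end sigmaOne

end PDEnvelope

end EnvelopeSigmaOne

section CrystallinePeriodRing

section Acris

variable (p : ℕ) [hp : Fact p.Prime] (R : Type u) [CommRing R] [CharP R p]

/-- The ideal `p D` of the divided power envelope. -/
abbrev pD : Ideal (PDEnvelope p R) := Ideal.span {(p : PDEnvelope p R)}

/-- The ring `A_cris(R)`: the `p`-adic completion of the divided power envelope of `W(R^♭) → R`. -/
abbrev Acris : Type u := AdicCompletion (pD p R) (PDEnvelope p R)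

namespace Acris

open PDEnvelope

variable {R}

/-- `Rep p n x d` means that `d` represents `x` modulo `p ^ n`. -/
def Rep (n : ℕ) (x : Acris p R) (d : PDEnvelope p R) : Prop :=
  AdicCompletion.evalₐ (pD p R) n x = Ideal.Quotient.mk _ d

theorem exists_rep (n : ℕ) (x : Acris p R) : ∃ d, Rep p n x d := by
  obtain ⟨d, hd⟩ := Ideal.Quotient.mk_surjective (AdicCompletion.evalₐ (pD p R) n x)
  exact ⟨d, hd.symm⟩

theorem Rep.mono {m n : ℕ} (h : m ≤ n) {x : Acris p R} {d : PDEnvelope p R} (hx : Rep p n x d) :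
    Rep p m x d := by
  obtain ⟨s, rfl⟩ := AdicCompletion.mk_surjective _ _ x
  unfold Rep at hx ⊢
  rw [AdicCompletion.evalₐ_mk, Ideal.Quotient.eq] at hx ⊢
  have h1 := s.property h
  rw [SModEq.sub_mem, smul_eq_mul, Ideal.mul_top] at h1
  have h2 := add_mem h1 (Ideal.pow_le_pow_right h hx)
  rwa [sub_add_sub_cancel] at h2

theorem ext_rep {x y : Acris p R} (h : ∀ n, ∃ d, Rep p n x d ∧ Rep p n y d) : x = y := by
  apply AdicCompletion.ext_evalₐ
  intro n
  obtain ⟨d, h1, h2⟩ := h n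
  exact Eq.trans h1 (Eq.symm h2)

variable {p} {n : ℕ} {x y : Acris p R} {d e : PDEnvelope p R}

theorem Rep.sub_mem (h : Rep p n x d) (h' : Rep p n x e) : d - e ∈ pD p R ^ n :=
  Ideal.Quotient.eq.1 (Eq.trans (Eq.symm h) h')

theorem Rep.congr (h : Rep p n x d) (h' : d - e ∈ pD p R ^ n) : Rep p n x e :=
  Eq.trans h (Ideal.Quotient.eq.2 h')

theorem Rep.add (h : Rep p n x d) (h' : Rep p n y e) : Rep p n (x + y) (d + e) := by
  unfold Rep at *; rw [map_add, map_add, h, h']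

theorem Rep.mul (h : Rep p n x d) (h' : Rep p n y e) : Rep p n (x * y) (d * e) := by
  unfold Rep at *; rw [map_mul, map_mul, h, h']

theorem Rep.pow (h : Rep p n x d) (m : ℕ) : Rep p n (x ^ m) (d ^ m) := by
  unfold Rep at *; rw [map_pow, map_pow, h]

theorem Rep.sub (h : Rep p n x d) (h' : Rep p n y e) : Rep p n (x - y) (d - e) := by
  unfold Rep at *; rw [map_sub, map_sub, h, h']

theorem rep_natCast (n m : ℕ) : Rep p n (m : Acris p R) (m : PDEnvelope p R) := by
  unfold Rep; rw [map_natCast, map_natCast]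

theorem rep_one (n : ℕ) : Rep p n (1 : Acris p R) (1 : PDEnvelope p R) := by
  unfold Rep; rw [map_one, map_one]

theorem pD_pow : pD p R ^ n = Ideal.span {(p : PDEnvelope p R) ^ n} :=
  Ideal.span_singleton_pow _ _

variable (p R)

theorem pD_pow_le_comap (n : ℕ) : pD p R ^ n ≤ (pD p R ^ n).comap (PDEnvelope.sigma p R) := by
  rw [pD_pow, Ideal.span_le, Set.singleton_subset_iff, SetLike.mem_coe, Ideal.mem_comap]
  rw [map_pow, map_natCast]
  exact Ideal.subset_span rfl

theorem toR_eq_zero (a : PDEnvelope p R) (ha : a ∈ pD p R) : PDEnvelope.toR p R a = 0 := by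
  obtain ⟨c, rfl⟩ := Ideal.mem_span_singleton.1 ha
  rw [map_mul, map_natCast, CharP.cast_eq_zero, zero_mul]

/-- The natural map `A_cris(R) → R`. -/
def toR : Acris p R →+* R :=
  (Ideal.Quotient.lift (pD p R) (PDEnvelope.toR p R) (toR_eq_zero p R)).comp
    (AdicCompletion.evalOneₐ (pD p R)).toRingHom

theorem sigma_compat {m n : ℕ} (hle : m ≤ n) :
    (Ideal.Quotient.factorPow (pD p R) hle).comp
      ((Ideal.quotientMap (pD p R ^ n) (PDEnvelope.sigma p R) (pD_pow_le_comap p R n)).comp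
        (AdicCompletion.evalₐ (pD p R) n).toRingHom) =
      (Ideal.quotientMap (pD p R ^ m) (PDEnvelope.sigma p R) (pD_pow_le_comap p R m)).comp
        (AdicCompletion.evalₐ (pD p R) m).toRingHom := by
  ext x
  obtain ⟨d, hd⟩ := exists_rep p n x
  have hd' := hd.mono p hle
  unfold Rep at hd hd'
  change Ideal.Quotient.factorPow _ hle (Ideal.quotientMap _ _ (pD_pow_le_comap p R n)
    (AdicCompletion.evalₐ (pD p R) n x)) =
      Ideal.quotientMap _ _ (pD_pow_le_comap p R m) (AdicCompletion.evalₐ (pD p R) m x)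
  rw [hd, hd', Ideal.quotientMap_mk, Ideal.quotientMap_mk]
  rfl

/-- The Frobenius lift `σ` of `A_cris(R)`, the completion of `σ : D → D`. -/
def sigma : Acris p R →+* Acris p R :=
  AdicCompletion.liftRingHom (pD p R)
    (fun n => (Ideal.quotientMap (pD p R ^ n) (PDEnvelope.sigma p R) (pD_pow_le_comap p R n)).comp
      (AdicCompletion.evalₐ (pD p R) n).toRingHom)
    (fun hle => sigma_compat p R hle)

variable {p R}

theorem Rep.sigma (h : Rep p n x d) : Rep p n (sigma p R x) (PDEnvelope.sigma p R d) := by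
  unfold Rep at *
  rw [Acris.sigma, AdicCompletion.evalₐ_liftRingHom _ _ (fun hle => sigma_compat p R hle)]
  change Ideal.quotientMap _ _ (pD_pow_le_comap p R n) (AdicCompletion.evalₐ (pD p R) n x) = _
  rw [h, Ideal.quotientMap_mk]

theorem Rep.toR_one (h : Rep p 1 x d) : toR p R x = PDEnvelope.toR p R d := by
  unfold Rep at h
  have h1 : AdicCompletion.evalOneₐ (pD p R) x = Ideal.Quotient.mk _ d := by
    rw [← AdicCompletion.factorₐ_evalₐ_one, h]
    rfl
  change Ideal.Quotient.lift (pD p R) (PDEnvelope.toR p R) (toR_eq_zero p R)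
    (AdicCompletion.evalOneₐ (pD p R) x) = _
  rw [h1, Ideal.Quotient.lift_mk]

theorem Rep.toR (h : Rep p (n + 1) x d) : toR p R x = PDEnvelope.toR p R d :=
  (h.mono p (by omega)).toR_one

theorem Rep.mem_ker (h : Rep p (n + 1) x d) (hx : x ∈ RingHom.ker (Acris.toR p R)) :
    d ∈ RingHom.ker (PDEnvelope.toR p R) := by
  rw [RingHom.mem_ker, ← h.toR]; exact hx

theorem sigmaOne_mem {c : PDEnvelope p R} (hc : c ∈ pD p R ^ (n + 1))
    (hc' : c ∈ RingHom.ker (PDEnvelope.toR p R)) :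
    PDEnvelope.sigmaOne p R ⟨c, hc'⟩ ∈ pD p R ^ n := by
  rw [pD_pow, Ideal.mem_span_singleton] at hc
  obtain ⟨e, rfl⟩ := hc
  have h1 : (⟨_, hc'⟩ : RingHom.ker (PDEnvelope.toR p R)) =
      ((p : PDEnvelope p R) ^ n * e) • ⟨p, PDEnvelope.p_mem p⟩ := by
    ext1
    change _ = (p : PDEnvelope p R) ^ n * e * p
    ring
  rw [h1, LinearMap.map_smulₛₗ, PDEnvelope.sigmaOne_p, map_mul, map_pow, map_natCast, smul_eq_mul,
    mul_one, pD_pow]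
  exact Ideal.mul_mem_right _ _ (Ideal.subset_span rfl)

theorem sigmaOne_sub_mem (h : d - e ∈ pD p R ^ (n + 1))
    (hd : d ∈ RingHom.ker (PDEnvelope.toR p R)) (he : e ∈ RingHom.ker (PDEnvelope.toR p R)) :
    PDEnvelope.sigmaOne p R ⟨d, hd⟩ - PDEnvelope.sigmaOne p R ⟨e, he⟩ ∈ pD p R ^ n := by
  rw [← map_sub]
  exact sigmaOne_mem h (sub_mem hd he)

/-- The underlying function of `σ₁`. -/
def sigmaOneFun (x : RingHom.ker (Acris.toR p R)) : Acris p R :=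
  AdicCompletion.mk _ _ (AdicCompletion.AdicCauchySequence.mk _ _
    (fun n => PDEnvelope.sigmaOne p R ⟨(exists_rep p (n + 1) (x : Acris p R)).choose,
      (exists_rep p (n + 1) (x : Acris p R)).choose_spec.mem_ker x.2⟩)
    (fun n => by
      rw [SModEq.sub_mem, smul_eq_mul, Ideal.mul_top]
      apply sigmaOne_sub_mem
      exact (exists_rep p (n + 1) (x : Acris p R)).choose_spec.sub_mem
        ((exists_rep p (n + 1 + 1) (x : Acris p R)).choose_spec.mono p (by omega))))

theorem Rep.sigmaOne {x : RingHom.ker (Acris.toR p R)} (h : Rep p (n + 1) (x : Acris p R) d) :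
    Rep p n (sigmaOneFun x) (PDEnvelope.sigmaOne p R ⟨d, h.mem_ker x.2⟩) := by
  unfold Rep
  rw [sigmaOneFun, AdicCompletion.evalₐ_mk, Ideal.Quotient.eq]
  apply sigmaOne_sub_mem
  exact (exists_rep p (n + 1) (x : Acris p R)).choose_spec.sub_mem h

variable (p R)

/-- The `σ`-linear map `σ₁ : Ker(A_cris(R) → R) → A_cris(R)`, the completion of the map
`σ₁ : Ker(D → R) → D`. -/
def sigmaOne : RingHom.ker (Acris.toR p R) →ₛₗ[sigma p R] Acris p R where
  toFun := sigmaOneFun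
  map_add' x y := by
    refine ext_rep p fun n => ?_
    obtain ⟨d, hd⟩ := exists_rep p (n + 1) (x : Acris p R)
    obtain ⟨e, he⟩ := exists_rep p (n + 1) (y : Acris p R)
    have h : Rep p (n + 1) ((x + y : RingHom.ker (Acris.toR p R)) : Acris p R) (d + e) := hd.add he
    refine ⟨_, h.sigmaOne, ?_⟩
    have h1 := hd.sigmaOne.add he.sigmaOne
    rwa [← map_add] at h1
  map_smul' a x := by
    refine ext_rep p fun n => ?_
    obtain ⟨d, hd⟩ := exists_rep p (n + 1) (x : Acris p R)
    obtain ⟨e, he⟩ := exists_rep p (n + 1) a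
    have h : Rep p (n + 1) ((a • x : RingHom.ker (Acris.toR p R)) : Acris p R) (e * d) := he.mul hd
    refine ⟨_, h.sigmaOne, ?_⟩
    have h1 := (he.mono p (Nat.le_succ n)).sigma.mul hd.sigmaOne
    rwa [← smul_eq_mul (PDEnvelope.sigma p R e), ← LinearMap.map_smulₛₗ] at h1

variable {p R}

theorem Rep.sigmaOne' {x : RingHom.ker (Acris.toR p R)} (h : Rep p (n + 1) (x : Acris p R) d) :
    Rep p n (Acris.sigmaOne p R x) (PDEnvelope.sigmaOne p R ⟨d, h.mem_ker x.2⟩) := h.sigmaOne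

theorem p_mul_sigmaOne (x : RingHom.ker (Acris.toR p R)) :
    (p : Acris p R) * sigmaOne p R x = sigma p R x := by
  refine ext_rep p fun n => ?_
  obtain ⟨d, hd⟩ := exists_rep p (n + 1) (x : Acris p R)
  refine ⟨_, (rep_natCast n p).mul hd.sigmaOne', ?_⟩
  rw [PDEnvelope.p_mul_sigmaOne]
  exact (hd.mono p (Nat.le_succ n)).sigma

theorem p_mem : (p : Acris p R) ∈ RingHom.ker (Acris.toR p R) := by
  rw [RingHom.mem_ker, map_natCast, CharP.cast_eq_zero]

theorem sigmaOne_p : sigmaOne p R ⟨p, p_mem⟩ = 1 := by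
  refine ext_rep p fun n => ?_
  refine ⟨_, Rep.sigmaOne' (x := ⟨p, p_mem⟩) (rep_natCast (n + 1) p), ?_⟩
  rw [PDEnvelope.sigmaOne_p]
  exact rep_one n

theorem pD_fg : (pD p R).FG := ⟨{(p : PDEnvelope p R)}, by simp⟩

theorem map_pD : (pD p R).map (algebraMap (PDEnvelope p R) (Acris p R)) =
    Ideal.span {(p : Acris p R)} := by
  rw [Ideal.map_span, Set.image_singleton, map_natCast]

theorem mem_span_p (h : Rep p 1 x d) (hd : d ∈ pD p R) : x ∈ Ideal.span {(p : Acris p R)} := by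
  have h1 : x ∈ RingHom.ker (AdicCompletion.evalOneₐ (pD p R)).toRingHom := by
    change AdicCompletion.evalOneₐ (pD p R) x = 0
    unfold Rep at h
    rw [← AdicCompletion.factorₐ_evalₐ_one, h]
    exact Ideal.Quotient.eq_zero_iff_mem.2 hd
  have h2 := AdicCompletion.ker_evalOneₐ_eq_map (I := pD p R) pD_fg
  rw [← map_pD]
  exact h2.le h1

theorem sigma_sub_pow_mem (x : Acris p R) :
    sigma p R x - x ^ p ∈ Ideal.span {(p : Acris p R)} := by
  obtain ⟨d, hd⟩ := exists_rep p 1 x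
  exact mem_span_p (hd.sigma.sub (hd.pow p)) (PDEnvelope.sigma_sub_pow_mem p d)

theorem span_p_le_jacobson : Ideal.span {(p : Acris p R)} ≤ (⊥ : Ideal (Acris p R)).jacobson := by
  have : IsAdicComplete (Ideal.span {(p : Acris p R)}) (Acris p R) := by
    rw [← map_pD, IsAdicComplete.map_algebraMap_iff]
    exact AdicCompletion.isAdicComplete pD_fg
  exact IsAdicComplete.le_jacobson_bot _

theorem ker_le_jacobson : RingHom.ker (Acris.toR p R) ≤ (⊥ : Ideal (Acris p R)).jacobson := by
  intro x hx
  have h1 := sigma_sub_pow_mem x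
  have h2 : sigma p R x ∈ Ideal.span {(p : Acris p R)} := by
    rw [← p_mul_sigmaOne ⟨x, hx⟩]
    exact Ideal.mul_mem_right _ _ (Ideal.subset_span rfl)
  have h3 := span_p_le_jacobson (sub_mem h2 h1)
  rw [sub_sub_cancel] at h3
  exact Ideal.isRadical_jacobson ⊥ ⟨p, h3⟩

end Acris

/-- The frame `A_cris(R)`, with `Fil¹ A_cris(R) = Ker(A_cris(R) → R)`. -/
def acrisFrame : Frame.{u} p where
  S := Acris p R
  Fil := RingHom.ker (Acris.toR p R)
  σ := Acris.sigma p R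
  σ₁ := Acris.sigmaOne p R
  le_jacobson := sup_le Acris.span_p_le_jacobson Acris.ker_le_jacobson
  frobenius_lift := Acris.sigma_sub_pow_mem
  span_σ₁ := by
    rw [Ideal.eq_top_iff_one]
    exact Ideal.subset_span ⟨_, Acris.sigmaOne_p⟩

end Acris

end CrystallinePeriodRing

section WeakLift

/-! ## The straight weak lift -/

section WittIdeal

variable {p : ℕ} [hp : Fact p.Prime]

theorem coeff_teichmuller_mul {A : Type u} [CommRing A] [CharP A p] (n : ℕ) (x : A)
    (a : WittVector p A) : (WittVector.teichmuller p x * a).coeff n = x ^ p ^ n * a.coeff n := by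
  induction n generalizing x a with
  | zero => simp [WittVector.mul_coeff_zero]
  | succ n ih =>
    have h1 : a = WittVector.teichmuller p (a.coeff 0) + WittVector.verschiebung (a.shift 1) := by
      ext m
      rw [WittVector.coeff_add_of_disjoint]
      · cases m with
        | zero => simp
        | succ m =>
          rw [WittVector.teichmuller_coeff_pos _ _ _ (Nat.succ_pos m),
            WittVector.verschiebung_coeff_succ, WittVector.shift_coeff, zero_add, add_comm]
      · intro m
        cases m with
        | zero => right; simp
        | succ m => left; exact WittVector.teichmuller_coeff_pos _ _ _ (Nat.succ_pos m)
    have h2 : WittVector.teichmuller p x * a = WittVector.teichmuller p (x * a.coeff 0) +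
        WittVector.verschiebung (WittVector.teichmuller p (x ^ p) * a.shift 1) := by
      have h3 : WittVector.frobenius (WittVector.teichmuller p x) =
          WittVector.teichmuller p (x ^ p) := by
        rw [WittVector.frobenius_eq_map_frobenius, WittVector.map_teichmuller, frobenius_def]
      rw [← h3, mul_comm _ (a.shift 1), WittVector.verschiebung_mul_frobenius, map_mul]
      conv_lhs => rw [h1]
      ring
    rw [h2, WittVector.coeff_add_of_disjoint,
      WittVector.teichmuller_coeff_pos _ _ _ (Nat.succ_pos n),
      WittVector.verschiebung_coeff_succ, ih, WittVector.shift_coeff, zero_add, ← pow_mul,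
      ← pow_succ', add_comm 1 n]
    intro m
    cases m with
    | zero => right; simp
    | succ m => left; exact WittVector.teichmuller_coeff_pos _ _ _ (Nat.succ_pos m)

variable {k : Type u} [CommRing k] [CharP k p]

set_option linter.unusedSectionVars false

open Polynomial in
/-- `[X] a` in `W(k[X])`. -/
def twist (a : WittVector p k) : WittVector p k[X] :=
  WittVector.teichmuller p X * WittVector.map C a

open Polynomial in
theorem twist_coeff (a : WittVector p k) (n : ℕ) :
    (twist a).coeff n = monomial (p ^ n) (a.coeff n) := by
  rw [twist, coeff_teichmuller_mul, WittVector.map_coeff, X_pow_mul_C, C_mul_X_pow_eq_monomial]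

variable (p) in
/-- The subring `W(k[J X])` of `W(k[X])`. -/
def wittRees (J : Ideal k) : Subring (WittVector p (Polynomial k)) :=
  (WittVector.map (p := p) (reesAlgebra J).val.toRingHom).range

theorem mem_wittRees {J : Ideal k} {z : WittVector p (Polynomial k)} :
    z ∈ wittRees p J ↔ ∀ n, z.coeff n ∈ reesAlgebra J := by
  constructor
  · rintro ⟨w, rfl⟩ n
    rw [WittVector.map_coeff]
    exact (w.coeff n).2
  · intro h
    refine ⟨WittVector.mk p fun n => ⟨z.coeff n, h n⟩, ?_⟩
    ext1 n
    rw [WittVector.map_coeff, WittVector.coeff_mk]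
    rfl

theorem twist_mem {J : Ideal k} {a : WittVector p k} :
    twist a ∈ wittRees p J ↔ ∀ n, a.coeff n ∈ J ^ p ^ n := by
  simp only [mem_wittRees, twist_coeff, reesAlgebra.monomial_mem]

variable (p) in
/-- The ideal `W(J_*)` of `W(k)` for `J_i = J ^ (p ^ i)`: all Witt vectors `(a₀, a₁, …)` such that
`a_i` lies in `J_i` for all `i`. -/
def wittIdeal (J : Ideal k) : Ideal (WittVector p k) where
  carrier := {a | ∀ i, a.coeff i ∈ J ^ p ^ i}
  zero_mem' i := by simp
  add_mem' {a b} ha hb := by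
    have h := add_mem (twist_mem.2 ha) (twist_mem.2 hb)
    rw [twist, twist, ← mul_add, ← map_add] at h
    exact twist_mem.1 h
  smul_mem' r a ha := by
    have h1 : WittVector.map Polynomial.C r ∈ wittRees p J := by
      rw [mem_wittRees]
      intro n
      rw [WittVector.map_coeff]
      exact (reesAlgebra J).algebraMap_mem (r.coeff n)
    have h := mul_mem h1 (twist_mem.2 ha)
    rw [twist, mul_left_comm, ← map_mul] at h
    exact twist_mem.1 h

theorem mem_wittIdeal {J : Ideal k} {a : WittVector p k} :
    a ∈ wittIdeal p J ↔ ∀ i, a.coeff i ∈ J ^ p ^ i := Iff.rfl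

theorem frobenius_mem_wittIdeal {J : Ideal k} {a : WittVector p k} (ha : a ∈ wittIdeal p J) :
    WittVector.frobenius a ∈ wittIdeal p J := by
  intro i
  rw [WittVector.coeff_frobenius_charP]
  exact Ideal.pow_mem_of_mem _ (ha i) _ hp.out.pos

theorem frobenius_mem_of_p_mul {J : Ideal k} {a : WittVector p k}
    (ha : (p : WittVector p k) * a ∈ wittIdeal p J) : WittVector.frobenius a ∈ wittIdeal p J := by
  intro i
  have h := ha (i + 1)
  rw [mul_comm, WittVector.mul_charP_coeff_succ] at h
  rw [WittVector.coeff_frobenius_charP]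
  exact Ideal.pow_le_pow_right (Nat.pow_le_pow_right hp.out.pos (Nat.le_succ i)) h

theorem teichmuller_mem_wittIdeal {J : Ideal k} {a : k} (ha : a ∈ J) :
    WittVector.teichmuller p a ∈ wittIdeal p J := by
  intro i
  cases i with
  | zero => simpa using ha
  | succ i =>
    rw [WittVector.teichmuller_coeff_pos _ _ _ (Nat.succ_pos i)]
    exact zero_mem _

end WittIdeal

section AJ

variable (p : ℕ) [hp : Fact p.Prime] (R : Type u) [CommRing R] [CharP R p]

/-- The ideal `W(J_*)` of `W(R^♭)` for `J = Ker(R^♭ → R)` and `J_i = J ^ (p ^ i)`. -/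
abbrev wittJ : Ideal (Ainf p R) := wittIdeal p (idealJ p R)

/-- The ring `A(J_*) = W(R^♭) / W(J_*)`. -/
abbrev AJ : Type u := Ainf p R ⧸ wittJ p R

namespace AJ

/-- The projection `W(R^♭) → A(J_*)`. -/
abbrev mk : Ainf p R →+* AJ p R := Ideal.Quotient.mk (wittJ p R)

/-- The Frobenius lift `σ` of `A(J_*)`, induced by the Frobenius of `W(R^♭)`. -/
def sigma : AJ p R →+* AJ p R :=
  Ideal.quotientMap (wittJ p R) WittVector.frobenius (fun _ ha => frobenius_mem_wittIdeal ha)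

variable {R}

theorem sigma_mk (a : Ainf p R) : sigma p R (mk p R a) = mk p R (WittVector.frobenius a) :=
  Ideal.quotientMap_mk

theorem sigma_eq_zero {y : AJ p R} (h : (p : AJ p R) * y = 0) : sigma p R y = 0 := by
  obtain ⟨a, rfl⟩ := Ideal.Quotient.mk_surjective y
  rw [← map_natCast (mk p R), ← map_mul, Ideal.Quotient.eq_zero_iff_mem] at h
  rw [sigma_mk, Ideal.Quotient.eq_zero_iff_mem]
  exact frobenius_mem_of_p_mul h

theorem sigma_congr {y z : AJ p R} (h : (p : AJ p R) * y = p * z) : sigma p R y = sigma p R z := by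
  rw [← sub_eq_zero, ← map_sub]
  apply sigma_eq_zero
  rw [mul_sub, h, sub_self]

theorem exists_of_mem (x : Ideal.span {(p : AJ p R)}) : ∃ y : AJ p R, (p : AJ p R) * y = x := by
  obtain ⟨y, hy⟩ := Ideal.mem_span_singleton.1 x.2
  exact ⟨y, hy.symm⟩

variable (R)

/-- The `σ`-linear map `σ₁ : p A(J_*) → A(J_*)`, `σ₁(p y) = σ(y)`. -/
def sigmaOne : Ideal.span {(p : AJ p R)} →ₛₗ[sigma p R] AJ p R where
  toFun x := sigma p R (exists_of_mem p x).choose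
  map_add' x y := by
    rw [← map_add]
    apply sigma_congr
    rw [mul_add, (exists_of_mem p _).choose_spec, (exists_of_mem p _).choose_spec,
      (exists_of_mem p _).choose_spec]
    rfl
  map_smul' a x := by
    rw [smul_eq_mul, ← map_mul]
    apply sigma_congr
    rw [mul_left_comm, (exists_of_mem p _).choose_spec, (exists_of_mem p _).choose_spec]
    rfl

variable {R}

theorem sigmaOne_apply {x : Ideal.span {(p : AJ p R)}} {y : AJ p R} (h : (x : AJ p R) = p * y) :
    sigmaOne p R x = sigma p R y :=
  sigma_congr p ((exists_of_mem p x).choose_spec.trans h)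

theorem span_p_le_jacobson : Ideal.span {(p : AJ p R)} ≤ (⊥ : Ideal (AJ p R)).jacobson := by
  rw [Ideal.span_le, Set.singleton_subset_iff, SetLike.mem_coe, Ideal.mem_jacobson_bot]
  intro y
  obtain ⟨a, rfl⟩ := Ideal.Quotient.mk_surjective y
  have h : (p : Ainf p R) ∈ (⊥ : Ideal (Ainf p R)).jacobson :=
    W_p_mem_jacobson (Ideal.subset_span rfl)
  rw [Ideal.mem_jacobson_bot] at h
  have h1 := (h a).map (mk p R)
  rwa [map_add, map_mul, map_natCast, map_one] at h1

theorem sigma_sub_pow_mem (y : AJ p R) : sigma p R y - y ^ p ∈ Ideal.span {(p : AJ p R)} := by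
  obtain ⟨a, rfl⟩ := Ideal.Quotient.mk_surjective y
  rw [sigma_mk, delta_spec, map_add, map_pow, map_mul, map_natCast, add_sub_cancel_left]
  exact Ideal.mul_mem_right _ _ (Ideal.subset_span rfl)

theorem map_span_p : (Ideal.span {(p : Ainf p R)}).map (algebraMap (Ainf p R) (AJ p R)) =
    Ideal.span {(p : AJ p R)} := by
  rw [Ideal.map_span, Set.image_singleton, map_natCast]

instance isHausdorff : IsHausdorff (Ideal.span {(p : AJ p R)}) (AJ p R) where
  haus' y hy := by
    obtain ⟨a, rfl⟩ := Ideal.Quotient.mk_surjective y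
    rw [Ideal.Quotient.eq_zero_iff_mem]
    intro i
    have h := hy (i + 1)
    rw [SModEq.zero, smul_eq_mul, Ideal.mul_top, Ideal.span_singleton_pow,
      Ideal.mem_span_singleton] at h
    obtain ⟨z, hz⟩ := h
    obtain ⟨b, rfl⟩ := Ideal.Quotient.mk_surjective z
    have h1 : a - (p : Ainf p R) ^ (i + 1) * b ∈ wittJ p R := by
      rw [← Ideal.Quotient.eq, hz, map_mul, map_pow, map_natCast]
    have h2 : ∀ j < i + 1, a.coeff j = (a - (p : Ainf p R) ^ (i + 1) * b).coeff j := by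
      rw [WittVector.le_coeff_eq_iff_le_sub_coeff_eq_zero, sub_sub_cancel,
        ← WittVector.mem_span_p_pow_iff_le_coeff_eq_zero]
      exact Ideal.mul_mem_right _ _ (Ideal.subset_span rfl)
    rw [h2 i (Nat.lt_succ_self i)]
    exact h1 i

instance isPrecomplete : IsPrecomplete (Ideal.span {(p : AJ p R)}) (AJ p R) := by
  rw [← map_span_p, IsPrecomplete.map_algebraMap_iff, ← AdicCompletion.of_surjective_iff]
  intro y
  have hs : Function.Surjective (Ideal.Quotient.mkₐ (Ainf p R) (wittJ p R)).toLinearMap :=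
    Ideal.Quotient.mk_surjective
  obtain ⟨x, rfl⟩ := AdicCompletion.map_surjective (Ideal.span {(p : Ainf p R)}) hs y
  obtain ⟨a, rfl⟩ := AdicCompletion.of_surjective (Ideal.span {(p : Ainf p R)}) (Ainf p R) x
  exact ⟨_, (AdicCompletion.map_of _ _ a).symm⟩

instance isAdicComplete : IsAdicComplete (Ideal.span {(p : AJ p R)}) (AJ p R) where

end AJ

/-- The frame `A(J_*)`, with `Fil¹ A(J_*) = p A(J_*)`. -/
def ajFrame : Frame.{u} p where
  S := AJ p R
  Fil := Ideal.span {(p : AJ p R)}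
  σ := AJ.sigma p R
  σ₁ := AJ.sigmaOne p R
  le_jacobson := sup_le (AJ.span_p_le_jacobson p) (AJ.span_p_le_jacobson p)
  frobenius_lift := AJ.sigma_sub_pow_mem p
  span_σ₁ := by
    rw [Ideal.eq_top_iff_one]
    refine Ideal.subset_span ⟨⟨p, Ideal.subset_span rfl⟩, ?_⟩
    rw [AJ.sigmaOne_apply p (y := 1) (mul_one _).symm, map_one]

end AJ

end WeakLift

section Comparison

/-! ## The frame homomorphism from `A_cris(R)` to `A(J_*)` -/

section kappa

variable (p : ℕ) [hp : Fact p.Prime] (R : Type u) [CommRing R] [CharP R p]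

variable {R} in
theorem exists_p_mul (x : kerTheta p R) : ∃ w : Ainf p R,
    (x : Ainf p R) = WittVector.teichmuller p ((x : Ainf p R).coeff 0) + p * w := by
  have h : (x : Ainf p R) - WittVector.teichmuller p ((x : Ainf p R).coeff 0) ∈
      Ideal.span {(p : Ainf p R)} := by
    rw [WittVector.mem_span_p_iff_coeff_zero_eq_zero]
    have h1 : ∀ y : Ainf p R, y.coeff 0 = WittVector.constantCoeff y := fun _ => rfl
    rw [h1, map_sub, ← h1, ← h1, WittVector.teichmuller_coeff_zero, sub_self]
  obtain ⟨w, hw⟩ := Ideal.mem_span_singleton.1 h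
  exact ⟨w, by rw [← hw]; ring⟩

variable {R} in
theorem coeff_zero_mem (x : kerTheta p R) : (x : Ainf p R).coeff 0 ∈ idealJ p R := x.2

variable {R} in
theorem exists_div (x : kerTheta p R) : ∃ y : AJ p R, (p : AJ p R) * y = AJ.mk p R x := by
  obtain ⟨w, hw⟩ := exists_p_mul p x
  refine ⟨AJ.mk p R w, ?_⟩
  have h := Ideal.Quotient.eq_zero_iff_mem.2 (teichmuller_mem_wittIdeal (coeff_zero_mem p x))
  conv_rhs => rw [hw]
  rw [map_add, h, zero_add, map_mul, map_natCast]

variable {R} in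
/-- An element `y` of `A(J_*)` such that `p y` is the image of `x`. -/
def divP (x : kerTheta p R) : AJ p R := (exists_div p x).choose

variable {R} in
theorem p_mul_divP (x : kerTheta p R) : (p : AJ p R) * divP p x = AJ.mk p R x :=
  (exists_div p x).choose_spec

/-- The homomorphism from the divided power envelope `D` to `A(J_*)` that is compatible with the
divided powers on the ideal `p A(J_*)`, which are `(p y)^{[n]} = (p ^ n / n!) y ^ n`. -/
def kappaD : PDEnvelope p R →+* AJ p R :=
  PDEnvelope.lift p R (AJ.mk p R) (coefFun (AJ.mk p R) (p : AJ p R) (divP p))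
    (coefFun_zero _ _ _)
    (coefFun_smul (fun r m => by
      rw [mul_left_comm, p_mul_divP, p_mul_divP, ← map_mul]; rfl))
    (coefFun_mul rfl)
    (coefFun_add rfl (fun u v => by
      rw [mul_add, p_mul_divP, p_mul_divP, p_mul_divP, ← map_add]; rfl))
    (fun x => by
      have h := coefFun_succ (AJ.mk p R) (p : AJ p R) (divP p) 0 x
      rw [zero_add, coef_zero, map_one, one_mul, pow_one, p_mul_divP] at h
      exact h)
    (fun n c h => by
      cases n with
      | zero =>
        rw [PDEnvelope.eq_one_of_zero p h, coefFun_zero, map_one]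
      | succ n =>
        have h1 : (p : AJ p R) * divP p (pElt p R) = p * 1 := by
          rw [p_mul_divP, mul_one]
          exact map_natCast (AJ.mk p R) p
        rw [PDEnvelope.eq_p_mul_coef p h, coefFun_succ, mul_pow_eq h1, map_mul, map_natCast]
        ring)

variable {R}

@[simp]
theorem kappaD_iota (a : Ainf p R) : kappaD p R (PDEnvelope.iota p R a) = AJ.mk p R a :=
  PDEnvelope.lift_iota p _ _ _ _ _ _ _ _ a

theorem kappaD_gamma (n : ℕ) (x : kerTheta p R) : kappaD p R (PDEnvelope.gamma p (n + 1) x) =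
    p * (AJ.mk p R (coef n) * divP p x ^ (n + 1)) := by
  refine (PDEnvelope.lift_gamma p _ _ _ _ _ _ _ _ (n + 1) x).trans ?_
  rw [coefFun_succ]
  ring

theorem kappaD_mem {d : PDEnvelope p R} (hd : d ∈ RingHom.ker (PDEnvelope.toR p R)) :
    kappaD p R d ∈ Ideal.span {(p : AJ p R)} := by
  rw [PDEnvelope.ker_toR_eq] at hd
  induction hd using Submodule.span_induction with
  | mem d hd =>
    obtain ⟨n, x, rfl⟩ := hd
    rw [kappaD_gamma]
    exact Ideal.mul_mem_right _ _ (Ideal.subset_span rfl)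
  | zero => rw [map_zero]; exact zero_mem _
  | add x y _ _ h1 h2 => rw [map_add]; exact add_mem h1 h2
  | smul a x _ h => rw [smul_eq_mul, map_mul]; exact Ideal.mul_mem_left _ _ h

theorem sigma_kappaD (d : PDEnvelope p R) :
    AJ.sigma p R (kappaD p R d) = kappaD p R (PDEnvelope.sigma p R d) := by
  have h : (AJ.sigma p R).comp (kappaD p R) = (kappaD p R).comp (PDEnvelope.sigma p R) := by
    apply PDEnvelope.ringHom_ext
    · intro a
      simp [AJ.sigma_mk]
    · intro n x
      cases n with
      | zero => simp [PDEnvelope.gamma_zero]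
      | succ n =>
        have h1 : (p : AJ p R) * divP p (PDEnvelope.frobI p x) =
            p * AJ.sigma p R (divP p x) := by
          have h2 := congrArg (AJ.sigma p R) (p_mul_divP p x)
          rw [map_mul, map_natCast, AJ.sigma_mk] at h2
          rw [p_mul_divP, h2]
          rfl
        simp only [RingHom.comp_apply, PDEnvelope.sigma_gamma, kappaD_gamma, map_mul, map_pow,
          map_natCast, AJ.sigma_mk, frobenius_coef]
        rw [mul_left_comm, mul_left_comm (p : AJ p R), mul_pow_eq h1]
  exact RingHom.congr_fun h d

theorem kappaD_tau (x : kerTheta p R) :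
    kappaD p R (PDEnvelope.tau p x) = AJ.sigma p R (divP p x) := by
  obtain ⟨w, hw⟩ := exists_p_mul p x
  let a := (x : Ainf p R).coeff 0
  have ha : a ∈ idealJ p R := coeff_zero_mem p x
  have ha' : WittVector.teichmuller p a ∈ kerTheta p R := by
    rw [RingHom.mem_ker, theta_apply, WittVector.teichmuller_coeff_zero]
    exact ha
  have hm : AJ.mk p R (WittVector.teichmuller p a) = 0 :=
    Ideal.Quotient.eq_zero_iff_mem.2 (teichmuller_mem_wittIdeal ha)
  have h1 : x = ⟨WittVector.teichmuller p a, ha'⟩ + w • pElt p R := by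
    ext1
    change (x : Ainf p R) = WittVector.teichmuller p a + w * p
    rw [mul_comm w]
    exact hw
  have h2 : delta (WittVector.teichmuller p a : Ainf p R) = 0 := by
    apply W_p_mul_cancel
    have h3 := delta_spec (WittVector.teichmuller p a : Ainf p R)
    rw [WittVector.frobenius_eq_map_frobenius, WittVector.map_teichmuller, frobenius_def,
      map_pow] at h3
    rw [mul_zero]
    exact left_eq_add.1 h3
  have h4 : kappaD p R (PDEnvelope.tau p ⟨WittVector.teichmuller p a, ha'⟩) = 0 := by
    have h5 : (p : AJ p R) * divP p ⟨WittVector.teichmuller p a, ha'⟩ = p * 0 := by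
      rw [p_mul_divP, mul_zero]
      exact hm
    have h6 := kappaD_gamma p (p - 1) ⟨WittVector.teichmuller p a, ha'⟩
    rw [Nat.sub_add_cancel hp.out.one_le, mul_left_comm, mul_pow_eq h5, zero_pow hp.out.ne_zero,
      mul_zero, mul_zero] at h6
    rw [PDEnvelope.tau, h2, map_add, map_mul, h6, map_zero, map_zero, mul_zero, add_zero]
  have h7 : AJ.sigma p R (divP p x) = AJ.sigma p R (AJ.mk p R w) := by
    apply AJ.sigma_congr
    rw [p_mul_divP, hw, map_add, hm, zero_add, map_mul, map_natCast]
  rw [h7, h1, PDEnvelope.tau_add, map_add, h4, zero_add, PDEnvelope.tau_smul, PDEnvelope.tau_p,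
    mul_one, kappaD_iota, AJ.sigma_mk]

theorem kappaD_sigmaOne (d : RingHom.ker (PDEnvelope.toR p R)) :
    AJ.sigmaOne p R ⟨kappaD p R d, kappaD_mem p d.2⟩ =
      kappaD p R (PDEnvelope.sigmaOne p R d) := by
  have key : ∀ d ∈ Ideal.span {d | ∃ (n : ℕ) (x : kerTheta p R), d = PDEnvelope.gamma p (n + 1) x},
      ∀ hd : d ∈ RingHom.ker (PDEnvelope.toR p R),
      AJ.sigmaOne p R ⟨kappaD p R d, kappaD_mem p hd⟩ =
        kappaD p R (PDEnvelope.sigmaOne p R ⟨d, hd⟩) := by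
    intro d hd
    induction hd using Submodule.span_induction with
    | mem d hd =>
      obtain ⟨n, x, rfl⟩ := hd
      intro hd
      rw [PDEnvelope.sigmaOne_gamma, AJ.sigmaOne_apply p (kappaD_gamma p n x), map_mul, map_mul,
        map_pow, map_pow, kappaD_tau, kappaD_iota, AJ.sigma_mk, frobenius_coef]
    | zero =>
      intro hd
      have h1 : (⟨0, hd⟩ : RingHom.ker (PDEnvelope.toR p R)) = 0 := rfl
      rw [h1, AJ.sigmaOne_apply p (y := 0) (by simp), map_zero, map_zero, map_zero]
    | add x y hx hy h1 h2 =>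
      intro hd
      replace hx := (PDEnvelope.ker_toR_eq p).ge hx
      replace hy := (PDEnvelope.ker_toR_eq p).ge hy
      have h3 : (⟨x + y, hd⟩ : RingHom.ker (PDEnvelope.toR p R)) = ⟨x, hx⟩ + ⟨y, hy⟩ := rfl
      have h4 : (⟨kappaD p R (x + y), kappaD_mem p hd⟩ : Ideal.span {(p : AJ p R)}) =
          ⟨kappaD p R x, kappaD_mem p hx⟩ + ⟨kappaD p R y, kappaD_mem p hy⟩ :=
        Subtype.ext (map_add _ _ _)
      rw [h4, map_add, h1 hx, h2 hy, h3, map_add, map_add]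
    | smul a x hx h1 =>
      intro hd
      replace hx := (PDEnvelope.ker_toR_eq p).ge hx
      have h3 : (⟨a • x, hd⟩ : RingHom.ker (PDEnvelope.toR p R)) = a • ⟨x, hx⟩ := rfl
      have h4 : (⟨kappaD p R (a • x), kappaD_mem p hd⟩ : Ideal.span {(p : AJ p R)}) =
          kappaD p R a • ⟨kappaD p R x, kappaD_mem p hx⟩ :=
        Subtype.ext (map_mul _ _ _)
      rw [h4, h3, LinearMap.map_smulₛₗ, LinearMap.map_smulₛₗ, h1 hx, sigma_kappaD, smul_eq_mul,
        smul_eq_mul, map_mul]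
  exact key d ((PDEnvelope.ker_toR_eq p).le d.2) d.2

variable (R)

theorem kappaD_pow_le (n : ℕ) :
    pD p R ^ n ≤ (Ideal.span {(p : AJ p R)} ^ n).comap (kappaD p R) := by
  rw [Acris.pD_pow, Ideal.span_le, Set.singleton_subset_iff, SetLike.mem_coe, Ideal.mem_comap,
    map_pow, map_natCast, Ideal.span_singleton_pow]
  exact Ideal.subset_span rfl

theorem kappa_compat {m n : ℕ} (hle : m ≤ n) :
    (Ideal.Quotient.factorPow (Ideal.span {(p : AJ p R)}) hle).comp
      ((Ideal.quotientMap (Ideal.span {(p : AJ p R)} ^ n) (kappaD p R) (kappaD_pow_le p R n)).comp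
        (AdicCompletion.evalₐ (pD p R) n).toRingHom) =
      (Ideal.quotientMap (Ideal.span {(p : AJ p R)} ^ m) (kappaD p R) (kappaD_pow_le p R m)).comp
        (AdicCompletion.evalₐ (pD p R) m).toRingHom := by
  ext x
  obtain ⟨d, hd⟩ := Acris.exists_rep p n x
  have hd' := hd.mono p hle
  unfold Acris.Rep at hd hd'
  change Ideal.Quotient.factorPow _ hle (Ideal.quotientMap _ _ (kappaD_pow_le p R n)
    (AdicCompletion.evalₐ (pD p R) n x)) =
      Ideal.quotientMap _ _ (kappaD_pow_le p R m) (AdicCompletion.evalₐ (pD p R) m x)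
  rw [hd, hd', Ideal.quotientMap_mk, Ideal.quotientMap_mk]
  rfl

/-- The ring homomorphism `ϰ : A_cris(R) → A(J_*)`, the completion of `D → A(J_*)`. -/
def kappaRingHom : Acris p R →+* AJ p R :=
  IsAdicComplete.liftRingHom (Ideal.span {(p : AJ p R)})
    (fun n => (Ideal.quotientMap (Ideal.span {(p : AJ p R)} ^ n) (kappaD p R)
      (kappaD_pow_le p R n)).comp (AdicCompletion.evalₐ (pD p R) n).toRingHom)
    (fun hle => kappa_compat p R hle)

variable {R}

theorem kappa_sub_mem {n : ℕ} {x : Acris p R} {d : PDEnvelope p R} (h : Acris.Rep p n x d) :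
    kappaRingHom p R x - kappaD p R d ∈ Ideal.span {(p : AJ p R)} ^ n := by
  rw [← Ideal.Quotient.eq, kappaRingHom,
    IsAdicComplete.mk_liftRingHom _ _ (fun hle => kappa_compat p R hle)]
  change Ideal.quotientMap _ _ (kappaD_pow_le p R n) (AdicCompletion.evalₐ (pD p R) n x) = _
  unfold Acris.Rep at h
  rw [h, Ideal.quotientMap_mk]

theorem kappa_mem {x : Acris p R} (hx : x ∈ RingHom.ker (Acris.toR p R)) :
    kappaRingHom p R x ∈ Ideal.span {(p : AJ p R)} := by
  obtain ⟨d, hd⟩ := Acris.exists_rep p (0 + 1) x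
  have h1 := kappa_sub_mem p hd
  have h2 := kappaD_mem p (hd.mem_ker hx)
  rw [zero_add, pow_one] at h1
  have h3 := add_mem h1 h2
  rwa [sub_add_cancel] at h3

theorem AJ_ext {x y : AJ p R} (h : ∀ n, x - y ∈ Ideal.span {(p : AJ p R)} ^ n) : x = y := by
  rw [IsHausdorff.eq_iff_smodEq (I := Ideal.span {(p : AJ p R)})]
  intro n
  rw [SModEq.sub_mem, smul_eq_mul, Ideal.mul_top]
  exact h n

theorem AJ_sigma_mem {n : ℕ} {y : AJ p R} (h : y ∈ Ideal.span {(p : AJ p R)} ^ n) :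
    AJ.sigma p R y ∈ Ideal.span {(p : AJ p R)} ^ n := by
  rw [Ideal.span_singleton_pow, Ideal.mem_span_singleton] at h ⊢
  obtain ⟨c, rfl⟩ := h
  exact ⟨AJ.sigma p R c, by rw [map_mul, map_pow, map_natCast]⟩

theorem AJ_sigmaOne_mem {n : ℕ} {y : Ideal.span {(p : AJ p R)}}
    (h : (y : AJ p R) ∈ Ideal.span {(p : AJ p R)} ^ (n + 1)) :
    AJ.sigmaOne p R y ∈ Ideal.span {(p : AJ p R)} ^ n := by
  rw [Ideal.span_singleton_pow, Ideal.mem_span_singleton] at h ⊢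
  obtain ⟨c, hc⟩ := h
  rw [pow_succ', mul_assoc] at hc
  rw [AJ.sigmaOne_apply p hc]
  exact ⟨AJ.sigma p R c, by rw [map_mul, map_pow, map_natCast]⟩

theorem sigma_kappa (x : Acris p R) :
    AJ.sigma p R (kappaRingHom p R x) = kappaRingHom p R (Acris.sigma p R x) := by
  refine AJ_ext p fun n => ?_
  obtain ⟨d, hd⟩ := Acris.exists_rep p n x
  have h1 := AJ_sigma_mem p (kappa_sub_mem p hd)
  have h2 := kappa_sub_mem p hd.sigma
  rw [map_sub, sigma_kappaD] at h1
  have h3 := sub_mem h1 h2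
  rwa [sub_sub_sub_cancel_right] at h3

theorem sigmaOne_kappa (x : RingHom.ker (Acris.toR p R)) :
    AJ.sigmaOne p R ⟨kappaRingHom p R x, kappa_mem p x.2⟩ =
      kappaRingHom p R (Acris.sigmaOne p R x) := by
  refine AJ_ext p fun n => ?_
  obtain ⟨d, hd⟩ := Acris.exists_rep p (n + 1) (x : Acris p R)
  have hd' := hd.mem_ker x.2
  have h0 := kappa_sub_mem p hd
  have h1 : AJ.sigmaOne p R (⟨kappaRingHom p R x, kappa_mem p x.2⟩ -
      ⟨kappaD p R d, kappaD_mem p hd'⟩) ∈ Ideal.span {(p : AJ p R)} ^ n := AJ_sigmaOne_mem p h0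
  have h2 := kappa_sub_mem p hd.sigmaOne'
  rw [map_sub, kappaD_sigmaOne p ⟨d, hd'⟩] at h1
  have h3 := sub_mem h1 h2
  rwa [sub_sub_sub_cancel_right] at h3

variable (R)

/-- The frame homomorphism `ϰ : A_cris(R) → A(J_*)`: the unique homomorphism compatible with the
projections from `W(R^♭)` and with divided powers; it commutes with `σ` and with `σ₁`. -/
def kappa : Frame.Hom (acrisFrame p R) (ajFrame p R) where
  toRingHom := kappaRingHom p R
  map_fil _ ha := kappa_mem p ha
  map_σ := sigma_kappa p
  u := 1
  map_σ₁ a := by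
    rw [Units.val_one, one_mul]
    exact sigmaOne_kappa p a

end kappa

end Comparison

end

end SemiperfectFrames

/-! The proof separates a formal part about frames from a computation in `Acris p R`.

Formal part (`IsNilThickening.isCrystalline`). Let `α : F → G` be a surjective strict frame
homomorphism such that `Fil` of `F` is the preimage of `Fil` of `G`, `σ₁ p = 1`, both rings are
`p`-adically separated and that of `F` is complete. Assume also that `σ₁` is topologically nilpotent
on the kernel, uniformly: there are ideals `N m` with `N 0 = Ker α` and `σ₁ (N m) ⊆ N (m + 1)` that
eventually lie in every `p ^ k S`. Choose a normal decomposition of a window, with projection `π`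
onto its first summand. The `σ`-linear map `x ↦ Φ₁ (π x) + Φ (x - π x)` generates `P`, and by a rank
count it is universal among `σ`-linear maps on `P`. Hence every linear `f` preserving `Q` has a
unique transform `U f` with `U f (Φ₁ (π x) + Φ (x - π x)) = Φ₁ (f (π x)) + Φ (f (x - π x))`, and
window homomorphisms are the fixed points of `U`. If `f` and `f'` agree modulo `N m`, then `U f` and
`U f'` agree modulo `N (m + 1)`. So `U` contracts the set of linear lifts of a given homomorphism
over `G`: uniqueness of the fixed point is faithfulness, convergence of the iterates is fullness.
For essential surjectivity no nilpotence of `σ₁` is needed: since `a ^ p` lies in `p S` for `a` in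
`Fil`, the kernel is nil modulo `p`, so the summands of a normal decomposition lift by lifting
idempotent matrices. The semilinear structure map of the decomposition then lifts by projectivity,
and it still generates by Nakayama.

Computation (`kappa_isNilThickening`). Modulo `p ^ k`, an element of `Ker ϰ` is a combination of
divided powers `[a]^{[n]}` with `a ∈ J` and `n ≥ 1`, plus a sum of terms `p ^ i [b]` with `b ^ (p ^
i) ∈ J ^ (p ^ i)`. On the first kind, `σ₁ [a]^{[n]}` is a multiple of `p ^ (n - 1) [a]^{[p n]}`, so
every application of `σ₁` after the first gains a factor `p`. On the second kind, `σ₁ ^ q (p ^ i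
[b]) = p ^ (i - q) [b ^ (p ^ q)]` for `q ≤ i`. If `i` is small, this reaches an element `[a]` with
`a ∈ J` after `i` steps. If `i` is large, the iso-balanced hypothesis provides an `n` independent of
`i` with `b ^ (p ^ n) ∈ J` (`IsIsoBalanced.exists_pow_mem`). Then `[b] ^ (p ^ (n + j))` is divisible
by `(p ^ j)!`, so the divided powers take over after boundedly many steps. Thus one exponent `m`
sends all of `Ker ϰ` into `p ^ k` (`exists_kerSigmaOne_pow_mem`), and the ideals generated by `σ₁ ^
m (Ker ϰ)` serve as `N m`. -/

namespace SemiperfectFrames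

universe u

open CategoryTheory
open scoped TensorProduct

/-! ### Separatedness and completeness for the `p`-adic topology of an abelian group. -/

section PAdic

/-- The subgroup `p ^ k M` of an abelian group `M`. -/
def pPow (p : ℕ) (M : Type*) [AddCommGroup M] (k : ℕ) : AddSubgroup M :=
  (nsmulAddMonoidHom (p ^ k)).range

theorem mem_pPow {p : ℕ} {M : Type*} [AddCommGroup M] {k : ℕ} {x : M} :
    x ∈ pPow p M k ↔ ∃ y, p ^ k • y = x := Iff.rfl

theorem smul_mem_pPow {p : ℕ} {M : Type*} [AddCommGroup M] (k : ℕ) (x : M) :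
    p ^ k • x ∈ pPow p M k := ⟨x, rfl⟩

theorem pPow_anti {p : ℕ} {M : Type*} [AddCommGroup M] {k l : ℕ} (h : k ≤ l) :
    pPow p M l ≤ pPow p M k := by
  rintro _ ⟨y, rfl⟩
  refine ⟨p ^ (l - k) • y, ?_⟩
  simp only [nsmulAddMonoidHom_apply, smul_smul, ← pow_add]
  rw [Nat.add_sub_cancel' h]

theorem map_mem_pPow {p : ℕ} {M N : Type*} [AddCommGroup M] [AddCommGroup N] {k : ℕ} (f : M →+ N)
    {x : M} (h : x ∈ pPow p M k) : f x ∈ pPow p N k := by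
  obtain ⟨y, rfl⟩ := h
  exact ⟨f y, (map_nsmul f _ _).symm⟩

theorem mem_pPow_iff_mem_span {p : ℕ} {S : Type*} [CommRing S] {k : ℕ} {x : S} :
    x ∈ pPow p S k ↔ x ∈ Ideal.span {(p : S)} ^ k := by
  rw [Ideal.span_singleton_pow, Ideal.mem_span_singleton, mem_pPow]
  simp only [nsmul_eq_mul, Nat.cast_pow, Dvd.dvd, eq_comm]

/-- `M` is `p`-adically separated. -/
def PSeparated (p : ℕ) (M : Type*) [AddCommGroup M] : Prop :=
  ∀ x : M, (∀ k, x ∈ pPow p M k) → x = 0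

/-- Every `p`-adic Cauchy sequence in `M` has a limit. -/
def PComplete (p : ℕ) (M : Type*) [AddCommGroup M] : Prop :=
  ∀ f : ℕ → M, (∀ n, f (n + 1) - f n ∈ pPow p M n) → ∃ L, ∀ n, L - f n ∈ pPow p M n

variable {p : ℕ}

theorem PSeparated.of_injective {M N : Type*} [AddCommGroup M] [AddCommGroup N]
    (h : PSeparated p N) (i : M →+ N) (hi : Function.Injective i) : PSeparated p M := by
  intro x hx
  apply hi
  rw [map_zero]
  exact h _ fun k => map_mem_pPow i (hx k)

theorem PComplete.of_retract {M N : Type*} [AddCommGroup M] [AddCommGroup N]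
    (h : PComplete p N) (i : M →+ N) (r : N →+ M) (hri : ∀ x, r (i x) = x) : PComplete p M := by
  intro f hf
  obtain ⟨L, hL⟩ := h (fun n => i (f n)) fun n => by
    rw [← map_sub]; exact map_mem_pPow i (hf n)
  refine ⟨r L, fun n => ?_⟩
  have := map_mem_pPow r (hL n)
  rwa [map_sub, hri] at this

theorem PSeparated.pi {ι : Type*} {M : Type*} [AddCommGroup M] (h : PSeparated p M) :
    PSeparated p (ι → M) := fun _ hx => funext fun i =>
  h _ fun k => map_mem_pPow (Pi.evalAddMonoidHom (fun _ : ι => M) i) (hx k)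

theorem PComplete.pi {ι : Type*} {M : Type*} [AddCommGroup M] (h : PComplete p M) :
    PComplete p (ι → M) := by
  intro f hf
  have := fun i => h (fun n => f n i) fun n =>
    map_mem_pPow (Pi.evalAddMonoidHom (fun _ : ι => M) i) (hf n)
  choose L hL using this
  refine ⟨L, fun n => ?_⟩
  choose y hy using fun i => hL i n
  exact ⟨y, funext hy⟩

/-- A finite projective module is a retract of `S ^ n`, and separatedness passes to powers and to
subgroups; completeness below passes to powers and retracts. -/
theorem PSeparated.of_projective {S : Type*} [CommRing S] (h : PSeparated p S) (M : Type*)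
    [AddCommGroup M] [Module S M] [Module.Finite S M] [Module.Projective S M] :
    PSeparated p M := by
  obtain ⟨n, r, i, _, hi, _⟩ := Module.Finite.exists_comp_eq_id_of_projective S M
  exact PSeparated.of_injective (h.pi (ι := Fin n)) i.toAddMonoidHom hi

theorem PComplete.of_projective {S : Type*} [CommRing S] (h : PComplete p S) (M : Type*)
    [AddCommGroup M] [Module S M] [Module.Finite S M] [Module.Projective S M] :
    PComplete p M := by
  obtain ⟨n, r, i, _, _, hri⟩ := Module.Finite.exists_comp_eq_id_of_projective S M
  exact PComplete.of_retract (h.pi (ι := Fin n)) i.toAddMonoidHom r.toAddMonoidHom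
    fun x => LinearMap.congr_fun hri x

theorem sub_mem_of_step {M : Type*} [AddCommGroup M] {H : AddSubgroup M} {f : ℕ → M} {m : ℕ}
    (h : ∀ j ≥ m, f (j + 1) - f j ∈ H) {j : ℕ} (hj : m ≤ j) : f j - f m ∈ H := by
  induction j, hj using Nat.le_induction with
  | base => simp
  | succ j hj ih =>
    have := H.add_mem (h j hj) ih
    rwa [sub_add_sub_cancel] at this

/-- `PComplete` asks for the rate `p ^ n` at the `n`-th step, whereas the iterations below are
Cauchy without a prescribed rate. A subsequence restores that rate. -/
theorem PComplete.exists_limit {M : Type*} [AddCommGroup M] (hM : PComplete p M) (f : ℕ → M)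
    (hf : ∀ k, ∃ m, ∀ j ≥ m, f (j + 1) - f j ∈ pPow p M k) :
    ∃ L, ∀ k, ∃ m, ∀ j ≥ m, L - f j ∈ pPow p M k := by
  choose m hm using hf
  -- Partial sums turn the thresholds `m` into a monotone sequence that dominates them.
  let t : ℕ → ℕ := fun k => ∑ i ∈ Finset.range (k + 1), m i
  have ht : ∀ k, m k ≤ t k := fun k =>
    Finset.single_le_sum (f := m) (fun _ _ => Nat.zero_le _) (Finset.self_mem_range_succ k)
  have ht' : ∀ k, t k ≤ t (k + 1) := fun k => by
    simp only [t]
    rw [Finset.sum_range_succ _ (k + 1)]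
    exact Nat.le_add_right _ _
  have key : ∀ k j, t k ≤ j → f j - f (t k) ∈ pPow p M k := fun k j hj =>
    sub_mem_of_step (fun i hi => hm k i ((ht k).trans hi)) hj
  obtain ⟨L, hL⟩ := hM (fun k => f (t k)) fun k => key k _ (ht' k)
  refine ⟨L, fun k => ⟨t k, fun j hj => ?_⟩⟩
  have := (pPow p M k).sub_mem (hL k) (key k j hj)
  rwa [sub_sub_sub_cancel_right] at this

end PAdic

/-! ### Lifting of idempotents by Newton iteration. -/

section Idempotents

open Polynomial

/-- The Newton iteration for the equation `X ^ 2 = X`. -/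
noncomputable def newtonIdem : ℕ → ℤ[X]
  | 0 => X
  | n + 1 => 3 * newtonIdem n ^ 2 - 2 * newtonIdem n ^ 3

/-- With `t = x ^ 2 - x`, one Newton step replaces `t` by `t ^ 2 (4 t - 3)`, so the defect is
squared. Working in `ℤ[X]` keeps the identities commutative although they are later evaluated in
matrix rings. -/
theorem dvd_newtonIdem (n : ℕ) :
    ((X : ℤ[X]) ^ 2 - X) ^ (2 ^ n) ∣ newtonIdem n ^ 2 - newtonIdem n := by
  induction n with
  | zero => simp [newtonIdem]
  | succ n ih =>
    have h : newtonIdem (n + 1) ^ 2 - newtonIdem (n + 1) = (newtonIdem n ^ 2 - newtonIdem n) ^ 2 *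
        (4 * (newtonIdem n ^ 2 - newtonIdem n) - 3) := by
      rw [newtonIdem]; ring
    rw [h, pow_succ 2 n, pow_mul]
    exact Dvd.dvd.mul_right (pow_dvd_pow_of_dvd ih 2) _

theorem dvd_newtonIdem_succ_sub (n : ℕ) :
    newtonIdem n ^ 2 - newtonIdem n ∣ newtonIdem (n + 1) - newtonIdem n :=
  ⟨1 - 2 * newtonIdem n, by rw [newtonIdem]; ring⟩

/-- Lifting of idempotents along a homomorphism of `p`-adically complete rings. -/
theorem exists_isIdempotentElem_lift {p : ℕ} {A B : Type*} [Ring A] [Ring B] (α : A →+* B)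
    (hA : PComplete p A) (hA' : PSeparated p A) (hB : PSeparated p B) (e : A) (c : ℕ)
    (hc : (e ^ 2 - e) ^ c ∈ pPow p A 1) (he : α (e ^ 2 - e) = 0) :
    ∃ e', e' ^ 2 = e' ∧ α e' = α e := by
  have hpow : ∀ k, (e ^ 2 - e) ^ (c * k) ∈ pPow p A k := by
    obtain ⟨y, hy⟩ := hc
    intro k
    refine ⟨y ^ k, ?_⟩
    rw [pow_mul, ← hy]
    simp [(Nat.cast_commute p y).mul_pow]
  have hmul : ∀ k (x z : A), x ∈ pPow p A k → x * z ∈ pPow p A k := by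
    rintro k _ z ⟨y, rfl⟩
    exact ⟨y * z, by simp [mul_assoc]⟩
  -- The `j`-th defect is divisible by `(e ^ 2 - e) ^ (2 ^ j)`, and `c k ≤ j < 2 ^ j`; the bound is
  -- crude but sufficient.
  have hdvd : ∀ k j q, c * k ≤ j → newtonIdem j ^ 2 - newtonIdem j ∣ q →
      aeval e q ∈ pPow p A k := by
    intro k j q hj hq
    obtain ⟨q', rfl⟩ := (pow_dvd_pow _ (hj.trans Nat.lt_two_pow_self.le)).trans
      ((dvd_newtonIdem j).trans hq)
    rw [map_mul]
    refine hmul _ _ _ ?_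
    rw [map_pow, map_sub, map_pow, aeval_X]
    exact hpow k
  obtain ⟨L, hL⟩ := hA.exists_limit (fun j => aeval e (newtonIdem j)) fun k =>
    ⟨c * k, fun j hj => by
      rw [← map_sub]
      exact hdvd k j _ hj (dvd_newtonIdem_succ_sub j)⟩
  refine ⟨L, ?_, ?_⟩
  · rw [← sub_eq_zero]
    refine hA' _ fun k => ?_
    obtain ⟨m, hm⟩ := hL k
    let j := max m (c * k)
    have h1 := hm j (le_max_left _ _)
    have h2 := hdvd k j _ (le_max_right _ _) dvd_rfl
    rw [map_sub, map_pow] at h2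
    set x := aeval e (newtonIdem j)
    obtain ⟨y, hy⟩ := h1
    have h3 : L = x + p ^ k • y := by
      rw [← sub_eq_iff_eq_add']; exact hy.symm
    -- The limit may be replaced by an iterate modulo `p ^ k`. The elements `x` and `y` need not
    -- commute; only the integer `p ^ k` is moved across products.
    have h4 : L ^ 2 - L = (x ^ 2 - x) + p ^ k • (x * y + y * x + p ^ k • y ^ 2 - y) := by
      rw [h3]
      simp only [nsmul_eq_mul, smul_add, smul_sub]
      have hc : ∀ z : A, z * ((p ^ k : ℕ) : A) = ((p ^ k : ℕ) : A) * z := fun z =>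
        (Nat.cast_commute _ _).symm
      generalize ((p ^ k : ℕ) : A) = t at *
      rw [pow_two, pow_two, pow_two, mul_add, add_mul, add_mul, mul_assoc t y x, ← mul_assoc x t y,
        hc x, mul_assoc t y (t * y), ← mul_assoc y t y, hc y]
      noncomm_ring
    rw [h4]
    exact add_mem h2 (smul_mem_pPow _ _)
  · rw [← sub_eq_zero]
    refine hB _ fun k => ?_
    obtain ⟨m, hm⟩ := hL k
    have h1 := map_mem_pPow α.toAddMonoidHom (hm m le_rfl)
    -- The image `ε = α e` is already idempotent and `3 ε ^ 2 - 2 ε ^ 3 = ε`, so the iteration is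
    -- stationary in the target.
    have h2 : ∀ j, α (aeval e (newtonIdem j)) = α e := by
      intro j
      induction j with
      | zero => simp [newtonIdem]
      | succ j ih =>
        rw [newtonIdem, map_sub, map_mul, map_mul, map_pow, map_pow, map_sub, map_mul, map_mul,
          map_pow, map_pow, ih]
        have h3 : α e ^ 2 = α e := by
          rwa [map_sub, map_pow, sub_eq_zero] at he
        have h4 : α e ^ 3 = α e := by rw [pow_succ, h3, ← pow_two, h3]
        rw [h3, h4, ← sub_mul]
        have : (α (aeval e (3 : ℤ[X])) - α (aeval e (2 : ℤ[X]))) = 1 := by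
          rw [← map_sub, ← map_sub]
          norm_num
        rw [this, one_mul]
    change α (L - _) ∈ _ at h1
    rwa [map_sub, h2] at h1

end Idempotents

/-! ### Universal semilinear maps and semilinear lifting. -/

section Linearization

variable {S T : Type*} [CommRing S] [CommRing T] [Algebra S T] {P P' X : Type*} [AddCommGroup P]
  [Module S P] [AddCommGroup P'] [Module T P'] [AddCommGroup X] [Module T X]

/-- The linear map `T ⊗ P → X` defined by a semilinear map `P → X`. -/
theorem exists_linearization (g : P →ₛₗ[algebraMap S T] X) :
    ∃ f : T ⊗[S] P →ₗ[T] X, ∀ x, f (1 ⊗ₜ x) = g x := by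
  let _ : Module S X := Module.compHom X (algebraMap S T)
  have : IsScalarTower S T X := .of_algebraMap_smul fun _ _ => rfl
  let g' : P →ₗ[S] X :=
    { toFun := g, map_add' := map_add g, map_smul' := fun s x => map_smulₛₗ g s x }
  exact ⟨LinearMap.liftBaseChange T g', fun x => by simp [g']⟩

/-- A semilinear map between finite projective modules of the same rank whose image generates the
target is universal among semilinear maps. -/
theorem exists_comp_eq_of_span_range [Module.Finite S P] [Module.Projective S P]
    [Module.Finite T P'] [Module.Projective T P'] (Ψ : P →ₛₗ[algebraMap S T] P')
    (hΨ : Submodule.span T (Set.range Ψ) = ⊤)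
    (hrank : ∀ (m : Ideal T) [m.IsMaximal], Module.rankAtStalk P' ⟨m, inferInstance⟩ =
      Module.rankAtStalk P (PrimeSpectrum.comap (algebraMap S T) ⟨m, inferInstance⟩))
    (g : P →ₛₗ[algebraMap S T] X) : ∃ f : P' →ₗ[T] X, ∀ x, f (Ψ x) = g x := by
  obtain ⟨Ψ', hΨ'⟩ := exists_linearization Ψ
  obtain ⟨g', hg'⟩ := exists_linearization g
  have hs : Function.Surjective Ψ' := by
    rw [← LinearMap.range_eq_top, eq_top_iff, ← hΨ, Submodule.span_le]
    rintro _ ⟨x, rfl⟩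
    exact ⟨1 ⊗ₜ x, hΨ' x⟩
  -- A surjection between finite projective modules with equal ranks at all maximal ideals is
  -- bijective. Hence `P'` is the base change of `P` via `Ψ`, and the universal property of the
  -- tensor product transfers to `Ψ`.
  have hb := Module.bijective_of_surjective_of_rankAtStalk_eq hs fun m _ => by
    rw [Module.rankAtStalk_baseChange, hrank]
  let e := LinearEquiv.ofBijective Ψ' hb
  refine ⟨g' ∘ₗ e.symm.toLinearMap, fun x => ?_⟩
  have : e.symm (Ψ x) = 1 ⊗ₜ x := by
    rw [LinearEquiv.symm_apply_eq]; exact (hΨ' x).symm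
  simp [this, hg']

/-- For a Frobenius lift the rank condition is automatic: every maximal ideal `m` contains `p`, and
`σ a ≡ a ^ p` modulo `p` gives `σ⁻¹ m = m`. So `P` and its `σ`-twist have the same rank at `m`. -/
theorem exists_comp_eq_of_frobenius_lift {p : ℕ} [hp : Fact p.Prime] {σ : S →+* S} {P X : Type*}
    [AddCommGroup P] [Module S P] [AddCommGroup X] [Module S X] [Module.Finite S P]
    [Module.Projective S P] (hσ : ∀ a, σ a - a ^ p ∈ Ideal.span {(p : S)})
    (hj : Ideal.span {(p : S)} ≤ (⊥ : Ideal S).jacobson) (Ψ : P →ₛₗ[σ] P)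
    (hΨ : Submodule.span S (Set.range Ψ) = ⊤) (g : P →ₛₗ[σ] X) :
    ∃ f : P →ₗ[S] X, ∀ x, f (Ψ x) = g x := by
  refine @exists_comp_eq_of_span_range S S _ _ σ.toAlgebra P P X _ _ _ _ _ _ _ _ _ _ Ψ hΨ ?_ g
  intro m hm
  congr 1
  ext a
  have hpm : Ideal.span {(p : S)} ≤ m := hj.trans (by
    rw [Ideal.jacobson]
    exact sInf_le ⟨bot_le, hm⟩)
  change a ∈ m ↔ σ a ∈ m
  have h := hpm (hσ a)
  constructor
  · intro ha
    have := m.add_mem h (Ideal.pow_mem_of_mem m ha p hp.out.pos)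
    rwa [sub_add_cancel] at this
  · intro ha
    have := m.sub_mem ha h
    rw [sub_sub_cancel] at this
    exact hm.isPrime.mem_of_pow_mem p this

end Linearization

/-- Semilinear maps out of a finite projective module can be lifted along surjections. -/
theorem exists_semilinear_lift {S T : Type*} [CommRing S] [CommRing T] {τ : S →+* T}
    {P Y Z : Type*} [AddCommGroup P] [Module S P] [Module.Finite S P] [Module.Projective S P]
    [AddCommGroup Y] [Module T Y] [AddCommGroup Z] (q : Y →+ Z) (hq : Function.Surjective q)
    (h : P →+ Z) (hc : ∀ s y x, q y = h x → q (τ s • y) = h (s • x)) :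
    ∃ f : P →ₛₗ[τ] Y, ∀ x, q (f x) = h x := by
  obtain ⟨n, r, i, _, _, hri⟩ := Module.Finite.exists_comp_eq_id_of_projective S P
  -- Lifts are chosen on generators and extended by the coordinates `i x j`, through `x = ∑ i x j •
  -- r e_j`. Since `Z` is only a group, semilinearity of `h` enters as the condition `hc` on
  -- preimages.
  choose y hy using fun j : Fin n => hq (h (r (Pi.single j 1)))
  refine ⟨{ toFun := fun x => ∑ j, τ (i x j) • y j, map_add' := ?_, map_smul' := ?_ }, ?_⟩
  · intro a b
    simp [add_smul, Finset.sum_add_distrib]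
  · intro s a
    simp [Finset.smul_sum, mul_smul]
  · intro x
    have h1 : x = ∑ j, i x j • r (Pi.single j 1) := by
      have h2 := LinearMap.congr_fun hri x
      rw [LinearMap.comp_apply, pi_eq_sum_univ' (i x), map_sum] at h2
      simpa using h2.symm
    change q (∑ j, τ (i x j) • y j) = h x
    conv_rhs => rw [h1]
    rw [map_sum, map_sum]
    exact Finset.sum_congr rfl fun j _ => hc _ _ _ (hy j)

/-! ### Normal decompositions and window homomorphisms. -/

section Windows

variable {p : ℕ} {F : Frame.{u} p}

namespace Window

/-- From `Φ₁ (a x) = σ₁ a • Φ x`: the behaviour of `σ₁` on ideals controls that of `Φ₁`. This is the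
source of the contraction. -/
theorem Φ₁_mem {M : Window F} {I I' : Ideal F.S}
    (hI : ∀ a ∈ I, ∃ h : a ∈ F.Fil, F.σ₁ ⟨a, h⟩ ∈ I') {y : M.P}
    (hy : y ∈ I • (⊤ : Submodule F.S M.P)) :
    ∃ h : y ∈ M.Q, M.Φ₁ ⟨y, h⟩ ∈ I' • (⊤ : Submodule F.S M.P) := by
  induction hy using Submodule.smul_induction_on' with
  | smul a ha x _ =>
    obtain ⟨h, h'⟩ := hI a ha
    refine ⟨M.smul_mem_Q ⟨a, h⟩ x, ?_⟩
    rw [M.Φ₁_smul ⟨a, h⟩ x]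
    exact Submodule.smul_mem_smul h' trivial
  | add x _ y _ hx hy =>
    obtain ⟨h1, h1'⟩ := hx
    obtain ⟨h2, h2'⟩ := hy
    refine ⟨add_mem h1 h2, ?_⟩
    have : (⟨x + y, add_mem h1 h2⟩ : M.Q) = ⟨x, h1⟩ + ⟨y, h2⟩ := rfl
    rw [this, map_add]
    exact add_mem h1' h2'

theorem smul_top_le_Q (M : Window F) : F.Fil • (⊤ : Submodule F.S M.P) ≤ M.Q := by
  rw [Submodule.smul_le]
  exact fun a ha x _ => M.smul_mem_Q ⟨a, ha⟩ x

/-- The projection onto the first summand of a normal decomposition; the linearization of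
`l + t ↦ Φ₁ l + Φ t` is surjective. -/
theorem exists_normal_projection (M : Window F) : ∃ (π : M.P →ₗ[F.S] M.P) (hπ : ∀ x, π x ∈ M.Q),
    (∀ x, π (π x) = π x) ∧ (∀ x ∈ M.Q, x - π x ∈ F.Fil • (⊤ : Submodule F.S M.P)) ∧
    Submodule.span F.S (Set.range fun x => M.Φ₁ ⟨π x, hπ x⟩ + M.Φ (x - π x)) = ⊤ := by
  obtain ⟨L, T, hLT, hQ⟩ := M.exists_normal
  have hLQ : L ≤ M.Q := hQ ▸ le_sup_left
  let π : M.P →ₗ[F.S] M.P := L.subtype ∘ₗ L.projectionOnto T hLT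
  have hπL : ∀ x ∈ L, π x = x := fun x hx => by
    simp [π, Submodule.projectionOnto_apply_left hLT ⟨x, hx⟩]
  have hπT : ∀ x ∈ T, π x = 0 := fun x hx => by
    simpa [π] using hx
  have hπ : ∀ x, π x ∈ L := fun x => (L.projectionOnto T hLT x).2
  have hsub : ∀ x, x - π x ∈ T := by
    intro x
    have hx : x ∈ L ⊔ T := by rw [hLT.sup_eq_top]; trivial
    obtain ⟨l, hl, t, ht, rfl⟩ := Submodule.mem_sup.1 hx
    simpa [hπL l hl, hπT t ht] using ht
  refine ⟨π, fun x => hLQ (hπ x), fun x => hπL _ (hπ x), ?_, ?_⟩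
  · intro x hx
    rw [hQ] at hx
    obtain ⟨l, hl, z, hz, rfl⟩ := Submodule.mem_sup.1 hx
    have hzT : z ∈ T := Submodule.smul_le_right hz
    rw [map_add, hπL l hl, hπT z hzT, add_zero, add_sub_cancel_left]
    exact Submodule.smul_mono le_rfl le_top hz
  · set W := Submodule.span F.S (Set.range fun x => M.Φ₁ ⟨π x, hLQ (hπ x)⟩ + M.Φ (x - π x))
    have h1 : ∀ l (hl : l ∈ L), M.Φ₁ ⟨l, hLQ hl⟩ ∈ W := fun l hl =>
      Submodule.subset_span ⟨l, by simp [hπL l hl]⟩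
    have h2 : ∀ t ∈ T, M.Φ t ∈ W := fun t ht =>
      Submodule.subset_span ⟨t, by
        have : (⟨π t, hLQ (hπ t)⟩ : M.Q) = 0 := Subtype.ext (hπT t ht)
        change M.Φ₁ ⟨π t, hLQ (hπ t)⟩ + M.Φ (t - π t) = M.Φ t
        rw [this, map_zero, zero_add, hπT t ht, sub_zero]⟩
    -- As `Φ₁ (a t) = σ₁ a • Φ t`, knowing `Φ` on `T` suffices to recover `Φ₁` on the remaining part
    -- of `Q = L + Fil T`.
    have h3 : ∀ z ∈ F.Fil • T, ∃ h : z ∈ M.Q, M.Φ₁ ⟨z, h⟩ ∈ W := by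
      intro z hz
      induction hz using Submodule.smul_induction_on' with
      | smul a ha x hx =>
        refine ⟨M.smul_mem_Q ⟨a, ha⟩ x, ?_⟩
        rw [M.Φ₁_smul ⟨a, ha⟩ x]
        exact W.smul_mem _ (h2 x hx)
      | add x _ y _ hx hy =>
        obtain ⟨h1, h1'⟩ := hx
        obtain ⟨h2, h2'⟩ := hy
        refine ⟨add_mem h1 h2, ?_⟩
        have : (⟨x + y, add_mem h1 h2⟩ : M.Q) = ⟨x, h1⟩ + ⟨y, h2⟩ := rfl
        rw [this, map_add]
        exact add_mem h1' h2'
    rw [eq_top_iff, ← M.span_Φ₁, Submodule.span_le]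
    rintro _ ⟨⟨x, hx⟩, rfl⟩
    have hx' := hx
    rw [hQ] at hx'
    obtain ⟨l, hl, z, hz, rfl⟩ := Submodule.mem_sup.1 hx'
    obtain ⟨hzQ, hz'⟩ := h3 z hz
    have : (⟨l + z, hx⟩ : M.Q) = ⟨l, hLQ hl⟩ + ⟨z, hzQ⟩ := rfl
    rw [this, map_add]
    exact add_mem (h1 l hl) hz'

section Hom

variable {M M' : Window F} {π : M.P →ₗ[F.S] M.P} {hπ : ∀ x, π x ∈ M.Q} {f f' : M.P →ₗ[F.S] M'.P}

/-- A linear map that is compatible with `Φ₁` on one and with `Φ` on the other summand of a normal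
decomposition is compatible with `Φ₁`. -/
theorem map_Φ₁_of_normal (hπ2 : ∀ x, π (π x) = π x)
    (hQ : ∀ x ∈ M.Q, x - π x ∈ F.Fil • (⊤ : Submodule F.S M.P)) (hf : ∀ x ∈ M.Q, f x ∈ M'.Q)
    (h : ∀ x, f (M.Φ₁ ⟨π x, hπ x⟩ + M.Φ (x - π x)) =
      M'.Φ₁ ⟨f (π x), hf _ (hπ x)⟩ + M'.Φ (f (x - π x))) (x : M.Q) :
    f (M.Φ₁ x) = M'.Φ₁ ⟨f x, hf x x.2⟩ := by
  -- Evaluating the hypothesis at `π x` removes the second summand because `π` is idempotent;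
  -- subtraction then isolates that summand.
  have hL : ∀ x, f (M.Φ₁ ⟨π x, hπ x⟩) = M'.Φ₁ ⟨f (π x), hf _ (hπ x)⟩ := fun x => by
    simpa [hπ2] using h (π x)
  have hT : ∀ x, f (M.Φ (x - π x)) = M'.Φ (f (x - π x)) := fun x => by
    have h1 := h x
    rw [map_add, hL] at h1
    exact add_left_cancel h1
  have hF : ∀ z ∈ F.Fil • (⊤ : Submodule F.S M.P), ∃ hz : z - π z ∈ M.Q,
      f (M.Φ₁ ⟨z - π z, hz⟩) = M'.Φ₁ ⟨f (z - π z), hf _ hz⟩ := by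
    intro z hz
    induction hz using Submodule.smul_induction_on' with
    | smul a ha y _ =>
      have e1 : a • y - π (a • y) = a • (y - π y) := by rw [map_smul, smul_sub]
      refine ⟨e1 ▸ M.smul_mem_Q ⟨a, ha⟩ _, ?_⟩
      simp only [e1, map_smul f]
      rw [M.Φ₁_smul ⟨a, ha⟩ (y - π y), map_smul, hT, M'.Φ₁_smul ⟨a, ha⟩]
    | add x _ y _ hx hy =>
      obtain ⟨h1, h1'⟩ := hx
      obtain ⟨h2, h2'⟩ := hy
      have e1 : x + y - π (x + y) = (x - π x) + (y - π y) := by rw [map_add]; abel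
      refine ⟨e1 ▸ add_mem h1 h2, ?_⟩
      simp only [e1]
      have e2 : (⟨_, add_mem h1 h2⟩ : M.Q) = ⟨_, h1⟩ + ⟨_, h2⟩ := rfl
      have e3 : (⟨f (x - π x + (y - π y)), hf _ (add_mem h1 h2)⟩ : M'.Q) =
        ⟨_, hf _ h1⟩ + ⟨_, hf _ h2⟩ := Subtype.ext (map_add _ _ _)
      rw [e2, e3, map_add, map_add, map_add, h1', h2']
  obtain ⟨x, hx⟩ := x
  -- The previous step is applied to `z = x - π x`, which lies in `Fil P` and satisfies `π z = 0`.
  obtain ⟨h1, h2⟩ := hF _ (hQ x hx)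
  have e1 : x - π x - π (x - π x) = x - π x := by rw [map_sub, hπ2, sub_self, sub_zero]
  simp only [e1] at h1 h2
  have e2 : (⟨x, hx⟩ : M.Q) = ⟨π x, hπ x⟩ + ⟨x - π x, h1⟩ := Subtype.ext (by simp)
  have e3 : (⟨f x, hf x hx⟩ : M'.Q) = ⟨f (π x), hf _ (hπ x)⟩ + ⟨f (x - π x), hf _ h1⟩ :=
    Subtype.ext (by simp)
  change f (M.Φ₁ ⟨x, hx⟩) = M'.Φ₁ ⟨f x, hf x hx⟩
  rw [e3, e2, map_add, map_add, map_add, hL, h2]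

end Hom

end Window

end Windows

theorem mem_pPow_of_mem_smul {p : ℕ} {S P : Type*} [CommRing S] [AddCommGroup P] [Module S P]
    {I : Ideal S} {k : ℕ} (hI : ∀ a ∈ I, a ∈ pPow p S k) {x : P}
    (hx : x ∈ I • (⊤ : Submodule S P)) : x ∈ pPow p P k := by
  induction hx using Submodule.smul_induction_on' with
  | smul a ha x _ =>
    obtain ⟨b, rfl⟩ := hI a ha
    exact ⟨b • x, by
      rw [nsmulAddMonoidHom_apply, nsmulAddMonoidHom_apply, smul_assoc]⟩
  | add x _ y _ hx hy => exact add_mem hx hy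

theorem mem_smul_of_mem_pPow {p : ℕ} (S : Type*) {P : Type*} [CommRing S] [AddCommGroup P]
    [Module S P] {k : ℕ} {x : P} (hx : x ∈ pPow p P k) :
    x ∈ Ideal.span {(p : S)} ^ k • (⊤ : Submodule S P) := by
  obtain ⟨y, rfl⟩ := hx
  have h : (p : S) ^ k ∈ Ideal.span {(p : S)} ^ k :=
    Ideal.pow_mem_pow (Ideal.mem_span_singleton_self _) k
  rw [nsmulAddMonoidHom_apply, ← Nat.cast_smul_eq_nsmul S, Nat.cast_pow]
  exact Submodule.smul_mem_smul h Submodule.mem_top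

/-! ### Nil thickenings of frames, and faithfulness of base change. -/

section Crystalline

variable {p : ℕ} {F G : Frame.{u} p}

/-- A surjective strict frame homomorphism of `p`-adically complete frames over the same quotient
`S / Fil¹ S` such that `σ₁` is topologically nilpotent on the kernel. -/
structure Frame.Hom.IsNilThickening (α : Frame.Hom F G) : Prop where
  surjective : Function.Surjective α.toRingHom
  mem_fil : ∀ a, α.toRingHom a ∈ G.Fil → a ∈ F.Fil
  u_eq_one : α.u = 1
  complete : PComplete p F.S
  separated : PSeparated p F.S
  separated_target : PSeparated p G.S
  σ₁_p : ∃ h : (p : F.S) ∈ F.Fil, F.σ₁ ⟨p, h⟩ = 1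
  nilpotent : ∃ N : ℕ → Ideal F.S, N 0 = RingHom.ker α.toRingHom ∧
    (∀ m, ∀ a ∈ N m, ∃ h : a ∈ F.Fil, F.σ₁ ⟨a, h⟩ ∈ N (m + 1)) ∧
    ∀ k, ∃ m, ∀ j ≥ m, ∀ a ∈ N j, a ∈ pPow p F.S k

namespace Frame.Hom.IsNilThickening

variable {α : Frame.Hom F G}

theorem p_mem_fil (hα : α.IsNilThickening) : (p : F.S) ∈ F.Fil := hα.σ₁_p.1

/-- Because `σ₁ p = 1`, the map `Φ` is determined by `Φ₁`; compatibility with `Φ₁` is then all that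
has to be checked. -/
theorem Φ_eq (hα : α.IsNilThickening) (M : Window F) (x : M.P) :
    M.Φ x = M.Φ₁ ⟨(p : F.S) • x, M.smul_mem_Q ⟨p, hα.p_mem_fil⟩ x⟩ := by
  rw [M.Φ₁_smul ⟨p, hα.p_mem_fil⟩ x, hα.σ₁_p.2, one_smul]

theorem toBase_surjective (hα : α.IsNilThickening)
    (M : Window F) : Function.Surjective (α.toBase M) := by
  intro y
  have hy : y ∈ Submodule.span G.S (Set.range (α.toBase M)) := by rw [α.span_toBase M]; trivial
  induction hy using Submodule.span_induction with
  | mem y hy => exact hy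
  | zero => exact ⟨0, map_zero _⟩
  | add x y _ _ hx hy =>
    obtain ⟨a, rfl⟩ := hx
    obtain ⟨b, rfl⟩ := hy
    exact ⟨a + b, map_add _ _ _⟩
  | smul s x _ hx =>
    obtain ⟨a, rfl⟩ := hx
    obtain ⟨r, rfl⟩ := hα.surjective s
    exact ⟨r • a, α.toBase_smul M r a⟩

/-- Right exactness of the tensor product, applied to `Ker α → S → S'`. -/
theorem toBase_eq_zero_iff (hα : α.IsNilThickening) {M : Window F} {x : M.P} :
    α.toBase M x = 0 ↔ x ∈ RingHom.ker α.toRingHom • (⊤ : Submodule F.S M.P) := by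
  constructor
  · intro h
    let _ := α.algebra
    let g : F.S →ₗ[F.S] G.S := Algebra.linearMap F.S G.S
    have hex : Function.Exact (RingHom.ker α.toRingHom).subtype g := by
      intro a
      simp only [Set.mem_range, Subtype.exists]
      constructor
      · intro ha
        exact ⟨a, ha, rfl⟩
      · rintro ⟨b, hb, rfl⟩
        exact hb
    have h1 := rTensor_exact M.P hex hα.surjective
    have h2 : g.rTensor M.P (1 ⊗ₜ x) = 0 := by
      rw [LinearMap.rTensor_tmul]
      have : g 1 = 1 := map_one α.toRingHom
      rw [this]
      exact h
    obtain ⟨t, ht⟩ := (h1 _).1 h2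
    have h3 : ∀ t, TensorProduct.lid F.S M.P
        ((RingHom.ker α.toRingHom).subtype.rTensor M.P t) ∈
          RingHom.ker α.toRingHom • (⊤ : Submodule F.S M.P) := by
      intro t
      induction t using TensorProduct.induction_on with
      | zero => simp
      | tmul a y => 
        rw [LinearMap.rTensor_tmul, TensorProduct.lid_tmul]
        exact Submodule.smul_mem_smul a.2 trivial
      | add a b ha hb => rw [map_add, map_add]; exact add_mem ha hb
    have h4 := h3 t
    rw [ht] at h4
    simpa using h4
  · intro h
    induction h using Submodule.smul_induction_on' with
    | smul a ha x _ =>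
      rw [toBase_smul, (RingHom.mem_ker).1 ha, zero_smul]
    | add x _ y _ hx hy => rw [map_add, hx, hy, add_zero]

theorem ker_le_fil (hα : α.IsNilThickening) : RingHom.ker α.toRingHom ≤ F.Fil := fun a ha =>
  hα.mem_fil a (by rw [(RingHom.mem_ker).1 ha]; exact zero_mem _)

theorem exists_fil_of_mem (hα : α.IsNilThickening)
    {b : G.S} (hb : b ∈ G.Fil) : ∃ a ∈ F.Fil, α.toRingHom a = b := by
  obtain ⟨a, rfl⟩ := hα.surjective b
  exact ⟨a, hα.mem_fil a hb, rfl⟩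

theorem exists_of_mem_baseQ (hα : α.IsNilThickening)
    {M : Window F} {y : α.BaseModule M} (hy : y ∈ α.baseQ M) :
    ∃ x ∈ M.Q, α.toBase M x = y := by
  refine α.baseQ_induction M (C := fun y => ∃ x ∈ M.Q, α.toBase M x = y) ?_ ?_ ?_ ?_ ?_ y hy
  · exact fun x hx => ⟨x, hx, rfl⟩
  · rintro ⟨b, hb⟩ y
    obtain ⟨a, ha, rfl⟩ := hα.exists_fil_of_mem hb
    obtain ⟨x, rfl⟩ := hα.toBase_surjective M y
    exact ⟨a • x, M.smul_mem_Q ⟨a, ha⟩ x, α.toBase_smul M a x⟩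
  · exact ⟨0, zero_mem _, map_zero _⟩
  · rintro _ _ _ _ ⟨x, hx, rfl⟩ ⟨y, hy, rfl⟩
    exact ⟨x + y, add_mem hx hy, map_add _ _ _⟩
  · rintro s _ _ ⟨x, hx, rfl⟩
    obtain ⟨r, rfl⟩ := hα.surjective s
    exact ⟨r • x, M.Q.smul_mem r hx, α.toBase_smul M r x⟩

/-- Two preimages differ by an element of `Ker α • P`, and this lies in `Fil P ⊆ Q`. Hence any
linear lift of a window homomorphism automatically preserves `Q`. -/
theorem toBase_mem_baseQ_iff (hα : α.IsNilThickening)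
    {M : Window F} {x : M.P} : α.toBase M x ∈ α.baseQ M ↔ x ∈ M.Q := by
  refine ⟨fun h => ?_, fun h => α.toBase_mem_baseQ M h⟩
  obtain ⟨y, hy, hxy⟩ := hα.exists_of_mem_baseQ h
  have h1 : α.toBase M (x - y) = 0 := by rw [map_sub, hxy, sub_self]
  rw [hα.toBase_eq_zero_iff] at h1
  have h2 := add_mem (M.smul_top_le_Q (Submodule.smul_mono_left hα.ker_le_fil h1)) hy
  rwa [sub_add_cancel] at h2

theorem baseΦ₁_toBase' (hα : α.IsNilThickening) {M : Window F} {x : M.P} (hx : x ∈ M.Q) :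
    α.baseΦ₁ M ⟨α.toBase M x, α.toBase_mem_baseQ M hx⟩ = α.toBase M (M.Φ₁ ⟨x, hx⟩) := by
  have := α.baseΦ₁_toBase M ⟨x, hx⟩
  rwa [hα.u_eq_one, Units.val_one, one_smul] at this

section Lift

variable {M M' : Window F} {π : M.P →ₗ[F.S] M.P} {hπ : ∀ x, π x ∈ M.Q}

/-- Let `U f` be the linear map that agrees with `Φ₁ f` and `Φ f` on the image of a normal
decomposition. If `f` and `f'` are congruent modulo `I`, then `U f` and `U f'` are congruent modulo
any ideal which contains `σ₁ I`. -/
theorem sub_mem_of_normal (hα : α.IsNilThickening)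
    (hspan : Submodule.span F.S (Set.range fun x => M.Φ₁ ⟨π x, hπ x⟩ + M.Φ (x - π x)) = ⊤)
    {f f' g g' : M.P →ₗ[F.S] M'.P} (hf : ∀ x ∈ M.Q, f x ∈ M'.Q) (hf' : ∀ x ∈ M.Q, f' x ∈ M'.Q)
    (hg : ∀ x, g (M.Φ₁ ⟨π x, hπ x⟩ + M.Φ (x - π x)) =
      M'.Φ₁ ⟨f (π x), hf _ (hπ x)⟩ + M'.Φ (f (x - π x)))
    (hg' : ∀ x, g' (M.Φ₁ ⟨π x, hπ x⟩ + M.Φ (x - π x)) =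
      M'.Φ₁ ⟨f' (π x), hf' _ (hπ x)⟩ + M'.Φ (f' (x - π x)))
    {I I' : Ideal F.S} (hI : ∀ a ∈ I, ∃ h : a ∈ F.Fil, F.σ₁ ⟨a, h⟩ ∈ I')
    (hff' : ∀ x, f x - f' x ∈ I • (⊤ : Submodule F.S M'.P)) (x : M.P) :
    g x - g' x ∈ I' • (⊤ : Submodule F.S M'.P) := by
  have hx : x ∈ Submodule.span F.S (Set.range fun x => M.Φ₁ ⟨π x, hπ x⟩ + M.Φ (x - π x)) := by
    rw [hspan]; trivial
  induction hx using Submodule.span_induction with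
  | mem y hy =>
    obtain ⟨x, rfl⟩ := hy
    simp only
    rw [hg, hg', add_sub_add_comm, ← map_sub, ← map_sub]
    refine add_mem ?_ ?_
    · obtain ⟨h1, h2⟩ := Window.Φ₁_mem hI (hff' (π x))
      exact h2
    -- Writing `Φ y = Φ₁ (p y)` reduces the second summand to the same bound, since `p` preserves `I
    -- P'`; no condition on `σ I` is needed.
    · rw [hα.Φ_eq]
      obtain ⟨h1, h2⟩ := Window.Φ₁_mem hI (Submodule.smul_mem _ (p : F.S) (hff' (x - π x)))
      exact h2
  | zero => simp
  | add x y _ _ hx hy =>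
    rw [map_add, map_add, add_sub_add_comm]
    exact add_mem hx hy
  | smul s x _ hx =>
    rw [map_smul, map_smul, ← smul_sub]
    exact Submodule.smul_mem _ _ hx

/-- Since `σ₁ p = 1`, one has `σ₁ (p ^ (k + 1) b) = p ^ k σ b`. So `σ₁` loses only one power of `p`,
which makes the transform of linear maps `p`-adically continuous. -/
theorem σ₁_pow_mem (hα : α.IsNilThickening)
    (k : ℕ) (a : F.S) (ha : a ∈ Ideal.span {(p : F.S)} ^ (k + 1)) :
    ∃ h : a ∈ F.Fil, F.σ₁ ⟨a, h⟩ ∈ Ideal.span {(p : F.S)} ^ k := by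
  rw [Ideal.span_singleton_pow, Ideal.mem_span_singleton] at ha
  obtain ⟨b, rfl⟩ := ha
  have h1 : (p : F.S) ^ (k + 1) * b = (p ^ k * b) * p := by ring
  refine ⟨by rw [h1]; exact Ideal.mul_mem_left _ _ hα.p_mem_fil, ?_⟩
  have h2 : (⟨(p : F.S) ^ (k + 1) * b, by rw [h1]; exact Ideal.mul_mem_left _ _ hα.p_mem_fil⟩ :
      F.Fil) = ((p : F.S) ^ k * b) • ⟨p, hα.p_mem_fil⟩ := Subtype.ext h1
  rw [h2, map_smulₛₗ, hα.σ₁_p.2, map_mul, map_pow, map_natCast, Ideal.span_singleton_pow,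
    Ideal.mem_span_singleton, smul_eq_mul, mul_one]
  exact dvd_mul_right _ _

/-- Window homomorphisms are fixed by the transform in `sub_mem_of_normal`. If two of them agree
modulo `N 0`, they therefore agree modulo every `N m`, and separatedness makes them equal. -/
theorem faithful (hα : α.IsNilThickening) : α.baseChange.Faithful where
  map_injective {M M'} f f' hff' := by
    obtain ⟨N, hN0, hN, hNp⟩ := hα.nilpotent
    obtain ⟨π, hπ, -, -, hspan⟩ := M.exists_normal_projection
    have h0 : ∀ x, f.toLin x - f'.toLin x ∈ N 0 • (⊤ : Submodule F.S M'.P) := by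
      intro x
      rw [hN0, ← hα.toBase_eq_zero_iff, map_sub, ← α.baseMap_toBase f.toLin,
        ← α.baseMap_toBase f'.toLin, sub_eq_zero]
      exact LinearMap.congr_fun (congrArg Window.Hom.toLin hff') (α.toBase M x)
    have hm : ∀ m x, f.toLin x - f'.toLin x ∈ N m • (⊤ : Submodule F.S M'.P) := by
      intro m
      induction m with
      | zero => exact h0
      | succ m ih =>
        refine hα.sub_mem_of_normal hspan f.map_Q f'.map_Q (fun x => ?_) (fun x => ?_) (hN m) ih
        · rw [map_add, f.map_Φ₁, f.map_Φ]
        · rw [map_add, f'.map_Φ₁, f'.map_Φ]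
    refine Window.Hom.ext (LinearMap.ext fun x => ?_)
    rw [← sub_eq_zero]
    refine hα.separated.of_projective M'.P _ fun k => ?_
    obtain ⟨m, hmk⟩ := hNp k
    exact mem_pPow_of_mem_smul (hmk m le_rfl) (hm m x)

end Lift

end Frame.Hom.IsNilThickening

end Crystalline

/-! ### The `p`-adic topology on groups of linear maps. -/

section HomComplete

variable {S P P' : Type*} [CommRing S] [AddCommGroup P] [Module S P] [Module.Finite S P]
  [Module.Projective S P] [AddCommGroup P'] [Module S P']

variable (S P P') in
/-- For a finite projective module `P` the group `Hom(P, P')` is a retract of a power of `P'`, via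
the evaluation at a generating system. -/
theorem exists_retract_linearMap : ∃ (n : ℕ) (v : Fin n → P) (r : (Fin n → P') →+ (P →ₗ[S] P')),
    ∀ f : P →ₗ[S] P', r (fun j => f (v j)) = f := by
  obtain ⟨n, r, i, _, _, hri⟩ := Module.Finite.exists_comp_eq_id_of_projective S P
  refine ⟨n, fun j => r (Pi.single j 1),
    { toFun := fun w => ∑ j, (LinearMap.proj j ∘ₗ i).smulRight (w j)
      map_zero' := by ext; simp
      map_add' := fun w w' => by ext; simp [Finset.sum_add_distrib] }, fun f => ?_⟩
  ext x
  have h2 := LinearMap.congr_fun hri x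
  rw [LinearMap.comp_apply, pi_eq_sum_univ' (i x), map_sum] at h2
  have h3 := congrArg f h2
  simpa [map_sum] using h3

theorem PComplete.linearMap {p : ℕ} (h : PComplete p P') : PComplete p (P →ₗ[S] P') := by
  obtain ⟨n, v, r, hr⟩ := exists_retract_linearMap S P P'
  exact PComplete.of_retract (h.pi (ι := Fin n))
    { toFun := fun f j => f (v j), map_zero' := rfl, map_add' := fun _ _ => rfl } r hr

/-- Pointwise quotients by `p ^ k` need not form a linear map. Dividing only at the generators and
applying the retraction produces one. -/
theorem mem_pPow_linearMap {p k : ℕ} {f : P →ₗ[S] P'} (h : ∀ x, f x ∈ pPow p P' k) :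
    f ∈ pPow p (P →ₗ[S] P') k := by
  obtain ⟨n, v, r, hr⟩ := exists_retract_linearMap S P P'
  choose y hy using fun j => h (v j)
  have h1 : (fun j => f (v j)) ∈ pPow p (Fin n → P') k := ⟨y, funext hy⟩
  have h2 := map_mem_pPow r h1
  rwa [hr] at h2

end HomComplete

/-! ### Fullness of base change along a nil thickening. -/

section Crystalline

variable {p : ℕ} {F G : Frame.{u} p}

/-- The linear map underlying a homomorphism between base changes. -/
def Frame.Hom.homBase {α : Frame.Hom F G} {M M' : Window F}
    (g : α.baseChangeObj M ⟶ α.baseChangeObj M') : α.BaseModule M →ₗ[G.S] α.BaseModule M' :=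
  g.toLin

namespace Frame.Hom.IsNilThickening

variable {α : Frame.Hom F G}

section Lift

variable {M M' : Window F} {g : α.baseChangeObj M ⟶ α.baseChangeObj M'} {f : M.P →ₗ[F.S] M'.P}

theorem map_Q_of_lifts (hα : α.IsNilThickening)
    (hf : ∀ x, α.toBase M' (f x) = homBase g (α.toBase M x)) :
    ∀ x ∈ M.Q, f x ∈ M'.Q := by
  intro x hx
  rw [← hα.toBase_mem_baseQ_iff, hf]
  exact g.map_Q _ (α.toBase_mem_baseQ M hx)

/-- One step of the iteration. The new map exists by universality of `x ↦ Φ₁ (π x) + Φ (x - π x)`;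
it still lifts `g` because `g` commutes with `Φ` and `Φ₁` and the values of that map generate `P`.
-/
theorem exists_next (hα : α.IsNilThickening)
    [Fact p.Prime] {π : M.P →ₗ[F.S] M.P} {hπ : ∀ x, π x ∈ M.Q}
    (hspan : Submodule.span F.S (Set.range fun x => M.Φ₁ ⟨π x, hπ x⟩ + M.Φ (x - π x)) = ⊤)
    (hf : ∀ x, α.toBase M' (f x) = homBase g (α.toBase M x)) :
    ∃ f' : M.P →ₗ[F.S] M'.P, (∀ x, α.toBase M' (f' x) = homBase g (α.toBase M x)) ∧
      ∀ x, f' (M.Φ₁ ⟨π x, hπ x⟩ + M.Φ (x - π x)) =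
        M'.Φ₁ ⟨f (π x), hα.map_Q_of_lifts hf _ (hπ x)⟩ + M'.Φ (f (x - π x)) := by
  let Ψ : M.P →ₛₗ[F.σ] M.P :=
    M.Φ₁ ∘ₛₗ (π.codRestrict M.Q hπ) + M.Φ ∘ₛₗ (LinearMap.id - π)
  let Ψ' : M.P →ₛₗ[F.σ] M'.P :=
    M'.Φ₁ ∘ₛₗ ((f ∘ₗ π).codRestrict M'.Q fun x => hα.map_Q_of_lifts hf _ (hπ x)) +
      M'.Φ ∘ₛₗ (f ∘ₗ (LinearMap.id - π))
  obtain ⟨f', hf'⟩ := exists_comp_eq_of_frobenius_lift F.frobenius_lift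
    (le_sup_left.trans F.le_jacobson) Ψ hspan Ψ'
  refine ⟨f', fun x => ?_, hf'⟩
  have hx : x ∈ Submodule.span F.S (Set.range fun x => M.Φ₁ ⟨π x, hπ x⟩ + M.Φ (x - π x)) := by
    rw [hspan]; trivial
  induction hx using Submodule.span_induction with
  | mem y hy =>
    obtain ⟨x, rfl⟩ := hy
    refine (congrArg (α.toBase M') (hf' x)).trans ?_
    change α.toBase M' (M'.Φ₁ ⟨f (π x), hα.map_Q_of_lifts hf _ (hπ x)⟩ + M'.Φ (f (x - π x))) =
      homBase g (α.toBase M (M.Φ₁ ⟨π x, hπ x⟩ + M.Φ (x - π x)))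
    rw [map_add, map_add, ← hα.baseΦ₁_toBase' (hπ x), ← hα.baseΦ₁_toBase',
      ← α.baseΦ_toBase, ← α.baseΦ_toBase]
    have h1 := g.map_Φ₁ ⟨α.toBase M (π x), α.toBase_mem_baseQ M (hπ x)⟩
    have h2 := g.map_Φ (α.toBase M (x - π x))
    refine Eq.trans ?_ (map_add (homBase g) _ _).symm
    refine Eq.trans ?_ (congrArg₂ (· + ·) h1 h2).symm
    refine congrArg₂ (· + ·) ?_ ?_
    · change α.baseΦ₁ M' _ = α.baseΦ₁ M' _
      congr 1
      exact Subtype.ext (hf (π x))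
    · change α.baseΦ M' _ = α.baseΦ M' _
      rw [hf]
      rfl
  | zero => rw [map_zero, map_zero, map_zero]; exact (map_zero (homBase g)).symm
  | add x y _ _ hx hy =>
    rw [map_add, map_add, map_add, hx, hy]
    exact (map_add (homBase g) _ _).symm
  | smul s x _ hx =>
    rw [map_smul, toBase_smul, toBase_smul, hx]
    exact (map_smul (homBase g) _ _).symm

end Lift

/-- A linear lift of `g` exists by projectivity; iterating the transform makes it converge to a
fixed point, which is a window homomorphism. -/
theorem full (hα : α.IsNilThickening) [Fact p.Prime] : α.baseChange.Full where
  map_surjective {M M'} g := by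
    change α.baseChangeObj M ⟶ α.baseChangeObj M' at g
    obtain ⟨N, hN0, hN, hNp⟩ := hα.nilpotent
    obtain ⟨π, hπ, hπ2, hπQ, hspan⟩ := M.exists_normal_projection
    obtain ⟨f₀, hf₀⟩ := exists_semilinear_lift (τ := RingHom.id F.S) (P := M.P) (α.toBase M')
      (hα.toBase_surjective M') ((homBase g).toAddMonoidHom.comp (α.toBase M)) (fun s y x h => by
        change α.toBase M' (s • y) = homBase g (α.toBase M (s • x))
        rw [toBase_smul, toBase_smul, h]
        exact (map_smul (homBase g) _ _).symm)
    replace hf₀ : ∀ x, α.toBase M' (f₀ x) = homBase g (α.toBase M x) := hf₀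
    choose U hU hU' using fun f : {f : M.P →ₗ[F.S] M'.P //
      ∀ x, α.toBase M' (f x) = homBase g (α.toBase M x)} => hα.exists_next hspan f.2
    let s : ℕ → {f : M.P →ₗ[F.S] M'.P // ∀ x, α.toBase M' (f x) = homBase g (α.toBase M x)} :=
      fun n => Nat.rec ⟨f₀, hf₀⟩ (fun _ f => ⟨U f, hU f⟩) n
    have hs : ∀ n, (s (n + 1)).1 = U (s n) := fun n => rfl
    -- At `n = 0` the two maps are lifts of the same `g`, so they differ by `Ker α = N 0`; each
    -- further step moves the difference from `N n` to `N (n + 1)`.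
    have hsN : ∀ n x, (s (n + 1)).1 x - (s n).1 x ∈ N n • (⊤ : Submodule F.S M'.P) := by
      intro n
      induction n with
      | zero =>
        intro x
        rw [hN0, ← hα.toBase_eq_zero_iff, map_sub, (s (0 + 1)).2, (s 0).2, sub_self]
      | succ n ih =>
        exact hα.sub_mem_of_normal hspan (hα.map_Q_of_lifts (s (n + 1)).2)
          (hα.map_Q_of_lifts (s n).2) (hU' (s (n + 1))) (hU' (s n)) (hN n) ih
    obtain ⟨f, hf⟩ := (hα.complete.of_projective M'.P).linearMap.exists_limit (fun n => (s n).1)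
      fun k => by
        obtain ⟨m, hm⟩ := hNp k
        exact ⟨m, fun j hj => mem_pPow_linearMap fun x =>
          mem_pPow_of_mem_smul (hm j hj) (hsN j x)⟩
    have hfx : ∀ k, ∃ m, ∀ j ≥ m, ∀ x, f x - (s j).1 x ∈ pPow p M'.P k := by
      intro k
      obtain ⟨m, hm⟩ := hf k
      refine ⟨m, fun j hj x => ?_⟩
      obtain ⟨h, hh⟩ := hm j hj
      exact ⟨h x, LinearMap.congr_fun hh x⟩
    have hfl : ∀ x, α.toBase M' (f x) = homBase g (α.toBase M x) := by
      intro x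
      rw [← sub_eq_zero]
      refine hα.separated_target.of_projective (α.baseChangeObj M').P _ fun k => ?_
      obtain ⟨m, hm⟩ := hfx k
      rw [← (s m).2 x]
      have := map_mem_pPow (α.toBase M') (hm m le_rfl x)
      rwa [map_sub] at this
    -- Both sides are compared with `U (s m) = s (m + 1)`. Precision `k + 1` is required for `f - s
    -- m` because applying `U` costs one power of `p`.
    have hUf : U ⟨f, hfl⟩ = f := by
      ext x
      rw [← sub_eq_zero]
      refine hα.separated.of_projective M'.P _ fun k => ?_
      obtain ⟨m, hm⟩ := hfx (k + 1)
      have h1 := hα.sub_mem_of_normal hspan (hα.map_Q_of_lifts hfl)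
        (hα.map_Q_of_lifts (s m).2) (hU' ⟨f, hfl⟩) (hU' (s m)) (hα.σ₁_pow_mem k)
        (fun x => mem_smul_of_mem_pPow F.S (hm m le_rfl x)) x
      have h2 := mem_pPow_of_mem_smul (fun a ha => mem_pPow_iff_mem_span.2 ha) h1
      have h3 := pPow_anti (Nat.le_succ k) (hm (m + 1) (Nat.le_succ m) x)
      have h4 := sub_mem h2 h3
      rwa [hs, sub_sub_sub_cancel_right] at h4
    have hΦ₁ := Window.map_Φ₁_of_normal hπ2 hπQ (hα.map_Q_of_lifts hfl) (hπ := hπ) (fun x => by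
      have := hU' ⟨f, hfl⟩ x
      rwa [hUf] at this)
    refine ⟨⟨f, hα.map_Q_of_lifts hfl, fun x => ?_, hΦ₁⟩, ?_⟩
    · rw [hα.Φ_eq, hα.Φ_eq, hΦ₁]
      congr 1
      exact Subtype.ext (map_smul _ _ _)
    · refine Window.Hom.ext (α.semilinear_ext M fun x => ?_)
      exact (α.baseMap_toBase f x).trans (hfl x)

end Frame.Hom.IsNilThickening

end Crystalline

/-! ### Lifting of finite projective modules. -/

theorem matrix_pow_mem {S : Type*} [CommRing S] {n : ℕ} {I : Ideal S}
    {A : Matrix (Fin n) (Fin n) S} (h : ∀ i j, A i j ∈ I) (c : ℕ) (i j : Fin n) :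
    (A ^ c) i j ∈ I ^ c := by
  induction c generalizing i j with
  | zero => simp
  | succ c ih =>
    rw [pow_succ, pow_succ, Matrix.mul_apply]
    exact sum_mem fun k _ => Ideal.mul_mem_mul (ih i k) (h k j)

/-- Finite projective modules lift along a surjective homomorphism of `p`-adically complete rings
whose kernel is a nil ideal modulo `p`. -/
theorem exists_projective_lift {p : ℕ} {S S' : Type*} [CommRing S] [CommRing S'] (α : S →+* S')
    (hα : Function.Surjective α) (hS : PComplete p S) (hS₁ : PSeparated p S)
    (hS' : PSeparated p S') (hker : RingHom.ker α ≤ (Ideal.span {(p : S)}).radical) (X : Type*)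
    [AddCommGroup X] [Module S' X] [Module.Finite S' X] [Module.Projective S' X] :
    ∃ (n : ℕ) (P : Submodule S (Fin n → S)) (π : P →ₛₗ[α] X), Module.Finite S P ∧
      Module.Projective S P ∧ Function.Surjective π ∧
      ∀ x, π x = 0 → x ∈ RingHom.ker α • (⊤ : Submodule S P) := by
  obtain ⟨n, r, i, _, _, hri⟩ := Module.Finite.exists_comp_eq_id_of_projective S' X
  have hri' : ∀ x, r (i x) = x := fun x => LinearMap.congr_fun hri x
  let E' : Matrix (Fin n) (Fin n) S' := LinearMap.toMatrix' (i ∘ₗ r)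
  have hE' : ∀ y, E'.mulVec y = i (r y) := fun y => LinearMap.toMatrix'_mulVec (i ∘ₗ r) y
  have hE'2 : E' ^ 2 = E' := by
    rw [pow_two, ← LinearMap.toMatrix'_comp, LinearMap.comp_assoc, ← LinearMap.comp_assoc r i r,
      hri, LinearMap.id_comp]
  choose s hs using hα
  let E : Matrix (Fin n) (Fin n) S := E'.map s
  have hE : α.mapMatrix E = E' := by ext; simp [E, hs]
  have hmap : α.mapMatrix (E ^ 2 - E) = 0 := by rw [map_sub, map_pow, hE, hE'2, sub_self]
  let I : Ideal S := Ideal.span (Set.range fun ij : Fin n × Fin n => (E ^ 2 - E) ij.1 ij.2)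
  have hI : I ≤ (Ideal.span {(p : S)}).radical := by
    refine le_trans (Ideal.span_le.2 ?_) hker
    rintro _ ⟨⟨a, b⟩, rfl⟩
    exact congrFun (congrFun hmap a) b
  have hIfg : I.FG := Submodule.fg_span (Set.finite_range _)
  obtain ⟨c, hc⟩ := Ideal.exists_pow_le_of_le_radical_of_fg hI hIfg
  have hpow : (E ^ 2 - E) ^ c ∈ pPow p (Matrix (Fin n) (Fin n) S) 1 := by
    have h1 : ∀ a b, ((E ^ 2 - E) ^ c) a b ∈ pPow p S 1 := fun a b => by
      rw [mem_pPow_iff_mem_span, pow_one]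
      exact hc (matrix_pow_mem (I := I) (fun a b => Ideal.subset_span ⟨(a, b), rfl⟩) c a b)
    choose y hy using h1
    exact ⟨y, Matrix.ext hy⟩
  have hM : PComplete p (Matrix (Fin n) (Fin n) S) :=
    (hS.pi.pi : PComplete p (Fin n → Fin n → S))
  have hM₁ : PSeparated p (Matrix (Fin n) (Fin n) S) :=
    (hS₁.pi.pi : PSeparated p (Fin n → Fin n → S))
  have hM' : PSeparated p (Matrix (Fin n) (Fin n) S') :=
    (hS'.pi.pi : PSeparated p (Fin n → Fin n → S'))
  obtain ⟨e, he, heE⟩ := exists_isIdempotentElem_lift α.mapMatrix hM hM₁ hM' E c hpow hmap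
  rw [hE] at heE
  let ε : (Fin n → S) →ₗ[S] (Fin n → S) := Matrix.toLin' e
  have hε : ∀ x, ε (ε x) = ε x := fun x => by
    simp only [ε, Matrix.toLin'_apply, Matrix.mulVec_mulVec, ← pow_two, he]
  have hαε : ∀ x : Fin n → S, (fun j => α (ε x j)) = i (r fun j => α (x j)) := by
    intro x
    rw [← hE', ← heE]
    ext j
    exact RingHom.map_mulVec α e x j
  let q : (Fin n → S) →ₛₗ[α] (Fin n → S') :=
    { toFun := fun x j => α (x j)
      map_add' := fun x y => by ext; simp
      map_smul' := fun a x => by ext; simp }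
  have hP : ∀ x : LinearMap.range ε, ε x = x := by
    rintro ⟨_, y, rfl⟩
    exact hε y
  refine ⟨n, LinearMap.range ε, r ∘ₛₗ q ∘ₛₗ (LinearMap.range ε).subtype, inferInstance, ?_, ?_, ?_⟩
  · exact Module.Projective.of_split (LinearMap.range ε).subtype ε.rangeRestrict
      (LinearMap.ext fun x => Subtype.ext (hP x))
  · intro x
    refine ⟨⟨ε fun j => s (i x j), _, rfl⟩, ?_⟩
    change r (fun j => α (ε _ j)) = x
    rw [hαε]
    simp only [hs]
    rw [hri', hri']
  · intro x hx
    -- For `x` in the range of `ε`, applying `α` to the coordinates gives `i` of the image of `x` in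
    -- `X`. If that image is zero, all coordinates lie in the kernel, and `x = ε x = ∑ x_j • ε e_j`.
    have h1 : (fun j => α ((x : Fin n → S) j)) = 0 := by
      have h2 := hαε x
      rw [hP] at h2
      rw [h2]
      exact (congrArg i hx).trans (map_zero i)
    have h3 : x = ∑ j, (x : Fin n → S) j • ε.rangeRestrict (Pi.single j 1) := by
      apply Subtype.ext
      conv_lhs => rw [← hP x, pi_eq_sum_univ' (x : Fin n → S), map_sum]
      simp
    rw [h3]
    exact sum_mem fun j _ => Submodule.smul_mem_smul (congrFun h1 j) trivial

/-! ### Windows defined by normal representations. -/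

section

variable {p : ℕ} {F G : Frame.{u} p}

/-- The product `p a` is read both as `p • a` and as `a • p` in `Fil`, and `σ₁` is applied to both.
-/
theorem Frame.p_mul_σ₁ (hpF : (p : F.S) ∈ F.Fil) (hσ : F.σ₁ ⟨p, hpF⟩ = 1) (a : F.Fil) :
    (p : F.S) * F.σ₁ a = F.σ a := by
  have h1 : (p : F.S) • a = (a : F.S) • (⟨p, hpF⟩ : F.Fil) := Subtype.ext (mul_comm _ _)
  have h2 := congrArg F.σ₁ h1
  rwa [map_smulₛₗ, map_smulₛₗ, map_natCast, hσ, smul_eq_mul, smul_eq_mul, mul_one] at h2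

/-- Here `a ^ p ≡ σ a = p σ₁ a ≡ 0` modulo `p`. This is what permits idempotents to be lifted along
`α`. -/
theorem Frame.fil_le_radical (hpF : (p : F.S) ∈ F.Fil) (hσ : F.σ₁ ⟨p, hpF⟩ = 1) :
    F.Fil ≤ (Ideal.span {(p : F.S)}).radical := by
  intro a ha
  have h1 := F.frobenius_lift a
  have h2 : F.σ a ∈ Ideal.span {(p : F.S)} := by
    rw [← Frame.p_mul_σ₁ hpF hσ ⟨a, ha⟩]
    exact Ideal.mul_mem_right _ _ (Ideal.mem_span_singleton_self _)
  have h3 := sub_mem h2 h1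
  rw [sub_sub_cancel] at h3
  exact ⟨p, h3⟩

/-- A bijective homomorphism of windows that induces a surjection `Q → Q'` is an isomorphism. -/
theorem Window.nonempty_iso {M N : Window F} (f : M ⟶ N) (hf : Function.Bijective f.toLin)
    (hQ : ∀ y ∈ N.Q, ∃ x ∈ M.Q, f.toLin x = y) : Nonempty (M ≅ N) := by
  let e := LinearEquiv.ofBijective f.toLin hf
  have he : ∀ x, e.symm (f.toLin x) = x := fun x => e.symm_apply_apply x
  have he' : ∀ y, f.toLin (e.symm y) = y := fun y => e.apply_symm_apply y
  have hQ' : ∀ y ∈ N.Q, e.symm y ∈ M.Q := by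
    intro y hy
    obtain ⟨x, hx, rfl⟩ := hQ y hy
    rwa [he]
  let g : N ⟶ M :=
    { toLin := e.symm.toLinearMap
      map_Q := hQ'
      map_Φ := fun y => hf.1 (by
        rw [f.map_Φ]
        change f.toLin (e.symm _) = N.Φ (f.toLin (e.symm y))
        rw [he', he'])
      map_Φ₁ := fun y => hf.1 (by
        rw [f.map_Φ₁]
        change f.toLin (e.symm _) = _
        rw [he']
        congr 1
        exact Subtype.ext (he' y).symm) }
  exact ⟨⟨f, g, Window.Hom.ext (LinearMap.ext he), Window.Hom.ext (LinearMap.ext he')⟩⟩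

section Normal

variable (L T : Type u) [AddCommGroup L] [Module F.S L] [AddCommGroup T] [Module F.S T]

theorem prod_mk_mem_smul {I : Ideal F.S} {t : T} (h : t ∈ I • (⊤ : Submodule F.S T)) :
    ((0, t) : L × T) ∈ I • (⊤ : Submodule F.S (L × T)) := by
  have h1 := Submodule.mem_map_of_mem (f := LinearMap.inr F.S L T) h
  rw [Submodule.map_smul''] at h1
  exact Submodule.smul_mono le_rfl le_top h1

theorem prod_mk_mem_smul' {I : Ideal F.S} {l : L} (h : l ∈ I • (⊤ : Submodule F.S L)) :
    ((l, 0) : L × T) ∈ I • (⊤ : Submodule F.S (L × T)) := by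
  have h1 := Submodule.mem_map_of_mem (f := LinearMap.inl F.S L T) h
  rw [Submodule.map_smul''] at h1
  exact Submodule.smul_mono le_rfl le_top h1

variable [Module.Projective F.S L] [Module.Projective F.S T]

variable {L T} in
/-- The map `a (l, t) ↦ σ₁ a • Ψ (0, t)`. -/
noncomputable def normalAux (Ψ : (L × T) →ₛₗ[F.σ] (L × T)) :
    ↥(F.Fil • (⊤ : Submodule F.S (L × T))) →ₛₗ[F.σ] (L × T) :=
  (exists_idealSMul F.σ₁ (Ψ ∘ₛₗ (LinearMap.inr F.S L T ∘ₗ LinearMap.snd F.S L T))).choose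

variable {L T}

theorem normalAux_smul (Ψ : (L × T) →ₛₗ[F.σ] (L × T)) (a : F.Fil) (x : L × T)
    (h : (a : F.S) • x ∈ F.Fil • (⊤ : Submodule F.S (L × T))) :
    normalAux Ψ ⟨(a : F.S) • x, h⟩ = F.σ₁ a • Ψ (0, x.2) :=
  (exists_idealSMul F.σ₁
    (Ψ ∘ₛₗ (LinearMap.inr F.S L T ∘ₗ LinearMap.snd F.S L T))).choose_spec a x h

/-- The map `Φ₁` defined by a normal representation `Ψ`. -/
noncomputable def normalΦ₁ (Ψ : (L × T) →ₛₗ[F.σ] (L × T)) :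
    ↥(Submodule.prod (⊤ : Submodule F.S L) (F.Fil • (⊤ : Submodule F.S T))) →ₛₗ[F.σ] (L × T) :=
  Ψ ∘ₛₗ (LinearMap.inl F.S L T ∘ₗ LinearMap.fst F.S L T ∘ₗ
      (Submodule.prod ⊤ (F.Fil • ⊤)).subtype) +
    normalAux Ψ ∘ₛₗ
      (LinearMap.codRestrict (F.Fil • (⊤ : Submodule F.S (L × T)))
        (LinearMap.inr F.S L T ∘ₗ LinearMap.snd F.S L T ∘ₗ
          (Submodule.prod ⊤ (F.Fil • ⊤)).subtype)
        fun x => prod_mk_mem_smul L T x.2.2)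

theorem normalΦ₁_apply (Ψ : (L × T) →ₛₗ[F.σ] (L × T)) (x : L × T) (hx) :
    normalΦ₁ Ψ ⟨x, hx⟩ = Ψ (x.1, 0) + normalAux Ψ ⟨(0, x.2), prod_mk_mem_smul L T hx.2⟩ := rfl

/-- The window defined by a normal representation. -/
noncomputable def normalWindow [Module.Finite F.S L] [Module.Finite F.S T]
    (hpF : (p : F.S) ∈ F.Fil) (hσ : F.σ₁ ⟨p, hpF⟩ = 1)
    (Ψ : (L × T) →ₛₗ[F.σ] (L × T)) (hΨ : Submodule.span F.S (Set.range Ψ) = ⊤) : Window F where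
  P := L × T
  Q := Submodule.prod ⊤ (F.Fil • ⊤)
  -- The factor `p` on `L` is forced: there `Φ l = Φ₁ (p l) = p Φ₁ l`, while `Φ₁` equals `Ψ` on `L`
  -- and `Φ` equals `Ψ` on `T`.
  Φ := Ψ ∘ₛₗ ((p : F.S) • (LinearMap.inl F.S L T ∘ₗ LinearMap.fst F.S L T) +
    LinearMap.inr F.S L T ∘ₗ LinearMap.snd F.S L T)
  Φ₁ := normalΦ₁ Ψ
  exists_normal := by
    refine ⟨Submodule.prod ⊤ ⊥, Submodule.prod ⊥ ⊤, ⟨?_, ?_⟩, le_antisymm ?_ ?_⟩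
    · rw [Submodule.disjoint_def]
      rintro ⟨l, t⟩ h1 h2
      exact Prod.ext h2.1 h1.2
    · rw [codisjoint_iff, eq_top_iff]
      rintro ⟨l, t⟩ -
      refine Submodule.mem_sup.2 ⟨(l, 0), ⟨trivial, rfl⟩, (0, t), ⟨rfl, trivial⟩, by simp⟩
    · rintro ⟨l, t⟩ h
      refine Submodule.mem_sup.2 ⟨(l, 0), ⟨trivial, rfl⟩, (0, t), ?_, by simp⟩
      have h1 := Submodule.mem_map_of_mem (f := LinearMap.inr F.S L T) h.2
      rw [Submodule.map_smul''] at h1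
      refine Submodule.smul_mono le_rfl ?_ h1
      rintro _ ⟨x, -, rfl⟩
      exact ⟨rfl, trivial⟩
    · rw [sup_le_iff]
      constructor
      · rintro ⟨l, t⟩ h
        obtain rfl : t = 0 := h.2
        exact ⟨trivial, zero_mem _⟩
      · rw [Submodule.smul_le]
        rintro a ha ⟨l, t⟩ h
        exact ⟨trivial, Submodule.smul_mem_smul ha trivial⟩
  Φ₁_smul a x h := by
    have h1 : normalAux Ψ ⟨(0, ((a : F.S) • x).2), prod_mk_mem_smul L T h.2⟩ =
        F.σ₁ a • Ψ (0, x.2) := by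
      have h2 := normalAux_smul Ψ a (0, x.2) (Submodule.smul_mem_smul a.2 trivial)
      rw [← h2]
      congr 1
      exact Subtype.ext (Prod.ext (by simp) (by simp))
    have h2 : Ψ (((a : F.S) • x).1, 0) = F.σ a • Ψ (x.1, 0) := by
      rw [← map_smulₛₗ]
      congr 1
      exact Prod.ext (by simp) (by simp)
    rw [normalΦ₁_apply, h1, h2, ← Frame.p_mul_σ₁ hpF hσ]
    change _ = F.σ₁ a • Ψ ((p : F.S) • (x.1, 0) + (0, x.2))
    rw [map_add, map_smulₛₗ, map_natCast, smul_add, smul_smul, mul_comm (p : F.S)]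
  span_Φ₁ := by
    rw [eq_top_iff, ← hΨ, Submodule.span_le]
    rintro _ ⟨⟨l, t⟩, rfl⟩
    -- Because `σ₁ p = 1`, the element `(l, p t)` of `Q` is a preimage of `Ψ (l, t)` under `Φ₁`.
    have hmem : ((l, (p : F.S) • t) : L × T) ∈
        Submodule.prod (⊤ : Submodule F.S L) (F.Fil • (⊤ : Submodule F.S T)) :=
      ⟨trivial, Submodule.smul_mem_smul hpF trivial⟩
    refine Submodule.subset_span ⟨⟨_, hmem⟩, ?_⟩
    have h1 : normalAux Ψ ⟨(0, (p : F.S) • t), prod_mk_mem_smul L T hmem.2⟩ = Ψ (0, t) := by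
      have h2 := normalAux_smul Ψ ⟨p, hpF⟩ (0, t) (Submodule.smul_mem_smul hpF trivial)
      rw [hσ, one_smul] at h2
      rw [← h2]
      congr 1
      exact Subtype.ext (Prod.ext (by simp) (by simp))
    rw [normalΦ₁_apply, h1, ← map_add]
    simp

end Normal

end

/-! ### Essential surjectivity, and nil thickenings are crystalline. -/

section Crystalline

variable {p : ℕ} {F G : Frame.{u} p}

namespace Frame.Hom.IsNilThickening

variable {α : Frame.Hom F G}

theorem p_mem_fil_target (hα : α.IsNilThickening) : (p : G.S) ∈ G.Fil := by
  have := α.map_fil _ hα.p_mem_fil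
  rwa [map_natCast] at this

theorem map_σ₁' (hα : α.IsNilThickening) (a : F.S) (ha : a ∈ F.Fil) :
    G.σ₁ ⟨α.toRingHom a, α.map_fil a ha⟩ = α.toRingHom (F.σ₁ ⟨a, ha⟩) := by
  have := α.map_σ₁ ⟨a, ha⟩
  rwa [hα.u_eq_one, Units.val_one, one_mul] at this

theorem σ₁_p_target (hα : α.IsNilThickening) : G.σ₁ ⟨p, hα.p_mem_fil_target⟩ = 1 := by
  have h := hα.map_σ₁' p hα.p_mem_fil
  rw [hα.σ₁_p.2, map_one] at h
  rw [← h]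
  congr 1
  exact Subtype.ext (map_natCast _ _).symm

theorem Φ_eq_target (hα : α.IsNilThickening) (M : Window G) (x : M.P) :
    M.Φ x = M.Φ₁ ⟨(p : G.S) • x, M.smul_mem_Q ⟨p, hα.p_mem_fil_target⟩ x⟩ := by
  rw [M.Φ₁_smul ⟨p, hα.p_mem_fil_target⟩ x, hα.σ₁_p_target, one_smul]

/-- A window over `F` whose reduction is the given window over `G` is a lift of that window. -/
theorem nonempty_iso_of_reduction (hα : α.IsNilThickening)
    {M : Window F} {N : Window G} (π : M.P →ₛₗ[α.toRingHom] N.P)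
    (hπ : Function.Surjective π)
    (hker : ∀ x, π x = 0 → x ∈ RingHom.ker α.toRingHom • (⊤ : Submodule F.S M.P))
    (hQ : ∀ x ∈ M.Q, π x ∈ N.Q) (hQ' : ∀ y ∈ N.Q, ∃ x ∈ M.Q, π x = y)
    (hΦ₁ : ∀ x (hx : x ∈ M.Q), π (M.Φ₁ ⟨x, hx⟩) = N.Φ₁ ⟨π x, hQ x hx⟩) :
    Nonempty (α.baseChangeObj M ≅ N) := by
  obtain ⟨θ, hθ⟩ : ∃ θ : α.BaseModule M →ₗ[G.S] N.P, ∀ x, θ (α.toBase M x) = π x := by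
    let _ := α.algebra
    exact exists_linearization (S := F.S) (T := G.S) π
  have hΦ : ∀ x, π (M.Φ x) = N.Φ (π x) := by
    intro x
    rw [hα.Φ_eq, hα.Φ_eq_target, hΦ₁]
    congr 1
    exact Subtype.ext (by simp)
  let f : α.baseChangeObj M ⟶ N :=
    { toLin := θ
      map_Q := fun y hy => by
        obtain ⟨x, hx, rfl⟩ := hα.exists_of_mem_baseQ hy
        have h1 := hQ x hx
        rw [← hθ] at h1
        exact h1
      map_Φ := fun y => by
        obtain ⟨x, rfl⟩ := hα.toBase_surjective M y
        change θ (α.baseΦ M (α.toBase M x)) = N.Φ (θ (α.toBase M x))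
        rw [α.baseΦ_toBase, hθ, hθ, hΦ]
      map_Φ₁ := by
        rintro ⟨y, hy⟩
        obtain ⟨x, hx, rfl⟩ := hα.exists_of_mem_baseQ hy
        have h1 := hα.baseΦ₁_toBase' hx
        change θ (α.baseΦ₁ M ⟨α.toBase M x, hy⟩) = _
        rw [h1, hθ, hΦ₁ x hx]
        congr 1
        exact Subtype.ext (hθ x).symm }
  refine Window.nonempty_iso f ⟨?_, ?_⟩ ?_
  · change Function.Injective θ
    rw [injective_iff_map_eq_zero]
    intro y hy
    obtain ⟨x, rfl⟩ := hα.toBase_surjective M y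
    rw [hθ] at hy
    exact hα.toBase_eq_zero_iff.2 (hker x hy)
  · intro y
    obtain ⟨x, rfl⟩ := hπ y
    exact ⟨α.toBase M x, hθ x⟩
  · intro y hy
    obtain ⟨x, hx, rfl⟩ := hQ' y hy
    exact ⟨α.toBase M x, α.toBase_mem_baseQ M hx, hθ x⟩

theorem ker_le_radical (hα : α.IsNilThickening) :
    RingHom.ker α.toRingHom ≤ (Ideal.span {(p : F.S)}).radical :=
  hα.ker_le_fil.trans (Frame.fil_le_radical hα.p_mem_fil hα.σ₁_p.2)

/-- The modules of a normal decomposition and the semilinear map that encodes `Φ₁` on `L` and `Φ` on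
`T` are lifted separately. The lifted data define a window over `F` with the given reduction. -/
theorem exists_reduction_eq (hα : α.IsNilThickening)
    (N : Window G) : ∃ M : Window F, Nonempty (α.baseChangeObj M ≅ N) := by
  obtain ⟨L, T, hLT, hNQ⟩ := N.exists_normal
  have hLQ : L ≤ N.Q := hNQ ▸ le_sup_left
  have hfin : ∀ {A B : Submodule G.S N.P}, IsCompl A B → Module.Finite G.S A ∧
      Module.Projective G.S A := by
    intro A B h
    have h1 : A.projectionOnto B h ∘ₗ A.subtype = LinearMap.id := by
      ext x
      simp [Submodule.projectionOnto_apply_left h x]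
    exact ⟨Module.Finite.of_surjective (A.projectionOnto B h) fun x =>
      ⟨x, LinearMap.congr_fun h1 x⟩, Module.Projective.of_split _ _ h1⟩
  obtain ⟨hL1, hL2⟩ := hfin hLT
  obtain ⟨hT1, hT2⟩ := hfin hLT.symm
  obtain ⟨n, L', πL, hL1', hL2', hLs, hLk⟩ := exists_projective_lift α.toRingHom hα.surjective
    hα.complete hα.separated hα.separated_target hα.ker_le_radical L
  obtain ⟨n', T', πT, hT1', hT2', hTs, hTk⟩ := exists_projective_lift α.toRingHom hα.surjective
    hα.complete hα.separated hα.separated_target hα.ker_le_radical T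
  let π : (L' × T') →ₛₗ[α.toRingHom] N.P :=
    L.subtype ∘ₛₗ πL ∘ₛₗ LinearMap.fst F.S L' T' + T.subtype ∘ₛₗ πT ∘ₛₗ LinearMap.snd F.S L' T'
  have hπ : ∀ l t, π (l, t) = πL l + πT t := fun l t => rfl
  have hπs : Function.Surjective π := by
    intro y
    have hy : y ∈ L ⊔ T := by rw [hLT.sup_eq_top]; trivial
    obtain ⟨l, hl, t, ht, rfl⟩ := Submodule.mem_sup.1 hy
    obtain ⟨l', hl'⟩ := hLs ⟨l, hl⟩
    obtain ⟨t', ht'⟩ := hTs ⟨t, ht⟩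
    exact ⟨(l', t'), by rw [hπ, hl', ht']⟩
  have hker : ∀ x, π x = 0 →
      x ∈ RingHom.ker α.toRingHom • (⊤ : Submodule F.S (L' × T')) := by
    rintro ⟨l, t⟩ h
    rw [hπ] at h
    have h1 : (πL l : N.P) ∈ T := by
      rw [eq_neg_of_add_eq_zero_left h]
      exact neg_mem (πT t).2
    have h2 : (πL l : N.P) = 0 := Submodule.disjoint_def.1 hLT.disjoint _ (πL l).2 h1
    rw [h2, zero_add] at h
    have h3 := hLk l (Subtype.ext h2)
    have h4 := hTk t (Subtype.ext h)
    have h5 := add_mem (prod_mk_mem_smul' L' T' h3) (prod_mk_mem_smul L' T' h4)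
    simpa using h5
  let pL : N.P →ₗ[G.S] L := L.projectionOnto T hLT
  have hpL : ∀ x : L, pL x = x := fun x => Submodule.projectionOnto_apply_left hLT x
  have hpT : ∀ x : T, pL x = 0 := fun x => by simp [pL]
  let ρ : N.P →ₗ[G.S] N.P := L.subtype ∘ₗ pL
  have hρ : ∀ x, ρ x ∈ N.Q := fun x => hLQ (pL x).2
  -- The normal representation of `N`: it is `Φ₁` on `L` and `Φ` on `T`, and it determines the
  -- window.
  let Ψ' : N.P →ₛₗ[G.σ] N.P :=
    N.Φ₁ ∘ₛₗ (ρ.codRestrict N.Q hρ) + N.Φ ∘ₛₗ (LinearMap.id - ρ)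
  have hΨL : ∀ x : L, Ψ' x = N.Φ₁ ⟨x, hLQ x.2⟩ := fun x => by
    have h1 : ρ x = x := congrArg Subtype.val (hpL x)
    change N.Φ₁ ⟨ρ x, _⟩ + N.Φ (x - ρ x) = _
    simp only [h1, sub_self, map_zero, add_zero]
  have hΨT : ∀ x : T, Ψ' x = N.Φ x := fun x => by
    have h1 : ρ x = 0 := congrArg Subtype.val (hpT x)
    have h2 : (⟨ρ x, hρ x⟩ : N.Q) = 0 := Subtype.ext h1
    change N.Φ₁ ⟨ρ x, hρ x⟩ + N.Φ (x - ρ x) = _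
    rw [h2, h1, map_zero, zero_add, sub_zero]
  obtain ⟨Ψ, hΨ⟩ := exists_semilinear_lift (τ := F.σ) (P := L' × T') π.toAddMonoidHom hπs
    (Ψ'.toAddMonoidHom.comp π.toAddMonoidHom) (fun s y x h => by
      change π y = Ψ' (π x) at h
      change π (F.σ s • y) = Ψ' (π (s • x))
      rw [map_smulₛₗ, h, map_smulₛₗ, map_smulₛₗ, α.map_σ])
  replace hΨ : ∀ x, π (Ψ x) = Ψ' (π x) := hΨ
  have hspan' : Submodule.span G.S (Set.range Ψ') = ⊤ := by
    set W := Submodule.span G.S (Set.range Ψ')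
    have h2 : ∀ z ∈ G.Fil • T, ∃ h : z ∈ N.Q, N.Φ₁ ⟨z, h⟩ ∈ W := by
      intro z hz
      induction hz using Submodule.smul_induction_on' with
      | smul a ha x hx =>
        refine ⟨N.smul_mem_Q ⟨a, ha⟩ x, ?_⟩
        rw [N.Φ₁_smul ⟨a, ha⟩ x, ← hΨT ⟨x, hx⟩]
        exact W.smul_mem _ (Submodule.subset_span ⟨x, rfl⟩)
      | add x _ y _ hx hy =>
        obtain ⟨h1, h1'⟩ := hx
        obtain ⟨h2, h2'⟩ := hy
        refine ⟨add_mem h1 h2, ?_⟩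
        have : (⟨x + y, add_mem h1 h2⟩ : N.Q) = ⟨x, h1⟩ + ⟨y, h2⟩ := rfl
        rw [this, map_add]
        exact add_mem h1' h2'
    rw [eq_top_iff, ← N.span_Φ₁, Submodule.span_le]
    rintro _ ⟨⟨x, hx⟩, rfl⟩
    have hx' := hx
    rw [hNQ] at hx'
    obtain ⟨l, hl, z, hz, rfl⟩ := Submodule.mem_sup.1 hx'
    obtain ⟨hzQ, hz'⟩ := h2 z hz
    have : (⟨l + z, hx⟩ : N.Q) = ⟨l, hLQ hl⟩ + ⟨z, hzQ⟩ := rfl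
    rw [this, map_add, ← hΨL ⟨l, hl⟩]
    exact add_mem (Submodule.subset_span ⟨l, rfl⟩) hz'
  -- Generation holds after reduction and lifts by Nakayama, since `Ker α ⊆ Fil` lies in the
  -- Jacobson radical.
  have hspan : Submodule.span F.S (Set.range Ψ) = ⊤ := by
    rw [eq_top_iff]
    refine Submodule.le_of_le_smul_of_le_jacobson_bot (I := RingHom.ker α.toRingHom)
      Module.Finite.fg_top (hα.ker_le_fil.trans (le_sup_right.trans F.le_jacobson)) ?_
    intro x _
    have h1 : ∀ y ∈ Submodule.span G.S (Set.range Ψ'),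
        ∃ z ∈ Submodule.span F.S (Set.range Ψ), π z = y := by
      intro y hy
      induction hy using Submodule.span_induction with
      | mem y hy =>
        obtain ⟨w, rfl⟩ := hy
        obtain ⟨v, rfl⟩ := hπs w
        exact ⟨Ψ v, Submodule.subset_span ⟨v, rfl⟩, hΨ v⟩
      | zero => exact ⟨0, zero_mem _, map_zero _⟩
      | add a b _ _ ha hb =>
        obtain ⟨a', ha', rfl⟩ := ha
        obtain ⟨b', hb', rfl⟩ := hb
        exact ⟨a' + b', add_mem ha' hb', map_add _ _ _⟩
      | smul s a _ ha =>
        obtain ⟨a', ha', rfl⟩ := ha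
        obtain ⟨s, rfl⟩ := hα.surjective s
        exact ⟨s • a', Submodule.smul_mem _ _ ha', map_smulₛₗ _ _ _⟩
    obtain ⟨z, hz, hzx⟩ := h1 (π x) (by rw [hspan']; trivial)
    refine Submodule.mem_sup.2 ⟨z, hz, x - z, hker _ ?_, by simp⟩
    rw [map_sub, hzx, sub_self]
  refine ⟨normalWindow hα.p_mem_fil hα.σ₁_p.2 Ψ hspan, ?_⟩
  -- On `Fil T'` compatibility of `Φ₁` with reduction follows from `Φ₁ (a t) = σ₁ a • Φ t` on both
  -- sides and strictness of `α`; on `L'` it is the lifting property of `Ψ`.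
  have hπT : ∀ (t : T') (ht : t ∈ F.Fil • (⊤ : Submodule F.S T')), ∃ h : (πT t : N.P) ∈ N.Q,
      π (normalAux Ψ ⟨(0, t), prod_mk_mem_smul L' T' ht⟩) = N.Φ₁ ⟨πT t, h⟩ := by
    intro t ht
    induction ht using Submodule.smul_induction_on' with
    | smul a ha x _ =>
      have e1 : (πT (a • x) : N.P) = α.toRingHom a • (πT x : N.P) := by rw [map_smulₛₗ]; rfl
      have hQ := N.smul_mem_Q ⟨α.toRingHom a, α.map_fil a ha⟩ (πT x)
      refine ⟨e1 ▸ hQ, ?_⟩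
      have e2 : normalAux Ψ
          ⟨(0, a • x), prod_mk_mem_smul L' T' (Submodule.smul_mem_smul ha trivial)⟩
          = F.σ₁ ⟨a, ha⟩ • Ψ (0, x) := by
        rw [← normalAux_smul Ψ ⟨a, ha⟩ (0, x) (Submodule.smul_mem_smul ha trivial)]
        congr 1
        exact Subtype.ext (Prod.ext (by simp) (by simp))
      have e3 : (⟨(πT (a • x) : N.P), e1 ▸ hQ⟩ : N.Q) =
          ⟨α.toRingHom a • (πT x : N.P), hQ⟩ := Subtype.ext e1
      rw [e2, e3, N.Φ₁_smul ⟨α.toRingHom a, α.map_fil a ha⟩, map_smulₛₗ, hΨ, hπ, map_zero,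
        ZeroMemClass.coe_zero, zero_add, hΨT, hα.map_σ₁' a ha]
    | add x hx y hy h1 h2 =>
      obtain ⟨h1, h1'⟩ := h1
      obtain ⟨h2, h2'⟩ := h2
      have e1 : (πT (x + y) : N.P) = πT x + πT y := by rw [map_add]; rfl
      refine ⟨e1 ▸ add_mem h1 h2, ?_⟩
      have e2 : (⟨(πT (x + y) : N.P), e1 ▸ add_mem h1 h2⟩ : N.Q) = ⟨_, h1⟩ + ⟨_, h2⟩ :=
        Subtype.ext e1
      rw [e2, map_add, ← h1', ← h2', ← map_add, ← map_add]
      congr 2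
      exact Subtype.ext (Prod.ext (by simp) (by simp))
  have hQπ : ∀ x ∈ Submodule.prod (⊤ : Submodule F.S L') (F.Fil • (⊤ : Submodule F.S T')),
      π x ∈ N.Q := by
    rintro ⟨l, t⟩ h
    rw [hπ]
    exact add_mem (hLQ (πL l).2) (hπT t h.2).1
  refine hα.nonempty_iso_of_reduction (M := normalWindow hα.p_mem_fil hα.σ₁_p.2 Ψ hspan) π hπs hker
    hQπ ?_ ?_
  · intro y hy
    rw [hNQ] at hy
    obtain ⟨l, hl, z, hz, rfl⟩ := Submodule.mem_sup.1 hy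
    obtain ⟨l', hl'⟩ := hLs ⟨l, hl⟩
    have h1 : ∀ z ∈ G.Fil • T, ∃ t ∈ F.Fil • (⊤ : Submodule F.S T'), (πT t : N.P) = z := by
      intro z hz
      induction hz using Submodule.smul_induction_on' with
      | smul a ha x hx =>
        obtain ⟨b, hb, rfl⟩ := hα.exists_fil_of_mem ha
        obtain ⟨t, ht⟩ := hTs ⟨x, hx⟩
        refine ⟨b • t, Submodule.smul_mem_smul hb trivial, ?_⟩
        rw [map_smulₛₗ, ht]
        rfl
      | add x _ y _ hx hy =>
        obtain ⟨a, ha, rfl⟩ := hx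
        obtain ⟨b, hb, rfl⟩ := hy
        exact ⟨a + b, add_mem ha hb, by rw [map_add]; rfl⟩
    obtain ⟨t, ht, rfl⟩ := h1 z hz
    exact ⟨(l', t), ⟨trivial, ht⟩, (hπ l' t).trans (by rw [hl'])⟩
  · rintro ⟨l, t⟩ hx
    obtain ⟨h1, h2⟩ := hπT t hx.2
    change π (Ψ (l, 0) + normalAux Ψ ⟨(0, t), prod_mk_mem_smul L' T' hx.2⟩) = _
    rw [map_add, h2, hΨ, hπ, map_zero, ZeroMemClass.coe_zero, add_zero, hΨL, ← map_add]
    rfl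

theorem isCrystalline (hα : α.IsNilThickening) [Fact p.Prime] : α.IsCrystalline :=
  { faithful := hα.faithful
    full := hα.full
    essSurj := ⟨fun N => hα.exists_reduction_eq N⟩ }

end Frame.Hom.IsNilThickening

end Crystalline

open scoped Nat

/-! ### Comparison with the adic notions for ideals. -/

section Completeness

theorem PSeparated.of_isHausdorff {p : ℕ} {S : Type*} [CommRing S]
    [IsHausdorff (Ideal.span {(p : S)}) S] : PSeparated p S := by
  intro x hx
  refine IsHausdorff.haus' (I := Ideal.span {(p : S)}) x fun n => ?_
  rw [SModEq.zero, smul_eq_mul, Ideal.mul_top, ← mem_pPow_iff_mem_span]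
  exact hx n

theorem PComplete.of_isPrecomplete {p : ℕ} {S : Type*} [CommRing S]
    [IsPrecomplete (Ideal.span {(p : S)}) S] : PComplete p S := by
  intro f hf
  obtain ⟨L, hL⟩ := IsPrecomplete.prec' (I := Ideal.span {(p : S)}) f fun {m n} hmn => by
    rw [SModEq.sub_mem, smul_eq_mul, Ideal.mul_top, ← mem_pPow_iff_mem_span, ← neg_sub]
    exact neg_mem (sub_mem_of_step (fun j hj => pPow_anti hj (hf j)) hmn)
  refine ⟨L, fun n => ?_⟩
  have := hL n
  rw [SModEq.sub_mem, smul_eq_mul, Ideal.mul_top, ← mem_pPow_iff_mem_span] at this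
  rw [← neg_sub]
  exact neg_mem this

end Completeness

/-! ### Consequence of the iso-balanced hypothesis for powers of `J`. -/

section IsoBalanced

variable (p : ℕ) [hp : Fact p.Prime] {R : Type u} [CommRing R] [CharP R p]

/-- The `i`-th power of the inverse of the Frobenius of `R^♭`. -/
noncomputable abbrev frobRoot (i : ℕ) : Perfection R p →+* Perfection R p :=
  (((frobeniusEquiv (Perfection R p) p).symm ^ i : Perfection R p ≃+* Perfection R p) :
    Perfection R p →+* Perfection R p)

theorem frobRoot_pow (i : ℕ) (a : Perfection R p) : frobRoot p i a ^ p ^ i = a := by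
  induction i generalizing a with
  | zero => simp [frobRoot]
  | succ i ih =>
    have h1 : frobRoot p (i + 1) a = frobRoot p i ((frobeniusEquiv (Perfection R p) p).symm a) := by
      simp [frobRoot, pow_succ]
    rw [h1, pow_succ p i, pow_mul, ih]
    exact (frobeniusEquiv (Perfection R p) p).apply_symm_apply a

/-- If `R` is iso-balanced, then the powers `J ^ (p ^ i)` are contained in the images under `φ ^ i`
of an ideal that is mapped into `J` by a power of `φ`. -/
theorem IsIsoBalanced.exists_pow_mem (hb : IsIsoBalanced p R) : ∃ n : ℕ, ∀ (i : ℕ),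
    ∀ a ∈ idealJ p R ^ p ^ i, frobRoot p i a ^ p ^ n ∈ idealJ p R := by
  obtain ⟨R', _, _, -, hbal, f, -, n, hn⟩ := hb
  let g : Perfection R p →+* R' := f.comp (Perfection.coeff R p 0)
  let J' : Ideal (Perfection R p) := RingHom.ker g
  let K : Ideal (Perfection R p) := J'.comap (frobenius (Perfection R p) p)
  -- The image of `K` in `R'` lies in the kernel of Frobenius, whose `p`-th power vanishes because
  -- `R'` is balanced.
  have hK : K ^ p ≤ J' := by
    have h1 : K.map g ≤ RingHom.ker (frobenius R' p) := by
      rw [Ideal.map_le_iff_le_comap]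
      intro x hx
      have h2 : g (x ^ p) = 0 := hx
      rw [Ideal.mem_comap, RingHom.mem_ker, frobenius_def, ← map_pow, h2]
    have h3 : (K ^ p).map g ≤ ⊥ := by
      rw [Ideal.map_pow, ← hbal]
      exact Ideal.pow_right_mono h1 p
    intro x hx
    exact h3 (Ideal.mem_map_of_mem g hx)
  have hstep : (J' ^ p).map (frobRoot p 1) ≤ J' := by
    rw [Ideal.map_pow]
    refine le_trans (Ideal.pow_right_mono ?_ p) hK
    rw [Ideal.map_le_iff_le_comap]
    intro x hx
    have h1 := frobRoot_pow p 1 x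
    rw [pow_one] at h1
    rw [Ideal.mem_comap, Ideal.mem_comap, frobenius_def, h1]
    exact hx
  -- Balancedness gives `φ⁻¹ (J' ^ p) ⊆ J'`, and this iterates because taking `φ⁻ⁱ` commutes with
  -- powers of ideals.
  have hmain : ∀ i, (J' ^ p ^ i).map (frobRoot p i) ≤ J' := by
    intro i
    induction i with
    | zero =>
      rw [pow_zero, pow_one, Ideal.map_le_iff_le_comap]
      intro x hx
      simpa [frobRoot] using hx
    | succ i ih =>
      have h1 : frobRoot p (i + 1) = (frobRoot p 1).comp (frobRoot (R := R) p i) := by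
        ext1 x
        simp [frobRoot, pow_succ']
      rw [h1, ← Ideal.map_map, pow_succ, pow_mul, Ideal.map_pow]
      exact le_trans (Ideal.map_mono (Ideal.pow_right_mono ih p)) hstep
  have hJ : idealJ p R ≤ J' := fun x hx => by
    change f (Perfection.coeff R p 0 x) = 0
    rw [(RingHom.mem_ker).1 hx, map_zero]
  refine ⟨n, fun i a ha => ?_⟩
  have h1 : frobRoot p i a ∈ J' :=
    hmain i (Ideal.mem_map_of_mem _ (Ideal.pow_right_mono hJ _ ha))
  -- The kernel of the isogeny is killed by `φ ^ n`, so `φ ^ n` maps `J'` into `J`. The same `n`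
  -- serves all `i`.
  have h2 := hn (Perfection.coeff R p 0 (frobRoot p i a)) h1
  rw [iterate_frobenius] at h2
  rw [RingHom.mem_ker, map_pow, h2]

end IsoBalanced

/-! ### Divided powers of Teichmüller elements in `A_cris(R)`. -/

section AcrisElements

variable {p : ℕ} [hp : Fact p.Prime] {R : Type u} [CommRing R] [CharP R p]

open PDEnvelope

/-- Frobenius sends `[a]` to `[a] ^ p` exactly, so `τ [a]` reduces to `(p - 1)! [a]^{[p]}`. -/
theorem delta_teichmuller (a : Perfection R p) :
    delta (WittVector.teichmuller p a : Ainf p R) = 0 := by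
  apply W_p_mul_cancel
  have h := delta_spec (WittVector.teichmuller p a : Ainf p R)
  rw [WittVector.frobenius_eq_map_frobenius, WittVector.map_teichmuller, frobenius_def,
    map_pow] at h
  rw [mul_zero]
  exact left_eq_add.1 h

/-- The element `[a]` of `Ker(W(R^♭) → R)` for `a` in `J`. -/
noncomputable def teichElt (a : idealJ p R) : kerTheta p R :=
  ⟨WittVector.teichmuller p (a : Perfection R p), by
    rw [RingHom.mem_ker, theta_apply, WittVector.teichmuller_coeff_zero]
    exact a.2⟩

/-- The factors `p, 2 p, …, n p` of `(p n)!` already multiply to the left-hand side. -/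
theorem pow_mul_factorial_dvd (n : ℕ) : p ^ n * n ! ∣ (p * n)! := by
  induction n with
  | zero => simp
  | succ n ih =>
    have h1 : (p * (n + 1))! = p * (n + 1) * (p * (n + 1) - 1)! :=
      (Nat.mul_factorial_pred (mul_ne_zero hp.out.ne_zero n.succ_ne_zero)).symm
    have h2 : p * n ≤ p * (n + 1) - 1 := by
      have := hp.out.pos
      rw [mul_add_one]
      omega
    have h3 : p ^ (n + 1) * (n + 1)! = p * (n + 1) * (p ^ n * n !) := by
      rw [Nat.factorial_succ]; ring
    rw [h1, h3]
    exact Nat.mul_dvd_mul_left _ (ih.trans (Nat.factorial_dvd_factorial h2))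

/-- With `N = n + 1`, the coefficient `(p N)! / (p · N!)` in `σ₁ [a]^{[N]}` is divisible by `p ^ (N
- 1)`. The gain is trivial for `N = 1` and at least one factor `p` for `N ≥ 2`. -/
theorem sigmaOne_gamma_teichElt (n : ℕ) (a : idealJ p R) : ∃ c : PDEnvelope p R,
    PDEnvelope.sigmaOne p R ⟨gamma p (n + 1) (teichElt a), gamma_mem p n _⟩ =
      p ^ n * c * gamma p (p * (n + 1)) (teichElt a) := by
  obtain ⟨N, h1, h2⟩ := gamma_pow p p (n + 1) (teichElt a)
  obtain ⟨q, hq⟩ := pow_mul_factorial_dvd (p := p) (n + 1)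
  refine ⟨q, ?_⟩
  have h3 : delta ((teichElt a : kerTheta p R) : Ainf p R) = 0 := delta_teichmuller _
  rw [sigmaOne_gamma, tau, h3, map_zero, add_zero, mul_pow, h1]
  have h4 : (coef n : Ainf p R) * ((p - 1)! : Ainf p R) ^ (n + 1) * N = p ^ n * q := by
    apply W_natCast_mul_cancel (Nat.factorial_ne_zero (n + 1))
    apply W_natCast_mul_cancel (pow_ne_zero (n + 1) hp.out.ne_zero)
    have h5 := coef_spec (p := p) (k := Perfection R p) n
    have h6 := h2.trans hq
    rw [← Nat.mul_factorial_pred hp.out.ne_zero] at h6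
    have h7 := congrArg (fun z : ℕ => (z : Ainf p R)) h6
    push_cast at h7 ⊢
    rw [mul_pow] at h7
    linear_combination (p : Ainf p R) ^ (n + 1) * ((p - 1)! : Ainf p R) ^ (n + 1) * N * h5 +
      (p : Ainf p R) ^ n * h7
  have h8 := congrArg (iota p R) h4
  simp only [map_mul, map_pow, map_natCast] at h8
  linear_combination gamma p (p * (n + 1)) (teichElt a) * h8

/-- Modulo the divided powers of the elements `[a]` with `a` in `J`, every element of `D` comes from
`W(R^♭)`. -/
theorem exists_sub_iota_mem (d : PDEnvelope p R) : ∃ a : Ainf p R, d - iota p R a ∈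
    Ideal.span {z | ∃ (n : ℕ) (x : idealJ p R), z = gamma p (n + 1) (teichElt x)} := by
  set K : Ideal (PDEnvelope p R) :=
    Ideal.span {z | ∃ (n : ℕ) (x : idealJ p R), z = gamma p (n + 1) (teichElt x)} with hK
  have hγ : ∀ n (x : kerTheta p R), ∃ a : Ainf p R, gamma p n x - iota p R a ∈ K := by
    intro n x
    obtain ⟨w, hw⟩ := exists_p_mul p x
    let a : idealJ p R := ⟨_, coeff_zero_mem p x⟩
    -- In the expansion of `([a] + w p)^{[n]}` every term with a positive divided power of `[a]`
    -- lies in `K`. What remains is `w ^ n p ^ n / n!`, which comes from `W(R^♭)`.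
    have h1 : x = teichElt a + w • pElt p R := by
      ext1
      change (x : Ainf p R) = WittVector.teichmuller p ((x : Ainf p R).coeff 0) + w * (p : Ainf p R)
      rw [mul_comm w]
      exact hw
    obtain ⟨c, hc⟩ := exists_c (R := R) p n
    refine ⟨w ^ n * c, ?_⟩
    rw [h1, gamma_add, Finset.Nat.sum_antidiagonal_eq_sum_range_succ_mk, Finset.sum_range_succ']
    simp only [gamma_zero, one_mul, Nat.sub_zero]
    rw [gamma_smul p n, gamma_p p hc, map_mul, map_pow, add_sub_cancel_right]
    exact sum_mem fun i _ => Ideal.mul_mem_right _ _ (Ideal.subset_span ⟨i, a, rfl⟩)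
  induction d using PDEnvelope.induction p with
  | h1 a => exact ⟨a, by simp⟩
  | h2 x y hx hy =>
    obtain ⟨a, ha⟩ := hx
    obtain ⟨b, hb⟩ := hy
    refine ⟨a + b, ?_⟩
    rw [map_add, add_sub_add_comm]
    exact add_mem ha hb
  | h3 d n x hd =>
    obtain ⟨a, ha⟩ := hd
    obtain ⟨b, hb⟩ := hγ n x
    refine ⟨a * b, ?_⟩
    have h1 : d * gamma p n x - iota p R (a * b) = (d - iota p R a) * gamma p n x +
        iota p R a * (gamma p n x - iota p R b) := by rw [map_mul]; ring
    rw [h1]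
    exact add_mem (Ideal.mul_mem_right _ _ ha) (Ideal.mul_mem_left _ _ hb)

variable (p R) in
/-- The natural map `D → A_cris(R)`. -/
noncomputable abbrev ofD : PDEnvelope p R →+* Acris p R := algebraMap _ _

theorem rep_ofD (n : ℕ) (d : PDEnvelope p R) : Acris.Rep p n (ofD p R d) d :=
  AlgHom.commutes (AdicCompletion.evalₐ (pD p R) n) d

/-- For a finitely generated ideal, the kernel of the projection from the completion to level `n` is
`p ^ n` times the completion. -/
theorem sub_ofD_mem {n : ℕ} {x : Acris p R} {d : PDEnvelope p R} (h : Acris.Rep p n x d) :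
    x - ofD p R d ∈ pPow p (Acris p R) n := by
  have h1 : AdicCompletion.evalₐ (pD p R) n (x - ofD p R d) = 0 := by
    rw [map_sub, sub_eq_zero]
    exact Eq.trans h (Eq.symm (rep_ofD n d))
  have h2 : x - ofD p R d ∈ (AdicCompletion.eval (pD p R) (PDEnvelope p R) n).ker := by
    rw [LinearMap.mem_ker, ← AdicCompletion.factor_evalₐ_eq_eval _ _ (Ideal.mul_top _).ge, h1,
      map_zero]
  rw [← AdicCompletion.pow_smul_top_eq_ker_eval Acris.pD_fg] at h2
  exact mem_pPow_of_mem_smul (fun a ha => mem_pPow_iff_mem_span.2 ha) h2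

theorem kappa_ofD (d : PDEnvelope p R) : kappaRingHom p R (ofD p R d) = kappaD p R d :=
  AJ_ext p fun n => kappa_sub_mem p (rep_ofD n d)

theorem acris_sigma_ofD (d : PDEnvelope p R) :
    Acris.sigma p R (ofD p R d) = ofD p R (PDEnvelope.sigma p R d) :=
  Acris.ext_rep p fun n => ⟨_, (rep_ofD n d).sigma, rep_ofD n _⟩

theorem toR_ofD (d : PDEnvelope p R) : Acris.toR p R (ofD p R d) = PDEnvelope.toR p R d :=
  (rep_ofD 1 d).toR_one

theorem acris_sigmaOne_ofD (d : PDEnvelope p R) (hd : d ∈ RingHom.ker (PDEnvelope.toR p R))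
    (h : ofD p R d ∈ RingHom.ker (Acris.toR p R)) :
    Acris.sigmaOne p R ⟨ofD p R d, h⟩ = ofD p R (PDEnvelope.sigmaOne p R ⟨d, hd⟩) :=
  Acris.ext_rep p fun n =>
    ⟨_, Acris.Rep.sigmaOne' (x := ⟨ofD p R d, h⟩) (rep_ofD (n + 1) d), rep_ofD n _⟩

/-- The image of `[a]` in `A(J_*)` is zero, and the divided powers of `p y` depend only on `p y`, so
they may be computed with `y = 0`. -/
theorem kappaD_gamma_teichElt (n : ℕ) (a : idealJ p R) :
    kappaD p R (gamma p (n + 1) (teichElt a)) = 0 := by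
  have h : (p : AJ p R) * divP p (teichElt a) = p * 0 := by
    rw [p_mul_divP, mul_zero]
    exact Ideal.Quotient.eq_zero_iff_mem.2 (teichmuller_mem_wittIdeal a.2)
  rw [kappaD_gamma, mul_left_comm, mul_pow_eq h, zero_pow n.succ_ne_zero, mul_zero, mul_zero]

instance : IsAdicComplete (Ideal.span {(p : Acris p R)}) (Acris p R) := by
  rw [← Acris.map_pD, IsAdicComplete.map_algebraMap_iff]
  exact AdicCompletion.isAdicComplete Acris.pD_fg

end AcrisElements

/-! ### Topological nilpotence of `σ₁` on the kernel of `ϰ`. -/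

section KernelOfKappa

variable {p : ℕ} [hp : Fact p.Prime] {R : Type u} [CommRing R] [CharP R p]

open PDEnvelope

variable (p R) in
/-- The ideal of `A_cris(R)` generated by the elements `[a]^{[n]}` with `a` in `J` and `n ≥ 1`. -/
noncomputable def teichIdeal : Ideal (Acris p R) :=
  Ideal.span {z | ∃ (n : ℕ) (x : idealJ p R), z = ofD p R (gamma p (n + 1) (teichElt x))}

variable (p R) in
/-- The ideal of `A_cris(R)` generated by the elements `p ^ j [a]^{[n]}` with `a` in `J` and
`n ≥ 2`. -/
noncomputable def teichIdealPow (j : ℕ) : Ideal (Acris p R) :=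
  Ideal.span {z | ∃ (n : ℕ) (x : idealJ p R),
    z = (p : Acris p R) ^ j * ofD p R (gamma p (n + 2) (teichElt x))}

theorem teichIdealPow_le (j : ℕ) : teichIdealPow p R j ≤ Ideal.span {(p : Acris p R)} ^ j := by
  rw [teichIdealPow, Ideal.span_le]
  rintro _ ⟨n, x, rfl⟩
  rw [SetLike.mem_coe, Ideal.span_singleton_pow, Ideal.mem_span_singleton]
  exact dvd_mul_right _ _

theorem teichIdeal_le_ker_kappa : teichIdeal p R ≤ RingHom.ker (kappaRingHom p R) := by
  rw [teichIdeal, Ideal.span_le]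
  rintro _ ⟨n, x, rfl⟩
  rw [SetLike.mem_coe, RingHom.mem_ker, kappa_ofD, kappaD_gamma_teichElt]

theorem teichIdeal_le_ker_toR : teichIdeal p R ≤ RingHom.ker (Acris.toR p R) := by
  rw [teichIdeal, Ideal.span_le]
  rintro _ ⟨n, x, rfl⟩
  rw [SetLike.mem_coe, RingHom.mem_ker, toR_ofD]
  exact gamma_mem p n _

/-- Up to the divided powers of the elements `[a]`, every element of `A_cris(R)` comes from
`W(R^♭)` modulo `p ^ k`. -/
theorem exists_sub_ofD_iota_mem (k : ℕ) (x : Acris p R) : ∃ a : Ainf p R, ∃ e ∈ teichIdeal p R,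
    x - ofD p R (iota p R a) - e ∈ pPow p (Acris p R) k := by
  obtain ⟨d, hd⟩ := Acris.exists_rep p k x
  obtain ⟨a, ha⟩ := exists_sub_iota_mem d
  refine ⟨a, ofD p R (d - iota p R a), ?_, ?_⟩
  · have h := Ideal.mem_map_of_mem (ofD p R) ha
    rw [Ideal.map_span] at h
    refine Ideal.span_mono ?_ h
    rintro _ ⟨_, ⟨n, y, rfl⟩, rfl⟩
    exact ⟨n, y, rfl⟩
  · rw [map_sub, sub_sub, add_sub_cancel]
    exact sub_ofD_mem hd

theorem toR_eq_zero_of_mem_pPow {x : Acris p R} (hx : x ∈ pPow p (Acris p R) 1) :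
    Acris.toR p R x = 0 := by
  obtain ⟨y, rfl⟩ := mem_pPow.1 hx
  rw [pow_one, nsmul_eq_mul, map_mul, map_natCast, CharP.cast_eq_zero, zero_mul]

/-- Modulo `p`, the ring `A(J_*)` becomes `R^♭ / J`. So if the image of `a` in `A(J_*)` is divisible
by `p`, its zeroth Witt component lies in `J`, and `a` maps to zero in `R`. -/
theorem mem_ker_toR_of_kappa_mem {x : Acris p R}
    (hx : kappaRingHom p R x ∈ Ideal.span {(p : AJ p R)}) : x ∈ RingHom.ker (Acris.toR p R) := by
  obtain ⟨a, e, he, h⟩ := exists_sub_ofD_iota_mem 1 x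
  have h1 : Acris.toR p R x = theta p R a := by
    have h2 := toR_eq_zero_of_mem_pPow h
    rwa [map_sub, map_sub, toR_ofD, toR_iota, (RingHom.mem_ker).1 (teichIdeal_le_ker_toR he),
      sub_zero, sub_eq_zero] at h2
  have h3 : AJ.mk p R a ∈ Ideal.span {(p : AJ p R)} := by
    have h4 := map_mem_pPow (kappaRingHom p R).toAddMonoidHom h
    rw [mem_pPow_iff_mem_span, pow_one] at h4
    change kappaRingHom p R (x - ofD p R (iota p R a) - e) ∈ _ at h4
    rw [map_sub, map_sub, kappa_ofD, kappaD_iota,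
      (RingHom.mem_ker).1 (teichIdeal_le_ker_kappa he), sub_zero] at h4
    have h5 := sub_mem hx h4
    rwa [sub_sub_cancel] at h5
  rw [← AJ.map_span_p] at h3
  obtain ⟨b, hb, hab⟩ := (Ideal.mem_map_iff_of_surjective _ Ideal.Quotient.mk_surjective).1 h3
  have h6 : b.coeff 0 = 0 := (WittVector.mem_span_p_iff_coeff_zero_eq_zero b).1 hb
  have h7 := Ideal.Quotient.eq.1 hab 0
  have h8 : ∀ y : Ainf p R, y.coeff 0 = WittVector.constantCoeff y := fun _ => rfl
  rw [pow_zero, pow_one, h8, map_sub, ← h8, ← h8, h6, zero_sub, neg_mem_iff] at h7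
  rw [RingHom.mem_ker, h1, theta_apply]
  exact h7

theorem ker_kappa_le_ker_toR :
    RingHom.ker (kappaRingHom p R) ≤ RingHom.ker (Acris.toR p R) := fun x hx =>
  mem_ker_toR_of_kappa_mem (by rw [(RingHom.mem_ker).1 hx]; exact zero_mem _)

variable (p R) in
/-- The restriction of `σ₁` to the kernel of `ϰ`. -/
noncomputable def kerSigmaOne : AddMonoid.End (RingHom.ker (kappaRingHom p R)) where
  toFun x := ⟨Acris.sigmaOne p R ⟨x, ker_kappa_le_ker_toR x.2⟩, by
    rw [RingHom.mem_ker, ← sigmaOne_kappa, AJ.sigmaOne_apply p (y := 0), map_zero]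
    rw [mul_zero]
    exact x.2⟩
  map_zero' := Subtype.ext (Acris.sigmaOne p R).map_zero
  map_add' x y := Subtype.ext ((Acris.sigmaOne p R).map_add
    ⟨x, ker_kappa_le_ker_toR x.2⟩ ⟨y, ker_kappa_le_ker_toR y.2⟩)

theorem coe_kerSigmaOne (x : RingHom.ker (kappaRingHom p R)) : (kerSigmaOne p R x : Acris p R) =
    Acris.sigmaOne p R ⟨x, ker_kappa_le_ker_toR x.2⟩ := rfl

theorem acris_sigmaOne_mul (a : Acris p R) {x : Acris p R} (hx : x ∈ RingHom.ker (Acris.toR p R))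
    (h : a * x ∈ RingHom.ker (Acris.toR p R)) : Acris.sigmaOne p R ⟨a * x, h⟩ =
      Acris.sigma p R a * Acris.sigmaOne p R ⟨x, hx⟩ :=
  (Acris.sigmaOne p R).map_smulₛₗ a ⟨x, hx⟩

/-- Since `σ₁ p = 1`, each application of `σ₁` trades one factor `p` for one application of `σ`. The
cofactor `y` itself need not lie in the kernel. -/
theorem kerSigmaOne_pow_of_eq_mul (m : ℕ) {x : RingHom.ker (kappaRingHom p R)} {y : Acris p R}
    (h : (x : Acris p R) = p ^ m * y) :
    ((kerSigmaOne p R ^ m) x : Acris p R) = (Acris.sigma p R)^[m] y := by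
  induction m generalizing x y with
  | zero => simpa using h
  | succ m ih =>
    rw [pow_succ, AddMonoid.End.coe_mul, Function.comp_apply, Function.iterate_succ_apply]
    refine ih ?_
    have h1 : (x : Acris p R) = p ^ m * y * p := by rw [h]; ring
    have h2 := ker_kappa_le_ker_toR x.2
    rw [coe_kerSigmaOne]
    simp only [h1] at h2 ⊢
    rw [acris_sigmaOne_mul _ Acris.p_mem, Acris.sigmaOne_p, mul_one, map_mul, map_pow, map_natCast]

theorem kerSigmaOne_pow_mem_pPow {k m : ℕ} {x : RingHom.ker (kappaRingHom p R)}
    (h : (x : Acris p R) ∈ pPow p (Acris p R) (m + k)) :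
    ((kerSigmaOne p R ^ m) x : Acris p R) ∈ pPow p (Acris p R) k := by
  obtain ⟨y, hy⟩ := mem_pPow.1 h
  rw [nsmul_eq_mul, Nat.cast_pow, pow_add, mul_assoc] at hy
  rw [kerSigmaOne_pow_of_eq_mul m hy.symm, ← RingHom.coe_pow, map_mul, map_pow, map_natCast,
    mem_pPow]
  exact ⟨_, by rw [nsmul_eq_mul, Nat.cast_pow]⟩

theorem sigmaOne_mem_of_mem_span {X : Set (Acris p R)} {I : Ideal (Acris p R)}
    (hX : ∀ x ∈ X, ∃ h, Acris.sigmaOne p R ⟨x, h⟩ ∈ I) {z : Acris p R} (hz : z ∈ Ideal.span X) :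
    ∃ h, Acris.sigmaOne p R ⟨z, h⟩ ∈ I := by
  induction hz using Submodule.span_induction with
  | mem x hx => exact hX x hx
  | zero => exact ⟨zero_mem _, by
      have h := map_zero (Acris.sigmaOne p R)
      exact h.symm ▸ zero_mem I⟩
  | add x y _ _ h1 h2 =>
    obtain ⟨h1, h1'⟩ := h1
    obtain ⟨h2, h2'⟩ := h2
    refine ⟨add_mem h1 h2, ?_⟩
    have h := map_add (Acris.sigmaOne p R) ⟨x, h1⟩ ⟨y, h2⟩
    exact h.symm ▸ add_mem h1' h2'
  | smul a x _ h1 =>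
    obtain ⟨h1, h1'⟩ := h1
    refine ⟨Ideal.mul_mem_left _ a h1, ?_⟩
    have h := acris_sigmaOne_mul a h1 (Ideal.mul_mem_left _ a h1)
    exact h.symm ▸ Ideal.mul_mem_left _ _ h1'

theorem sigmaOne_ofD_gamma_teichElt (n : ℕ) (a : idealJ p R) : ∃ (c : Acris p R)
    (h : ofD p R (gamma p (n + 1) (teichElt a)) ∈ RingHom.ker (Acris.toR p R)),
    Acris.sigmaOne p R ⟨_, h⟩ = p ^ n * c * ofD p R (gamma p (p * (n + 1)) (teichElt a)) := by
  obtain ⟨c, hc⟩ := sigmaOne_gamma_teichElt n a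
  refine ⟨ofD p R c, teichIdeal_le_ker_toR (Ideal.subset_span ⟨n, a, rfl⟩), ?_⟩
  rw [acris_sigmaOne_ofD _ (gamma_mem p n _), hc, map_mul, map_mul, map_pow, map_natCast]

theorem exists_mul_succ_eq (n : ℕ) : ∃ n' : ℕ, p * (n + 1) = n' + 2 := by
  have h : 2 * 1 ≤ p * (n + 1) := Nat.mul_le_mul hp.out.two_le n.succ_pos
  exact ⟨p * (n + 1) - 2, by omega⟩

/-- The first application of `σ₁` may gain no factor `p`, but it raises the divided power from `n ≥
1` to `p n ≥ 2`. -/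
theorem kerSigmaOne_mem_teichIdealPow_zero {x : RingHom.ker (kappaRingHom p R)}
    (hx : (x : Acris p R) ∈ teichIdeal p R) :
    (kerSigmaOne p R x : Acris p R) ∈ teichIdealPow p R 0 := by
  refine (sigmaOne_mem_of_mem_span ?_ hx).2
  rintro _ ⟨n, a, rfl⟩
  obtain ⟨c, h, hc⟩ := sigmaOne_ofD_gamma_teichElt n a
  obtain ⟨n', hn'⟩ := exists_mul_succ_eq (p := p) n
  refine ⟨h, ?_⟩
  rw [hc, hn']
  exact Ideal.mul_mem_left _ _ (Ideal.subset_span ⟨n', a, by rw [pow_zero, one_mul]⟩)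

/-- Once the divided power index is at least `2`, each application of `σ₁` gains a factor `p` and
keeps the index at least `2`. -/
theorem kerSigmaOne_mem_teichIdealPow {j : ℕ} {x : RingHom.ker (kappaRingHom p R)}
    (hx : (x : Acris p R) ∈ teichIdealPow p R j) :
    (kerSigmaOne p R x : Acris p R) ∈ teichIdealPow p R (j + 1) := by
  refine (sigmaOne_mem_of_mem_span ?_ hx).2
  rintro _ ⟨n, a, rfl⟩
  obtain ⟨c, h, hc⟩ := sigmaOne_ofD_gamma_teichElt (n + 1) a
  obtain ⟨n', hn'⟩ := exists_mul_succ_eq (p := p) (n + 1)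
  refine ⟨Ideal.mul_mem_left _ _ h, ?_⟩
  rw [acris_sigmaOne_mul _ h, hc, hn', map_pow, map_natCast]
  have h1 : (p : Acris p R) ^ j * (p ^ (n + 1) * c * ofD p R (gamma p (n' + 2) (teichElt a))) =
      p ^ n * c * (p ^ (j + 1) * ofD p R (gamma p (n' + 2) (teichElt a))) := by ring
  rw [h1]
  exact Ideal.mul_mem_left _ _ (Ideal.subset_span ⟨n', a, rfl⟩)

theorem kerSigmaOne_pow_mem_teichIdealPow (t : ℕ) {j : ℕ} {x : RingHom.ker (kappaRingHom p R)}
    (hx : (x : Acris p R) ∈ teichIdealPow p R j) :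
    ((kerSigmaOne p R ^ t) x : Acris p R) ∈ teichIdealPow p R (j + t) := by
  induction t with
  | zero => simpa using hx
  | succ t ih =>
    rw [pow_succ', AddMonoid.End.coe_mul, Function.comp_apply]
    exact kerSigmaOne_mem_teichIdealPow ih

theorem kerSigmaOne_pow_succ_mem {t : ℕ} {x : RingHom.ker (kappaRingHom p R)}
    (hx : (x : Acris p R) ∈ teichIdeal p R) :
    ((kerSigmaOne p R ^ (t + 1)) x : Acris p R) ∈ pPow p (Acris p R) t := by
  rw [pow_succ, AddMonoid.End.coe_mul, Function.comp_apply, mem_pPow_iff_mem_span]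
  have h := kerSigmaOne_pow_mem_teichIdealPow t (kerSigmaOne_mem_teichIdealPow_zero hx)
  rw [zero_add] at h
  exact teichIdealPow_le t h

theorem iterate_sigma_teichmuller (m : ℕ) (b : Perfection R p) :
    (Acris.sigma p R)^[m] (ofD p R (iota p R (WittVector.teichmuller p b))) =
      ofD p R (iota p R (WittVector.teichmuller p (b ^ p ^ m))) := by
  induction m generalizing b with
  | zero => simp
  | succ m ih =>
    rw [Function.iterate_succ_apply, acris_sigma_ofD, sigma_iota,
      WittVector.frobenius_eq_map_frobenius, WittVector.map_teichmuller, frobenius_def, ih,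
      ← pow_mul, ← pow_succ']

/-- Here `[c] ^ (p ^ j) = (p ^ j)! [c]^{[p ^ j]}`, and `p ^ j` divides `(p ^ j)!`. The condition `j
≠ 0` ensures that the divided power index is at least `2`. -/
theorem teichmuller_pow_mem_teichIdealPow {j : ℕ} (hj : j ≠ 0) {c : Perfection R p}
    (hc : c ∈ idealJ p R) :
    ofD p R (iota p R (WittVector.teichmuller p (c ^ p ^ j))) ∈ teichIdealPow p R j := by
  have h1 : 2 ≤ p ^ j := hp.out.two_le.trans (Nat.le_self_pow hj p)
  obtain ⟨n, hn⟩ := Nat.exists_eq_add_of_le' h1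
  obtain ⟨r, hr⟩ : p ^ j ∣ (p ^ j)! := Nat.dvd_factorial (by omega) le_rfl
  have h2 := factorial_mul_gamma p (p ^ j) (teichElt ⟨c, hc⟩)
  have h3 : iota p R (WittVector.teichmuller p (c ^ p ^ j)) =
      iota p R ((teichElt ⟨c, hc⟩ : kerTheta p R) : Ainf p R) ^ p ^ j := by
    rw [map_pow, map_pow]; rfl
  rw [h3, ← h2, hr, map_mul, map_natCast, Nat.cast_mul, Nat.cast_pow, mul_comm _ (r : Acris p R),
    mul_assoc, hn]
  exact Ideal.mul_mem_left _ _ (Ideal.subset_span ⟨n, _, rfl⟩)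

theorem kappa_surjective : Function.Surjective (kappaRingHom p R) := by
  intro y
  obtain ⟨a, rfl⟩ := Ideal.Quotient.mk_surjective y
  exact ⟨ofD p R (iota p R a), by rw [kappa_ofD, kappaD_iota]⟩

/-- The element `p ^ i [a ^ (p ^ -i)]` of `W(R^♭)`. -/
noncomputable def teichTerm (i : ℕ) (a : Perfection R p) : Ainf p R :=
  WittVector.teichmuller p (frobRoot p i a) * (p : Ainf p R) ^ i

/-- As a Witt vector, `p ^ i [a ^ (p ^ -i)]` has `a` in position `i` and zeros elsewhere. -/
theorem teichTerm_mem {i : ℕ} {a : Perfection R p} (ha : a ∈ idealJ p R ^ p ^ i) :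
    teichTerm i a ∈ wittJ p R := by
  intro j
  by_cases h : j = i
  · subst h
    rw [teichTerm, WittVector.teichmuller_mul_pow_coeff, frobRoot_pow]
    exact ha
  · rw [teichTerm, WittVector.teichmuller_mul_pow_coeff_of_ne _ h]
    exact zero_mem _

theorem ofD_iota_mem_ker_kappa {w : Ainf p R} (hw : w ∈ wittJ p R) :
    ofD p R (iota p R w) ∈ RingHom.ker (kappaRingHom p R) := by
  rw [RingHom.mem_ker, kappa_ofD, kappaD_iota]
  exact Ideal.Quotient.eq_zero_iff_mem.2 hw

theorem sub_sum_teichTerm_mem (k : ℕ) (w : Ainf p R) :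
    (p : Ainf p R) ^ k ∣ w - ∑ i ∈ Finset.range k, teichTerm i (w.coeff i) := by
  cases k with
  | zero => rw [pow_zero]; exact one_dvd _
  | succ k =>
    have h := WittVector.dvd_sub_sum_teichmuller_iterateFrobeniusEquiv_coeff w k
    have h1 : Finset.Iic k = Finset.range (k + 1) := by
      ext i
      rw [Finset.mem_Iic, Finset.mem_range, Nat.lt_succ_iff]
    rw [h1] at h
    exact h

/-- The elements of the kernel of `ϰ` are generated by the images of `W(J_*)` and by the divided
powers `[a]^{[n]}`, modulo `p ^ k`. -/
theorem exists_teichTerm_decomposition (k : ℕ) {x : Acris p R}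
    (hx : x ∈ RingHom.ker (kappaRingHom p R)) : ∃ w ∈ wittJ p R, ∃ e ∈ teichIdeal p R,
    x - ∑ i ∈ Finset.range k, ofD p R (iota p R (teichTerm i (w.coeff i))) - e ∈
      pPow p (Acris p R) k := by
  obtain ⟨a, e, he, h⟩ := exists_sub_ofD_iota_mem k x
  have h1 : AJ.mk p R a ∈ Ideal.span {(p : AJ p R)} ^ k := by
    have h2 := map_mem_pPow (kappaRingHom p R).toAddMonoidHom h
    rw [mem_pPow_iff_mem_span] at h2
    change kappaRingHom p R (x - ofD p R (iota p R a) - e) ∈ _ at h2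
    rwa [map_sub, map_sub, kappa_ofD, kappaD_iota, (RingHom.mem_ker).1 hx,
      (RingHom.mem_ker).1 (teichIdeal_le_ker_kappa he), sub_zero, zero_sub, neg_mem_iff] at h2
  rw [Ideal.span_singleton_pow, Ideal.mem_span_singleton] at h1
  obtain ⟨y, hy⟩ := h1
  obtain ⟨b, rfl⟩ := Ideal.Quotient.mk_surjective y
  -- The element `a` vanishes in `A(J_*)` only modulo `p ^ k`. Subtracting a multiple of `p ^ k`
  -- puts it into `W(J_*)`, where the Teichmüller expansion has components in `J ^ (p ^ i)`.
  have hw : a - (p : Ainf p R) ^ k * b ∈ wittJ p R := by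
    rw [← Ideal.Quotient.eq, hy, map_mul, map_pow, map_natCast]
  refine ⟨_, hw, e, he, ?_⟩
  obtain ⟨c, hc⟩ := sub_sum_teichTerm_mem k (a - (p : Ainf p R) ^ k * b)
  have h3 : ∑ i ∈ Finset.range k, teichTerm i ((a - (p : Ainf p R) ^ k * b).coeff i) =
      a - (p : Ainf p R) ^ k * (b + c) := by
    rw [mul_add, ← hc]; ring
  rw [← map_sum, ← map_sum, h3, map_sub, map_sub, map_mul, map_mul, map_pow, map_pow, map_natCast,
    map_natCast]
  have h4 := add_mem h (smul_mem_pPow k (ofD p R (iota p R (b + c))) : _ ∈ pPow p (Acris p R) k)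
  rw [nsmul_eq_mul, Nat.cast_pow] at h4
  convert h4 using 1
  ring

theorem kerSigmaOne_pow_teichTerm {q i : ℕ} (hq : q ≤ i) {a : Perfection R p}
    (ha : a ∈ idealJ p R ^ p ^ i) :
    ((kerSigmaOne p R ^ q) ⟨_, ofD_iota_mem_ker_kappa (teichTerm_mem ha)⟩ : Acris p R) =
      p ^ (i - q) * ofD p R (iota p R (WittVector.teichmuller p (frobRoot p i a ^ p ^ q))) := by
  have h1 : ofD p R (iota p R (teichTerm i a)) = (p : Acris p R) ^ q * (p ^ (i - q) *
      ofD p R (iota p R (WittVector.teichmuller p (frobRoot p i a)))) := by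
    rw [← mul_assoc, ← pow_add, Nat.add_sub_cancel' hq, teichTerm, map_mul, map_mul, map_pow,
      map_pow, map_natCast, map_natCast, mul_comm]
  rw [kerSigmaOne_pow_of_eq_mul q h1, ← RingHom.coe_pow, map_mul, map_pow, map_natCast,
    RingHom.coe_pow, iterate_sigma_teichmuller]

/-- Iterating `σ₁` on `p ^ i [b]` consumes the factors `p` and raises `b` to `p`-powers. The
exponent `n + 2 k + 1` works for all `i`, in two ranges. -/
theorem kerSigmaOne_pow_teichTerm_mem {n : ℕ} (hn : ∀ (i : ℕ), ∀ a ∈ idealJ p R ^ p ^ i,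
    frobRoot p i a ^ p ^ n ∈ idealJ p R) (k : ℕ) {i : ℕ} {a : Perfection R p}
    (ha : a ∈ idealJ p R ^ p ^ i) :
    ((kerSigmaOne p R ^ (n + 2 * k + 1)) ⟨_, ofD_iota_mem_ker_kappa (teichTerm_mem ha)⟩ :
      Acris p R) ∈ pPow p (Acris p R) k := by
  rcases lt_or_ge i (n + k + 1) with hi | hi
  -- For `i ≤ n + k`, the first `i` steps produce `[a]` with `a ∈ J`. Of the remaining steps one
  -- prepares the divided power and the other `n + 2 k - i ≥ k` each gain a factor `p`.
  · have h1 : n + 2 * k + 1 = (n + 2 * k - i + 1) + i := by omega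
    rw [h1, pow_add, AddMonoid.End.coe_mul, Function.comp_apply]
    refine pPow_anti (by omega : k ≤ n + 2 * k - i) (kerSigmaOne_pow_succ_mem ?_)
    rw [kerSigmaOne_pow_teichTerm le_rfl ha, Nat.sub_self, pow_zero, one_mul, frobRoot_pow]
    have ha' : a ∈ idealJ p R := Ideal.pow_le_self (pow_ne_zero i hp.out.ne_zero) ha
    refine Ideal.subset_span ⟨0, ⟨a, ha'⟩, ?_⟩
    rw [zero_add, gamma_one]
    rfl
  -- For larger `i`, after `n + k + 1` steps the element is a multiple of `[c] ^ (p ^ (k + 1))` with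
  -- `c = b ^ (p ^ n)` in `J`. This is divisible enough, and the last `k` steps do no harm.
  · have h1 : n + 2 * k + 1 = k + (n + (k + 1)) := by omega
    rw [h1, pow_add, AddMonoid.End.coe_mul, Function.comp_apply]
    have h2 : ((kerSigmaOne p R ^ (n + (k + 1))) ⟨_, ofD_iota_mem_ker_kappa (teichTerm_mem ha)⟩ :
        Acris p R) ∈ teichIdealPow p R (k + 1) := by
      rw [kerSigmaOne_pow_teichTerm (q := n + (k + 1)) hi ha, pow_add p n, pow_mul]
      exact Ideal.mul_mem_left _ _
        (teichmuller_pow_mem_teichIdealPow k.succ_ne_zero (hn i a ha))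
    refine pPow_anti (by omega : k ≤ k + 1 + k) (mem_pPow_iff_mem_span.2 ?_)
    exact teichIdealPow_le _ (kerSigmaOne_pow_mem_teichIdealPow k h2)

theorem exists_kerSigmaOne_pow_mem (hb : IsIsoBalanced p R) (k : ℕ) : ∃ m : ℕ,
    ∀ x : RingHom.ker (kappaRingHom p R),
      ((kerSigmaOne p R ^ m) x : Acris p R) ∈ pPow p (Acris p R) k := by
  obtain ⟨n, hn⟩ := hb.exists_pow_mem
  refine ⟨n + 2 * k + 1, fun x => ?_⟩
  set m := n + 2 * k + 1 with hm
  -- Precision `m + k` is needed because `σ₁ ^ m` costs `m` powers of `p` on the remainder. The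
  -- Teichmüller terms and `e` lie in the kernel, hence so does the remainder, and `σ₁ ^ m` can be
  -- applied to each summand.
  obtain ⟨w, hw, e, he, h⟩ := exists_teichTerm_decomposition (m + k) x.2
  let t : ℕ → RingHom.ker (kappaRingHom p R) := fun i =>
    ⟨_, ofD_iota_mem_ker_kappa (teichTerm_mem (hw i))⟩
  let e' : RingHom.ker (kappaRingHom p R) := ⟨e, teichIdeal_le_ker_kappa he⟩
  let y : RingHom.ker (kappaRingHom p R) := x - ∑ i ∈ Finset.range (m + k), t i - e'
  have hy : (y : Acris p R) ∈ pPow p (Acris p R) (m + k) := by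
    have h1 : (y : Acris p R) = x - ∑ i ∈ Finset.range (m + k),
        ofD p R (iota p R (teichTerm i (w.coeff i))) - e := by
      simp only [y, t, e', Submodule.coe_sub, Submodule.coe_sum]
    rw [h1]
    exact h
  have hx : x = y + ∑ i ∈ Finset.range (m + k), t i + e' := by simp only [y]; abel
  rw [hx, map_add, map_add, map_sum, Submodule.coe_add, Submodule.coe_add, Submodule.coe_sum]
  refine add_mem (add_mem (kerSigmaOne_pow_mem_pPow hy) (sum_mem fun i _ => ?_)) ?_
  · exact kerSigmaOne_pow_teichTerm_mem hn k (hw i)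
  · exact pPow_anti (by omega : k ≤ n + 2 * k) (kerSigmaOne_pow_succ_mem (x := e') he)

/-- The ideal of `A_cris(R)` generated by `σ₁ ^ m (Ker ϰ)`. -/
noncomputable def kerSigmaOneIdeal (m : ℕ) : Ideal (Acris p R) :=
  Ideal.span (Set.range fun x : RingHom.ker (kappaRingHom p R) =>
    ((kerSigmaOne p R ^ m) x : Acris p R))

theorem sigmaOne_mem_kerSigmaOneIdeal {m : ℕ} {z : Acris p R} (hz : z ∈ kerSigmaOneIdeal m) :
    ∃ h, Acris.sigmaOne p R ⟨z, h⟩ ∈ kerSigmaOneIdeal (m + 1) := by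
  refine sigmaOne_mem_of_mem_span ?_ hz
  rintro _ ⟨x, rfl⟩
  refine ⟨ker_kappa_le_ker_toR ((kerSigmaOne p R ^ m) x).2, Ideal.subset_span ⟨x, ?_⟩⟩
  change ((kerSigmaOne p R ^ (m + 1)) x : Acris p R) = _
  rw [pow_succ', AddMonoid.End.coe_mul, Function.comp_apply]
  rfl

/-- The filtration consists of the ideals generated by `σ₁ ^ m (Ker ϰ)`. A bound for one `m`
persists for `j ≥ m` because `σ₁ ^ j = σ₁ ^ m ∘ σ₁ ^ (j - m)` on the kernel. -/
theorem kappa_isNilThickening (hb : IsIsoBalanced p R) : (kappa p R).IsNilThickening where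
  surjective := kappa_surjective
  mem_fil _ ha := mem_ker_toR_of_kappa_mem ha
  u_eq_one := rfl
  complete := PComplete.of_isPrecomplete (S := Acris p R)
  separated := PSeparated.of_isHausdorff (S := Acris p R)
  separated_target := PSeparated.of_isHausdorff (S := AJ p R)
  σ₁_p := ⟨Acris.p_mem, Acris.sigmaOne_p⟩
  nilpotent := by
    refine ⟨kerSigmaOneIdeal (p := p) (R := R), ?_, fun m a ha => sigmaOne_mem_kerSigmaOneIdeal ha,
      fun k => ?_⟩
    · change Ideal.span _ = RingHom.ker (kappaRingHom p R)
      have h : (Set.range fun x : RingHom.ker (kappaRingHom p R) =>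
          ((kerSigmaOne p R ^ 0) x : Acris p R)) = RingHom.ker (kappaRingHom p R) :=
        Subtype.range_coe
      rw [h, Ideal.span_eq]
    · obtain ⟨m, hm⟩ := exists_kerSigmaOne_pow_mem hb k
      refine ⟨m, fun j hj a ha => mem_pPow_iff_mem_span.2 ?_⟩
      refine (Ideal.span_le.2 ?_ : kerSigmaOneIdeal j ≤ Ideal.span {(p : Acris p R)} ^ k) ha
      rintro _ ⟨x, rfl⟩
      change ((kerSigmaOne p R ^ j) x : Acris p R) ∈ _
      rw [SetLike.mem_coe, ← Nat.add_sub_cancel' hj, pow_add, AddMonoid.End.coe_mul,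
        Function.comp_apply, ← mem_pPow_iff_mem_span]
      exact hm _

end KernelOfKappa

end SemiperfectFrames

theorem mainTheorem8 (p : ℕ) [Fact p.Prime] (R : Type*) [CommRing R] [CharP R p]
    (hR : SemiperfectFrames.IsSemiperfect p R) (hb : SemiperfectFrames.IsIsoBalanced p R) :
    (SemiperfectFrames.kappa p R).IsCrystalline := by
  exact (SemiperfectFrames.kappa_isNilThickening hb).isCrystalline
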